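/- **Setting.** Let $\mathcal X\subseteq\mathbb R^{d_x}$ be closed and convex, and let $\mathcal Y=\{y\in\mathbb R^{d_y}: g_i(y)\le 0\ (i\le m_1),\ \langle a_j,y\rangle=b_j\ (j\le m_2)\}$ be nonempty and bounded, with $g_i$ convex and $C^2$. Let $f,g:\mathbb R^{d_x}\times\mathbb R^{d_y}\to\mathbb R$ be $C^2$ with, on $\mathcal X\times\mathcal Y$, $\|\nabla^2 f\|\le l_{f,1}$, $\|\nabla^2 g\|\le l_{g,1}$ (Hessians in $(x,y)$ jointly, operator norm), $\|\nabla_y f\|\le l_{f,0}$ and $|f|\le C_f$. Put $$h_\sigma(x,y)=\sigma f(x,y)+g(x,y),\quad T(x,\sigma)=\arg\min_{y\in\mathcal Y}h_\sigma(x,y),\quad \psi(x)=\min_{y\in T(x,0)}f(x,y),$$ $$\psi_\sigma(x)=\tfrac1\sigma\Big(\min_{y\in\mathcal Y}h_\sigma(x,y)-\min_{z\in\mathcal Y}g(x,z)\Big)\quad(\sigma>0).$$ Let $\rho,\mu,\delta,\sigma_0>0$ with $\rho\,(l_{g,1}+\sigma_0l_{f,1})<1$, and write $\mathrm{prox}_{\rho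 h_\sigma(x,\cdot)}(y)=\arg\min_{z\in\mathcal Y}\{\rho h_\sigma(x,z)+\frac12\|z-y\|^2\}$. Assume the proximal error bound: for all $x\in\mathcal X$, $\sigma\in[0,\sigma_0]$ and $y\in\mathcal Y$, $$\rho^{-1}\|y-\mathrm{prox}_{\rho h_\sigma(x,\cdot)}(y)\|\le\delta\ \Longrightarrow\ \mu\,\inf_{t\in T(x,\sigma)}\|y-t\|\le\rho^{-1}\|y-\mathrm{prox}_{\rho h_\sigma(x,\cdot)}(y)\|.$$ **Theorem.** (i) For every $x\in\mathcal X$ and every $\sigma>0$ with $\sigma\le\sigma_0$ and $2C_f\sigma\le\delta$, $$0\le\psi(x)-\psi_\sigma(x)\le\frac{l_{f,0}^2}{2\mu}\,\sigma .$$ (ii) Let $0\le l_{h,2}$, and let the constants be normalized so that $\mu\le1$, $0<s_{\min}\le1$, $l_{f,0}\ge1$, $l_{g,1}\ge1$. Let $\kappa$ be such that $l_{f,1}\le\kappa l_{g,1}$ and $\|\nabla^2g_i\|\le\kappa l_{g,1}$ on $\mathcal Y$ for all $i$. Suppose that at a given $x\in\mathcal X$ there are a set $\mathcal I$ and a continuous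 path $\sigma\mapsto y^*(\sigma)\in T(x,\sigma)$, $\sigma\in[0,\sigma_0]$, such that for every $\sigma\in[0,\sigma_0]$: * $\mathcal I=\{i: g_i(y^*(\sigma))=0\}$; the vectors $\nabla g_i(y^*(\sigma))$ ($i\in\mathcal I$) and $a_j$ ($j\le m_2$) are linearly independent (LICQ), and the matrix with these columns has minimum singular value at least $s_{\min}$; * there are multipliers $\lambda_i(\sigma)>0$ ($i\in\mathcal I$, strict complementarity) and $\nu_j(\sigma)\in\mathbb R$ with $\lambda_i(\sigma)\le\Lambda$, $|\nu_j(\sigma)|\le\Lambda$ and $\nabla_yh_\sigma(x,y^*(\sigma))+\sum_{i\in\mathcal I}\lambda_i(\sigma)\nabla g_i(y^*(\sigma))+\sum_j\nu_j(\sigma)a_j=0$; * $\nabla^2f$ and $\nabla^2g$ are $l_{h,2}$-Lipschitz at $(x,y^*(\sigma))$ relative to $\mathcal X\times\mathcal Y$, and each $\nabla^2g_i$ is $l_{h,2}$-Lipschitz at $y^*(\sigma)$ relative to $\mathcal Y$. Here $H$ is $K$-Lipschitz at $p$ relative to $S$ if $\|H(q)-H(p)\|\le K\|q-p\|$ for all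 $q\in S$ close to $p$. Then $\psi$ is differentiable at $x$ and, for every $\sigma>0$ with $\sigma\le\min\{\sigma_0,1\}$ and $2C_f\sigma\le\delta$, so is $\psi_\sigma$, and $$\|\nabla\psi_\sigma(x)-\nabla\psi(x)\|\le C\left(\frac{l_{g,1}^4l_{f,0}^3}{\mu^3s_{\min}^3}+\frac{l_{h,2}\,l_{g,1}^2l_{f,0}^3}{\mu^3s_{\min}^2}\right)\sigma ,$$ where $C$ depends only on $m_1$, $\kappa$ and $\Lambda$. Differentiability and gradients at $x$ are relative to $\mathcal X$: the gradient is the vector in the linear span of $\mathcal X-\mathcal X$ that gives the first-order expansion along $\mathcal X$. At interior points of $\mathcal X$ this is the ordinary gradient. -/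

import Mathlib

open Set Filter Topology

noncomputable section

/-- `d`-dimensional Euclidean space. -/
abbrev Euc (d : ℕ) : Type := EuclideanSpace ℝ (Fin d)

/-- The Euclidean product space, with norm `‖(x, y)‖² = ‖x‖² + ‖y‖²`. -/
abbrev EucProd (m n : ℕ) : Type := WithLp 2 (Euc m × Euc n)

/-- The point `(x, y)` of the Euclidean product. -/
def pairPt {m n : ℕ} (x : Euc m) (y : Euc n) : EucProd m n := WithLp.toLp 2 (x, y)

/-- A function of two variables as a function of the joint variable `(x, y)`. -/
def jointFun {m n : ℕ} (φ : Euc m → Euc n → ℝ) : EucProd m n → ℝ :=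
  fun z => φ z.fst z.snd

/-- The set `X × Y` inside the Euclidean product. -/
def jointSet {m n : ℕ} (X : Set (Euc m)) (Y : Set (Euc n)) : Set (EucProd m n) :=
  {z | z.fst ∈ X ∧ z.snd ∈ Y}

/-- The Hessian as a bilinear form; its norm is the operator norm. -/
def hessForm {E : Type*} [NormedAddCommGroup E] [NormedSpace ℝ E] (φ : E → ℝ) (z : E) :
    E →L[ℝ] E →L[ℝ] ℝ :=
  fderiv ℝ (fderiv ℝ φ) z

/-- `H` is `K`-Lipschitz at the point `p`, relative to the set `S`. -/
def LipAtPoint {E G : Type*} [NormedAddCommGroup E] [NormedAddCommGroup G]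
    (H : E → G) (S : Set E) (K : ℝ) (p : E) : Prop :=
  ∀ᶠ q in 𝓝[S] p, ‖H q - H p‖ ≤ K * ‖q - p‖

/-- The set of minimizers of `φ` over `S`. -/
def argminSet {E : Type*} (φ : E → ℝ) (S : Set E) : Set E :=
  {y | y ∈ S ∧ ∀ z ∈ S, φ y ≤ φ z}

/-- The minimal value of `φ` over `S`. -/
def minVal {E : Type*} (φ : E → ℝ) (S : Set E) : ℝ := sInf (φ '' S)

/-- The proximal operator of `ρ φ` over `S`, as the set of minimizers of
`z ↦ ρ φ z + ‖z - y‖² / 2`. -/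
def proxSet {E : Type*} [NormedAddCommGroup E] (ρ : ℝ) (φ : E → ℝ) (S : Set E) (y : E) : Set E :=
  argminSet (fun z => ρ * φ z + (1 / 2) * ‖z - y‖ ^ 2) S

/-- `v` is the gradient of `φ` at `x` relative to the convex set `X`: the first-order expansion
holds along `X`, and `v` is tangent to the affine span of `X`. The last condition makes `v` unique;
it is vacuous when `X` has interior points, and at interior points `v` is the usual gradient. -/
def HasRelGradient {E : Type*} [NormedAddCommGroup E] [InnerProductSpace ℝ E] [CompleteSpace E]
    (φ : E → ℝ) (v : E) (X : Set E) (x : E) : Prop :=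
  HasGradientWithinAt φ v X x ∧ v ∈ vectorSpan ℝ X

/-- The data of a bilevel problem: objectives `f` (upper) and `g` (lower), the upper domain `X`,
and the constraints `c i y ≤ 0` and `⟪a j, y⟫ = b j` that cut out the lower domain. -/
structure Bilevel (dx dy m₁ m₂ : ℕ) where
  f : Euc dx → Euc dy → ℝ
  g : Euc dx → Euc dy → ℝ
  X : Set (Euc dx)
  c : Fin m₁ → Euc dy → ℝ
  a : Fin m₂ → Euc dy
  b : Fin m₂ → ℝ

namespace Bilevel

variable {dx dy m₁ m₂ : ℕ} (P : Bilevel dx dy m₁ m₂)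

/-- The lower-level domain. -/
def Y : Set (Euc dy) := {y | (∀ i, P.c i y ≤ 0) ∧ ∀ j, inner ℝ (P.a j) y = P.b j}

/-- The perturbed lower-level objective `h_σ(x, y) = σ f(x, y) + g(x, y)`. -/
def h (σ : ℝ) (x : Euc dx) (y : Euc dy) : ℝ := σ * P.f x y + P.g x y

/-- The solution set `T(x, σ)` of the perturbed lower-level problem. -/
def T (x : Euc dx) (σ : ℝ) : Set (Euc dy) := argminSet (P.h σ x) P.Y

/-- The hyper-objective: the minimum of `f(x, ·)` over the minimizers of `g(x, ·)` in `Y`. -/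
def psi (x : Euc dx) : ℝ := minVal (P.f x) (argminSet (P.g x) P.Y)

/-- The penalized hyper-objective. -/
def psiPen (σ : ℝ) (x : Euc dx) : ℝ :=
  (1 / σ) * (minVal (P.h σ x) P.Y - minVal (P.g x) P.Y)

/-- Smoothness of the objectives, and the conditions on the two domains. -/
structure Smooth (lf0 lf1 lg1 Cf : ℝ) : Prop where
  f_contDiff : ContDiff ℝ 2 (jointFun P.f)
  g_contDiff : ContDiff ℝ 2 (jointFun P.g)
  f_hess : ∀ x ∈ P.X, ∀ y ∈ P.Y, ‖hessForm (jointFun P.f) (pairPt x y)‖ ≤ lf1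
  g_hess : ∀ x ∈ P.X, ∀ y ∈ P.Y, ‖hessForm (jointFun P.g) (pairPt x y)‖ ≤ lg1
  f_grad : ∀ x ∈ P.X, ∀ y ∈ P.Y, ‖gradient (P.f x) y‖ ≤ lf0
  f_bdd : ∀ x ∈ P.X, ∀ y ∈ P.Y, |P.f x y| ≤ Cf
  X_convex : Convex ℝ P.X
  X_closed : IsClosed P.X
  c_convex : ∀ i, ConvexOn ℝ Set.univ (P.c i)
  c_contDiff : ∀ i, ContDiff ℝ 2 (P.c i)
  Y_bounded : Bornology.IsBounded P.Y
  Y_nonempty : P.Y.Nonempty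

/-- The `(μ, δ)`-proximal error bound with proximal parameter `ρ`, for all `x ∈ X` and all
`σ ∈ [0, σ₀]`. -/
def ProxEB (ρ μ δ σ₀ : ℝ) : Prop :=
  ∀ x ∈ P.X, ∀ σ ∈ Set.Icc 0 σ₀, ∀ y ∈ P.Y, ∀ p ∈ proxSet ρ (P.h σ x) P.Y y,
    ρ⁻¹ * ‖y - p‖ ≤ δ → μ * Metric.infDist y (P.T x σ) ≤ ρ⁻¹ * ‖y - p‖

/-- Linear independence constraint qualification at `y` with active inequality constraints `I`. -/
def LICQ (I : Finset (Fin m₁)) (y : Euc dy) : Prop :=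
  LinearIndependent ℝ
    (Sum.elim (fun i : {i // i ∈ I} => gradient (P.c i.1) y) P.a : _ → Euc dy)

/-- The matrix of active constraint gradients `[∇ c i (y), i ∈ I | ∇ (equality constraints)]` has
minimum singular value at least `s`. -/
def MinSingGE (I : Finset (Fin m₁)) (s : ℝ) (y : Euc dy) : Prop :=
  ∀ (v : Fin m₁ → ℝ) (w : Fin m₂ → ℝ),
    s * Real.sqrt ((∑ i ∈ I, v i ^ 2) + ∑ j, w j ^ 2) ≤
      ‖(∑ i ∈ I, v i • gradient (P.c i) y) + ∑ j, w j • P.a j‖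

/-- At `(x, σ)` the point `y` is a solution of the perturbed lower-level problem with active set
`I` at which LICQ holds and `lam`, `nu` are Lagrange multipliers with strict complementarity. -/
structure RegularSol (x : Euc dx) (σ : ℝ) (I : Finset (Fin m₁)) (y : Euc dy)
    (lam : Fin m₁ → ℝ) (nu : Fin m₂ → ℝ) : Prop where
  mem : y ∈ P.T x σ
  active : ∀ i, i ∈ I ↔ P.c i y = 0
  licq : P.LICQ I y
  kkt : gradient (P.h σ x) y + (∑ i ∈ I, lam i • gradient (P.c i) y) + ∑ j, nu j • P.a j = 0
  strict : ∀ i ∈ I, 0 < lam i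

/-- A regular solution path `y` over `[0, σ₀]` at the given `x`: a continuous path of regular
solutions with a common active set, with multipliers bounded by `Λ`, with active constraint
gradients of minimum singular value at least `s`, and with Hessians of `f`, `g` and of the
inequality constraints that are `lh2`-Lipschitz at the points of the path. -/
structure RegularPath (x : Euc dx) (σ₀ s lh2 Λ : ℝ) (I : Finset (Fin m₁)) (y : ℝ → Euc dy)
    (lam : ℝ → Fin m₁ → ℝ) (nu : ℝ → Fin m₂ → ℝ) : Prop where
  cont : ContinuousOn y (Set.Icc 0 σ₀)
  regular : ∀ σ ∈ Set.Icc 0 σ₀, P.RegularSol x σ I (y σ) (lam σ) (nu σ)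
  lam_le : ∀ σ ∈ Set.Icc 0 σ₀, ∀ i ∈ I, lam σ i ≤ Λ
  nu_le : ∀ σ ∈ Set.Icc 0 σ₀, ∀ j, |nu σ j| ≤ Λ
  sing : ∀ σ ∈ Set.Icc 0 σ₀, P.MinSingGE I s (y σ)
  f_lip : ∀ σ ∈ Set.Icc 0 σ₀,
    LipAtPoint (hessForm (jointFun P.f)) (jointSet P.X P.Y) lh2 (pairPt x (y σ))
  g_lip : ∀ σ ∈ Set.Icc 0 σ₀,
    LipAtPoint (hessForm (jointFun P.g)) (jointSet P.X P.Y) lh2 (pairPt x (y σ))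
  c_lip : ∀ σ ∈ Set.Icc 0 σ₀, ∀ i, LipAtPoint (hessForm (P.c i)) P.Y lh2 (y σ)

end Bilevel

end

noncomputable section

/-! Everything rests on one consequence of the proximal error bound: near its minimizers, `h_σ(x,·)`
grows at least like `μ/2` times the squared distance to `T(x,σ)` (`sq_growth_of_prox_error_bound`).
This makes solutions Lipschitz in `(x,σ)` in the set sense (`exists_near_mem_T`). Comparing
optimality at `σ` and at a slightly larger parameter then shows that `f(x,·)` is constant on
`T(x,σ)` for `σ < σ₀`, so `ψ(x) = f(x,y)` for any `y ∈ T(x,0)`.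

Part (i): the value `v(σ) = min h_σ(x,·)` lies below its tangent with slope `f(x,y₀)`, which gives
the sign. Quadratic growth and Young's inequality show that `v(σ) + lf0²/(2μ) σ²` has a local affine
support from below at every point, hence lies above its support line at `0`, which gives the upper
bound.

Part (ii): Danskin's theorem gives `σ∇ψ_σ = ∇ₓh_σ(x,y_σ) - ∇ₓh_0(x,y_0)`, so the task is to expand
`p(σ) = ∇ₓh_σ(x,y_σ)` around `0` with quadratic remainder. Solutions need not be unique and the
Hessian of the Lagrangian may be singular on the critical subspace, so the path cannot simply be
differentiated by the implicit function theorem. Three facts replace invertibility. Strict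
complementarity and independence keep the active set and the multipliers stable
(`RegularSol.eventually_active_and_multipliers`). The right-hand sides that occur, `∇_y f` and the
mixed Hessian applied to a feasible direction, annihilate the kernel, because solutions persist
under perturbation of `σ` and `x` (`RegularSol.fderiv_f_kernel`,
`RegularSol.hessForm_mixed_kernel`). Orthogonally to the kernel the Hessian is coercive with
constant `μ`, by quadratic growth (`RegularSol.coercive`). The linearized systems are thus solvable
with bounds.

An adjoint argument removes the unknown displacement of the solution: it yields `∇ψ(x)`
(`hasFDerivWithinAt_psi`) and a local expansion of `p` at each `t` with a constant independent of
`t` (`RegularSol.local_expansion`). The derivative of `p` at `0` equals `∇ψ(x)`, and the local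
expansions add up to a global one by the same support-line principle as in part (i). -/

/-! ### Quadratic growth and stability of minimizers from the proximal error bound. -/

/-- A variational-principle argument. If growth fails at `y`, minimizing a proximal energy minus a
suitable quadratic in the distance to `y` produces a point `z` whose proximal residual is less than
`μ (D - ‖z - y‖)`, while its distance to the minimizers is at least `D - ‖z - y‖`. This contradicts
the error bound. Convexity of `φ` plays no role. -/
theorem sq_growth_of_prox_error_bound {E : Type*} [NormedAddCommGroup E] [NormedSpace ℝ E]
    {S : Set E} {φ : E → ℝ} {ρ μ δ : ℝ} (hS : IsCompact S) (hSc : Convex ℝ S)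
    (hφ : ContinuousOn φ S) (hρ : 0 < ρ) (hμ : 0 < μ)
    (hEB : ∀ y ∈ S, ∀ p ∈ proxSet ρ φ S y, ρ⁻¹ * ‖y - p‖ ≤ δ →
      μ * Metric.infDist y (argminSet φ S) ≤ ρ⁻¹ * ‖y - p‖)
    {y t : E} (hy : y ∈ S) (ht : t ∈ argminSet φ S) {D : ℝ} (hD0 : 0 ≤ D)
    (hD : D ≤ Metric.infDist y (argminSet φ S)) (hDδ : μ * D ≤ δ) :
    μ / 2 * D ^ 2 ≤ φ y - φ t := by
  by_contra! hlt
  have hDpos : 0 < D := by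
    rcases hD0.eq_or_lt with h | h
    · subst h
      have := ht.2 y hy
      norm_num at hlt; linarith
    · exact h
  -- The slack `θ < 1` turns the final comparison into a strict inequality.
  obtain ⟨θ, hθ0, hθ1, hθ⟩ : ∃ θ : ℝ, 0 < θ ∧ θ < 1 ∧ φ y - φ t < θ * (μ / 2 * D ^ 2) := by
    have hc : 0 < μ / 2 * D ^ 2 := by positivity
    have h1 : (φ y - φ t) / (μ / 2 * D ^ 2) < 1 := (div_lt_one hc).2 hlt
    have h0 : 0 ≤ (φ y - φ t) / (μ / 2 * D ^ 2) :=
      div_nonneg (sub_nonneg.2 (ht.2 y hy)) hc.le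
    obtain ⟨θ, h2, h3⟩ := exists_between h1
    exact ⟨θ, h0.trans_lt h2, h3, (div_lt_iff₀ hc).1 h2⟩
  -- Minimizing over the second variable gives the Moreau envelope of `φ` at the first. The
  -- subtracted term has slope `θ μ (D - r)` in the radius `r`, which is the residual bound wanted.
  let Ψ : E × E → ℝ := fun q =>
    φ q.2 + (1 / (2 * ρ)) * ‖q.2 - q.1‖ ^ 2 - θ * (μ / 2 * (D - ‖q.1 - y‖) ^ 2)
  have hK : IsCompact ((S ∩ Metric.closedBall y D) ×ˢ S) :=
    (hS.inter_right Metric.isClosed_closedBall).prod hS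
  have hΨ : ContinuousOn Ψ ((S ∩ Metric.closedBall y D) ×ˢ S) := by
    have h1 : ContinuousOn (fun q : E × E => φ q.2) ((S ∩ Metric.closedBall y D) ×ˢ S) :=
      hφ.comp continuousOn_snd fun q hq => hq.2
    have h2 : Continuous (fun q : E × E => (1 / (2 * ρ)) * ‖q.2 - q.1‖ ^ 2) := by fun_prop
    have h3 : Continuous (fun q : E × E => θ * (μ / 2 * (D - ‖q.1 - y‖) ^ 2)) := by fun_prop
    exact (h1.add h2.continuousOn).sub h3.continuousOn
  obtain ⟨⟨z, p⟩, ⟨⟨hzS, hzb⟩, hpS⟩, hmin⟩ :=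
    hK.exists_isMinOn ⟨(y, y), ⟨hy, Metric.mem_closedBall_self hD0⟩, hy⟩ hΨ
  simp only [Metric.mem_closedBall, dist_eq_norm] at hzb hzS hpS
  have hmin' : ∀ z' ∈ S, ‖z' - y‖ ≤ D → ∀ p' ∈ S, Ψ (z, p) ≤ Ψ (z', p') := fun z' h1 h2 p' h3 =>
    hmin ⟨⟨h1, by simpa [dist_eq_norm] using h2⟩, h3⟩
  have hprox : p ∈ proxSet ρ φ S z := by
    refine ⟨hpS, fun p' hp' => ?_⟩
    have := hmin' z hzS hzb p' hp'
    simp only [Ψ] at this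
    have h4 : φ p + 1 / (2 * ρ) * ‖p - z‖ ^ 2 ≤ φ p' + 1 / (2 * ρ) * ‖p' - z‖ ^ 2 := by linarith
    have h5 := mul_le_mul_of_nonneg_left h4 hρ.le
    have h6 : ∀ a b : ℝ, ρ * (a + 1 / (2 * ρ) * b) = ρ * a + 1 / 2 * b := by
      intro a b; field_simp
    rwa [h6, h6] at h5
  -- On the sphere the subtracted term vanishes, so `Ψ ≥ φ t` there, whereas `Ψ (y, y) < φ t` by the
  -- choice of `θ`.
  have hr : ‖z - y‖ < D := by
    refine lt_of_le_of_ne hzb fun h => ?_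
    have h1 := hmin' y hy (by simpa using hD0) y hy
    simp only [Ψ, h, sub_self, norm_zero] at h1
    have h2 := ht.2 p hpS
    have h3 : 0 ≤ 1 / (2 * ρ) * ‖p - z‖ ^ 2 := by positivity
    norm_num at h1
    norm_num at h3
    linarith
  set r := ‖z - y‖ with hrdef
  set a := ‖p - z‖ with hadef
  have ha0 : 0 ≤ a := norm_nonneg _
  -- Move `z` a fraction `s` towards `p` with `p` fixed: the proximal term drops at rate `a²/ρ`, the
  -- subtracted term changes at rate at most `θ μ (D - r) a`. Minimality compares the two as `s →
  -- 0`.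
  have key : ρ⁻¹ * a ≤ θ * μ * (D - r) := by
    rcases ha0.eq_or_lt with h | hapos
    · rw [← h, mul_zero]; have := sub_pos.2 hr; positivity
    have hs : ∀ᶠ s in 𝓝[>] (0 : ℝ), (1 - s / 2) * (ρ⁻¹ * a) ≤ θ * μ * (D - r) := by
      have hs0 : 0 < min 1 ((D - r) / a) := lt_min one_pos (div_pos (sub_pos.2 hr) hapos)
      filter_upwards [Ioo_mem_nhdsGT hs0] with s hs
      have hspos : 0 < s := hs.1
      have hs1 : s ≤ 1 := hs.2.le.trans (min_le_left _ _)
      have hs2 : s * a ≤ D - r := (le_div_iff₀ hapos).1 (hs.2.le.trans (min_le_right _ _))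
      have hz' : z + s • (p - z) ∈ S := hSc.add_smul_sub_mem hzS hpS ⟨hspos.le, hs1⟩
      have hrs : ‖z + s • (p - z) - y‖ ≤ r + s * a := by
        calc ‖z + s • (p - z) - y‖ = ‖(z - y) + s • (p - z)‖ := by congr 1; abel
          _ ≤ _ := norm_add_le _ _
          _ = r + s * a := by rw [norm_smul, Real.norm_of_nonneg hspos.le]
      have h1 := hmin' _ hz' (hrs.trans (by linarith)) p hpS
      simp only [Ψ] at h1
      rw [← hrdef, ← hadef] at h1
      have h2 : ‖p - (z + s • (p - z))‖ = (1 - s) * a := by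
        rw [show p - (z + s • (p - z)) = (1 - s) • (p - z) by module, norm_smul,
          Real.norm_of_nonneg (by linarith)]
      rw [h2] at h1
      have h3 : (D - r - s * a) ^ 2 ≤ (D - ‖z + s • (p - z) - y‖) ^ 2 := by
        apply pow_le_pow_left₀ <;> linarith
      have h4 := mul_le_mul_of_nonneg_left h3 (show 0 ≤ θ * (μ / 2) by positivity)
      have h5 : 1 / (2 * ρ) * (a ^ 2 - ((1 - s) * a) ^ 2) ≤
          θ * (μ / 2) * ((D - r) ^ 2 - (D - r - s * a) ^ 2) := by linarith
      have h6 : 1 / (2 * ρ) * (a ^ 2 - ((1 - s) * a) ^ 2) =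
          (s * a) * ((1 - s / 2) * (ρ⁻¹ * a)) := by field_simp; ring
      have h7 : θ * (μ / 2) * ((D - r) ^ 2 - (D - r - s * a) ^ 2) ≤
          (s * a) * (θ * μ * (D - r)) := by
        have : 0 ≤ θ * (μ / 2) * (s * a) ^ 2 := by positivity
        linarith
      exact le_of_mul_le_mul_left ((h6 ▸ h5).trans h7) (by positivity)
    have hlim : Tendsto (fun s : ℝ => (1 - s / 2) * (ρ⁻¹ * a)) (𝓝[>] 0) (𝓝 (ρ⁻¹ * a)) := by
      have : Continuous (fun s : ℝ => (1 - s / 2) * (ρ⁻¹ * a)) := by fun_prop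
      simpa using (this.tendsto 0).mono_left nhdsWithin_le_nhds
    exact le_of_tendsto hlim hs
  have hza : ‖z - p‖ = a := norm_sub_rev _ _
  have hμDr : θ * μ * (D - r) < μ * (D - r) := by
    have h : 0 < μ * (D - r) := mul_pos hμ (sub_pos.2 hr)
    nlinarith
  have hr0 : 0 ≤ r := norm_nonneg _
  have h1 := hEB z hzS p hprox (by rw [hza]; nlinarith)
  rw [hza] at h1
  have h2 : Metric.infDist y (argminSet φ S) ≤ Metric.infDist z (argminSet φ S) + r := by
    have := Metric.infDist_le_infDist_add_dist (s := argminSet φ S) (x := y) (y := z)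
    rwa [dist_comm, dist_eq_norm] at this
  nlinarith

theorem argminSet_isCompact {E : Type*} [TopologicalSpace E] {S : Set E} {φ : E → ℝ}
    (hS : IsCompact S) (hφ : ContinuousOn φ S) : IsCompact (argminSet φ S) := by
  rcases (argminSet φ S).eq_empty_or_nonempty with h | ⟨t, ht⟩
  · rw [h]; exact isCompact_empty
  have : argminSet φ S = S ∩ {y | φ y ≤ φ t} := by
    ext y
    exact ⟨fun hy => ⟨hy.1, hy.2 t ht.1⟩, fun hy => ⟨hy.1, fun z hz => hy.2.trans (ht.2 z hz)⟩⟩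
  rw [this]
  obtain ⟨u, hu, h⟩ := (continuousOn_iff_isClosed.1 hφ) (Iic (φ t)) isClosed_Iic
  have h' : S ∩ {y | φ y ≤ φ t} = S ∩ u := by
    rw [inter_comm S u, ← h, inter_comm]; rfl
  rw [h']
  exact hS.inter_right hu

theorem argminSet_nonempty {E : Type*} [TopologicalSpace E] {S : Set E} {φ : E → ℝ}
    (hS : IsCompact S) (hne : S.Nonempty) (hφ : ContinuousOn φ S) : (argminSet φ S).Nonempty := by
  obtain ⟨t, ht, hm⟩ := hS.exists_isMinOn hne hφ
  exact ⟨t, ht, fun z hz => hm hz⟩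

theorem minVal_eq_of_mem_argminSet {E : Type*} {S : Set E} {φ : E → ℝ} {t : E}
    (ht : t ∈ argminSet φ S) : minVal φ S = φ t :=
  IsLeast.csInf_eq ⟨mem_image_of_mem _ ht.1, by rintro _ ⟨z, hz, rfl⟩; exact ht.2 z hz⟩

/-- Stability of minimizers under perturbations with small Lipschitz constant, with the
resulting quadratic decrease. -/
theorem exists_near_argmin {E : Type*} [NormedAddCommGroup E] [NormedSpace ℝ E]
    {S : Set E} {φ₁ φ₂ : E → ℝ} {ρ μ δ R K : ℝ} (hS : IsCompact S) (hSc : Convex ℝ S)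
    (hR : ∀ a ∈ S, ∀ b ∈ S, ‖a - b‖ ≤ R)
    (hφ₂ : ContinuousOn φ₂ S) (hρ : 0 < ρ) (hμ : 0 < μ) (hδ : 0 < δ)
    (hEB : ∀ y ∈ S, ∀ p ∈ proxSet ρ φ₂ S y, ρ⁻¹ * ‖y - p‖ ≤ δ →
      μ * Metric.infDist y (argminSet φ₂ S) ≤ ρ⁻¹ * ‖y - p‖)
    (hK : ∀ a ∈ S, ∀ b ∈ S, |(φ₂ a - φ₁ a) - (φ₂ b - φ₁ b)| ≤ K * ‖a - b‖) (hK0 : 0 ≤ K)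
    (hsmall : K * R < δ ^ 2 / (2 * μ)) {y : E} (hy : y ∈ argminSet φ₁ S) :
    ∃ t ∈ argminSet φ₂ S, ‖y - t‖ ≤ 2 * K / μ ∧ μ / 2 * ‖y - t‖ ^ 2 ≤ φ₂ y - φ₂ t := by
  obtain ⟨t, ht, hdist⟩ := (argminSet_isCompact hS hφ₂).exists_infDist_eq_dist
    (argminSet_nonempty hS ⟨y, hy.1⟩ hφ₂) y
  rw [dist_eq_norm] at hdist
  have hup : φ₂ y - φ₂ t ≤ K * ‖y - t‖ := by
    have h1 := hy.2 t ht.1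
    have h2 := (abs_le.1 (hK y hy.1 t ht.1)).2
    linarith
  -- Growth is available only up to distance `δ / μ`. If `y` were farther away, growth at that
  -- radius would already exceed `K * R`.
  have hle : μ * ‖y - t‖ ≤ δ := by
    by_contra! h
    have h1 := sq_growth_of_prox_error_bound hS hSc hφ₂ hρ hμ hEB hy.1 ht (D := δ / μ)
      (by positivity) (by rw [hdist, div_le_iff₀ hμ]; linarith) (by field_simp; rfl)
    have h2 : μ / 2 * (δ / μ) ^ 2 = δ ^ 2 / (2 * μ) := by field_simp
    have h3 := mul_le_mul_of_nonneg_left (hR y hy.1 t ht.1) hK0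
    linarith
  have hg := sq_growth_of_prox_error_bound hS hSc hφ₂ hρ hμ hEB hy.1 ht (norm_nonneg (y - t))
    hdist.ge hle
  refine ⟨t, ht, ?_, hg⟩
  rw [le_div_iff₀ hμ]
  rcases (norm_nonneg (y - t)).eq_or_lt with h | h
  · rw [← h]; linarith
  · have : ‖y - t‖ * (‖y - t‖ * μ) ≤ ‖y - t‖ * (2 * K) := by nlinarith
    exact le_of_mul_le_mul_left this h

/-! ### Support lines on an interval, and solvability of symmetric systems. -/

/-- A continuous function with local affine supports from below at every point lies above its
support line at the left end point. -/
theorem add_mul_le_of_forall_local_support {q a : ℝ → ℝ} {σ : ℝ} (hσ : 0 < σ)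
    (hq : ContinuousOn q (Icc 0 σ))
    (h : ∀ t ∈ Ico 0 σ, ∀ᶠ s in 𝓝[Icc 0 σ] t, q t + (s - t) * a t ≤ q s) :
    q 0 + σ * a 0 ≤ q σ := by
  by_contra! hlt
  obtain ⟨ε, hε, hε'⟩ : ∃ ε : ℝ, 0 < ε ∧ q σ - q 0 - σ * a 0 + ε * σ ^ 2 < 0 := by
    refine ⟨(q 0 + σ * a 0 - q σ) / (2 * σ ^ 2), div_pos (by linarith) (by positivity), ?_⟩
    have : (q 0 + σ * a 0 - q σ) / (2 * σ ^ 2) * σ ^ 2 = (q 0 + σ * a 0 - q σ) / 2 := by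
      field_simp
    linarith
  -- The `ε`-term makes the local supports of `k` strictly convex, so at a maximum `t` the slope
  -- must be negative to the right and positive to the left. At `t = 0` the slope is zero, and `t =
  -- σ` is excluded by `k σ < 0 = k 0`.
  let k : ℝ → ℝ := fun s => q s - q 0 - s * a 0 + ε * s ^ 2
  have hk : ContinuousOn k (Icc 0 σ) := by
    have : Continuous fun s : ℝ => s * a 0 := by fun_prop
    have h2 : Continuous fun s : ℝ => ε * s ^ 2 := by fun_prop
    exact ((hq.sub continuousOn_const).sub this.continuousOn).add h2.continuousOn
  obtain ⟨t, htm, htmax⟩ := isCompact_Icc.exists_isMaxOn ⟨0, left_mem_Icc.2 hσ.le⟩ hk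
  have hmax : ∀ s ∈ Icc 0 σ, k s ≤ k t := fun s hs => htmax hs
  have hk0 : k 0 = 0 := by simp [k]
  have htσ : t < σ := by
    refine lt_of_le_of_ne htm.2 fun he => ?_
    have h1 := hmax 0 (left_mem_Icc.2 hσ.le)
    rw [hk0, he] at h1
    exact absurd h1 (not_le.2 hε')
  have hev : ∀ s, q t + (s - t) * a t ≤ q s →
      k t + (s - t) * (a t - a 0 + 2 * ε * t) + ε * (s - t) ^ 2 ≤ k s := by
    intro s hs
    simp only [k]
    linarith
  have hloc := h t ⟨htm.1, htσ⟩
  rw [eventually_nhdsWithin_iff, Metric.eventually_nhds_iff] at hloc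
  obtain ⟨r, hr, hloc⟩ := hloc
  have hgood : ∀ s ∈ Icc 0 σ, |s - t| < r → s ≠ t → (s - t) * (a t - a 0 + 2 * ε * t) < 0 := by
    intro s hs hsr hne
    have h1 := hev s (hloc (by rwa [Real.dist_eq]) hs)
    have h2 := hmax s hs
    have h3 : 0 < ε * (s - t) ^ 2 := mul_pos hε (by have := sub_ne_zero.2 hne; positivity)
    linarith
  have hm : 0 < min (r / 2) (σ - t) := lt_min (by positivity) (by linarith)
  have hR := hgood (t + min (r / 2) (σ - t))
    ⟨by linarith [htm.1], by linarith [min_le_right (r / 2) (σ - t)]⟩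
    (by rw [add_sub_cancel_left, abs_of_pos hm]; linarith [min_le_left (r / 2) (σ - t)])
    (by linarith)
  rw [add_sub_cancel_left] at hR
  have hneg : a t - a 0 + 2 * ε * t < 0 := by
    by_contra! h0; nlinarith
  rcases htm.1.eq_or_lt with h0 | h0
  · rw [← h0] at hneg; simp at hneg
  have hm' : 0 < min (r / 2) t := lt_min (by positivity) h0
  have hL := hgood (t - min (r / 2) t)
    ⟨by linarith [min_le_right (r / 2) t], by linarith [htm.2]⟩
    (by rw [sub_sub_cancel_left, abs_neg, abs_of_pos hm']; linarith [min_le_left (r / 2) t])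
    (by linarith)
  rw [sub_sub_cancel_left] at hL
  nlinarith

/-- Solvability of `M u + b = 0` on a subspace for a symmetric form, with the solution orthogonal
to the kernel. -/
theorem exists_solution_of_symm_form {E : Type*} [NormedAddCommGroup E] [InnerProductSpace ℝ E]
    [FiniteDimensional ℝ E] (M : E →L[ℝ] E →L[ℝ] ℝ) (hM : ∀ u v, M u v = M v u)
    (W : Submodule ℝ E) (b : E →L[ℝ] ℝ)
    (hb : ∀ z ∈ W, (∀ w ∈ W, M z w = 0) → b z = 0) :
    ∃ u ∈ W, (∀ w ∈ W, M u w + b w = 0) ∧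
      ∀ z ∈ W, (∀ w ∈ W, M z w = 0) → inner ℝ u z = 0 := by
  let A : W →ₗ[ℝ] W :=
    { toFun := fun u => (InnerProductSpace.toDual ℝ W).symm ((M u).comp W.subtypeL)
      map_add' := fun u v => by
        rw [← map_add]; congr 1; ext w; simp
      map_smul' := fun r u => by
        rw [RingHom.id_apply, ← LinearIsometryEquiv.map_smul]; congr 1; ext w; simp }
  have hA : ∀ u w : W, inner ℝ (A u) w = M u w := fun u w => by
    simp [A, InnerProductSpace.toDual_symm_apply]
  have hAs : A = LinearMap.adjoint A := by
    rw [LinearMap.eq_adjoint_iff]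
    intro u w
    rw [hA, real_inner_comm, hA, hM]
  let b' : W := (InnerProductSpace.toDual ℝ W).symm (b.comp W.subtypeL)
  have hb' : ∀ w : W, inner ℝ b' w = b w := fun w => by
    simp [b', InnerProductSpace.toDual_symm_apply]
  have hker : ∀ z : W, z ∈ A.ker ↔ ∀ w ∈ W, M z w = 0 := by
    intro z
    rw [LinearMap.mem_ker]
    refine ⟨fun h w hw => ?_, fun h => ext_inner_right ℝ fun w => ?_⟩
    · rw [← hA z ⟨w, hw⟩, h, inner_zero_left]
    · rw [hA, h w w.2, inner_zero_left]
  -- Fredholm alternative: the range of a self-adjoint operator is the orthogonal complement of its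
  -- kernel.
  have hmem : -b' ∈ A.range := by
    rw [hAs, ← LinearMap.orthogonal_ker, Submodule.mem_orthogonal]
    intro z hz
    rw [real_inner_comm, inner_neg_left, hb', hb z z.2 ((hker z).1 hz), neg_zero]
  obtain ⟨u₀, hu₀⟩ := hmem
  obtain ⟨k, hk, u, hu, rfl⟩ := A.ker.exists_add_mem_mem_orthogonal u₀
  rw [map_add, LinearMap.mem_ker.1 hk, zero_add] at hu₀
  refine ⟨u, u.2, fun w hw => ?_, fun z hz h => ?_⟩
  · have := hA u ⟨w, hw⟩
    rw [hu₀, inner_neg_left, hb'] at this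
    simp only at this
    linarith
  · have := (Submodule.mem_orthogonal' _ _).1 hu ⟨z, hz⟩ ((hker ⟨z, hz⟩).2 h)
    simpa using this

/-! ### Calculus of Hessians and of gradients relative to a convex set. -/

section Calculus

theorem norm_smul_add_le_of_le {G : Type*} [NormedAddCommGroup G] [NormedSpace ℝ G] {σ : ℝ}
    (hσ : 0 ≤ σ) {u v : G} {a b : ℝ} (ha : ‖u‖ ≤ a) (hb : ‖v‖ ≤ b) : ‖σ • u + v‖ ≤ σ * a + b := by
  refine (norm_add_le _ _).trans (add_le_add ?_ hb)
  rw [norm_smul, Real.norm_of_nonneg hσ]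
  exact mul_le_mul_of_nonneg_left ha hσ

variable {E : Type*} [NormedAddCommGroup E] [NormedSpace ℝ E]

theorem ContDiff.hasFDerivAt_fderiv {φ : E → ℝ} (hφ : ContDiff ℝ 2 φ) (z : E) :
    HasFDerivAt (fderiv ℝ φ) (hessForm φ z) z :=
  ((hφ.fderiv_right (m := 1) (by norm_num)).differentiable (by norm_num) z).hasFDerivAt

theorem hessForm_symm {φ : E → ℝ} (hφ : ContDiff ℝ 2 φ) (z u v : E) :
    hessForm φ z u v = hessForm φ z v u :=
  (hφ.contDiffAt.isSymmSndFDerivAt (by simp)) u v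

theorem fderiv_const_mul_add {φ γ : E → ℝ} (hφ : ContDiff ℝ 2 φ) (hγ : ContDiff ℝ 2 γ) (σ : ℝ)
    (z : E) : fderiv ℝ (fun z => σ * φ z + γ z) z = σ • fderiv ℝ φ z + fderiv ℝ γ z := by
  have hf := hφ.differentiable (by norm_num) z
  have hg := hγ.differentiable (by norm_num) z
  rw [fderiv_fun_add (hf.const_mul σ) hg, fderiv_const_mul hf]

theorem hessForm_const_mul_add {φ γ : E → ℝ} (hφ : ContDiff ℝ 2 φ) (hγ : ContDiff ℝ 2 γ) (σ : ℝ)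
    (z : E) : hessForm (fun z => σ * φ z + γ z) z = σ • hessForm φ z + hessForm γ z := by
  have h : fderiv ℝ (fun z => σ * φ z + γ z) = fun z => σ • fderiv ℝ φ z + fderiv ℝ γ z :=
    funext fun z => fderiv_const_mul_add hφ hγ σ z
  rw [hessForm, h]
  exact (((hφ.hasFDerivAt_fderiv z).const_smul σ).add (hγ.hasFDerivAt_fderiv z)).fderiv

theorem norm_hessForm_const_mul_add_le {φ γ : E → ℝ} (hφ : ContDiff ℝ 2 φ) (hγ : ContDiff ℝ 2 γ)
    {σ : ℝ} (hσ : 0 ≤ σ) {z : E} {a b : ℝ} (ha : ‖hessForm φ z‖ ≤ a) (hb : ‖hessForm γ z‖ ≤ b) :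
    ‖hessForm (fun z => σ * φ z + γ z) z‖ ≤ σ * a + b := by
  rw [hessForm_const_mul_add hφ hγ]
  exact norm_smul_add_le_of_le (G := E →L[ℝ] E →L[ℝ] ℝ) hσ ha hb

theorem LipAtPoint.hessForm_const_mul_add {φ γ : E → ℝ} (hφ : ContDiff ℝ 2 φ)
    (hγ : ContDiff ℝ 2 γ) {σ : ℝ} (hσ : 0 ≤ σ) {S : Set E} {p : E} {a b : ℝ}
    (ha : LipAtPoint (hessForm φ) S a p) (hb : LipAtPoint (hessForm γ) S b p) :
    LipAtPoint (hessForm fun z => σ * φ z + γ z) S (σ * a + b) p := by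
  unfold LipAtPoint at *
  filter_upwards [ha, hb] with q h1 h2
  rw [_root_.hessForm_const_mul_add hφ hγ, _root_.hessForm_const_mul_add hφ hγ]
  have e : σ • hessForm φ q + hessForm γ q - (σ • hessForm φ p + hessForm γ p) =
      σ • (hessForm φ q - hessForm φ p) + (hessForm γ q - hessForm γ p) := by module
  rw [e, add_mul, mul_assoc]
  exact norm_smul_add_le_of_le hσ h1 h2

theorem norm_fderiv_sub_le_of_hessForm {φ : E → ℝ} (hφ : ContDiff ℝ 2 φ) {S : Set E}
    (hS : Convex ℝ S) {L : ℝ} (hL : ∀ z ∈ S, ‖hessForm φ z‖ ≤ L) {p q : E} (hp : p ∈ S)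
    (hq : q ∈ S) : ‖fderiv ℝ φ q - fderiv ℝ φ p‖ ≤ L * ‖q - p‖ :=
  hS.norm_image_sub_le_of_norm_hasFDerivWithin_le
    (fun z _ => (hφ.hasFDerivAt_fderiv z).hasFDerivWithinAt) hL hp hq

/-- The Hessian is controlled only relative to its value at `p`, so the mean value inequality is
applied on the part of `S` in the ball around `p` through `q`, where the deviation is at most `K *
‖q - p‖`. -/
theorem LipAtPoint.norm_fderiv_sub_sub_le {φ : E → ℝ} (hφ : ContDiff ℝ 2 φ) {S : Set E}
    (hS : Convex ℝ S) {K : ℝ} (hK : 0 ≤ K) {p : E} (hp : p ∈ S)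
    (h : LipAtPoint (hessForm φ) S K p) :
    ∀ᶠ q in 𝓝[S] p, ‖fderiv ℝ φ q - fderiv ℝ φ p - hessForm φ p (q - p)‖ ≤ K * ‖q - p‖ ^ 2 := by
  unfold LipAtPoint at h
  rw [eventually_nhdsWithin_iff, Metric.eventually_nhds_iff] at h ⊢
  obtain ⟨r, hr, h⟩ := h
  refine ⟨r, hr, fun q hq hqS => ?_⟩
  have := (hS.inter (convex_closedBall p ‖q - p‖)).norm_image_sub_le_of_norm_hasFDerivWithin_le'
    (f := fderiv ℝ φ) (f' := fun z => hessForm φ z) (φ := hessForm φ p) (C := K * ‖q - p‖)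
    (x := p) (y := q)
    (fun z _ => (hφ.hasFDerivAt_fderiv z).hasFDerivWithinAt) ?_
    ⟨hp, Metric.mem_closedBall_self (norm_nonneg _)⟩ ⟨hqS, by simp [dist_eq_norm]⟩
  · rwa [mul_assoc, ← sq] at this
  · rintro z ⟨hz, hzb⟩
    rw [Metric.mem_closedBall, dist_eq_norm] at hzb
    rw [dist_eq_norm] at hq
    exact (h (by rw [dist_eq_norm]; linarith) hz).trans (by gcongr)

/-- By convexity the tangent cone at `x` contains all differences `x' - x`, and these span the
direction space. -/
theorem HasFDerivWithinAt.eqOn_vectorSpan {φ : E → ℝ} {L L' : E →L[ℝ] ℝ} {X : Set E} {x : E}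
    (hX : Convex ℝ X) (hx : x ∈ X) (h : HasFDerivWithinAt φ L X x)
    (h' : HasFDerivWithinAt φ L' X x) : ∀ e ∈ vectorSpan ℝ X, L e = L' e := by
  intro e he
  rw [vectorSpan_eq_span_vsub_set_right ℝ hx] at he
  induction he using Submodule.span_induction with
  | mem e he =>
    obtain ⟨x', hx', rfl⟩ := he
    exact h.unique_on h' (mem_tangentConeAt_of_segment_subset (hX.segment_subset hx hx'))
  | zero => simp
  | add u v _ _ hu hv => simp [hu, hv]
  | smul c u _ hu => simp [hu]

end Calculus

/-- The vector is the Riesz representative of `L` restricted to the direction space of `X`; changing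
`L` off that space does not affect expansions along `X`. -/
theorem exists_hasRelGradient_of_hasFDerivWithinAt {E : Type*} [NormedAddCommGroup E]
    [InnerProductSpace ℝ E] [FiniteDimensional ℝ E] [CompleteSpace E] {φ : E → ℝ} {L : E →L[ℝ] ℝ}
    {X : Set E} {x : E} (hx : x ∈ X) (h : HasFDerivWithinAt φ L X x) :
    ∃ v, HasRelGradient φ v X x ∧ ∀ e ∈ vectorSpan ℝ X, inner ℝ v e = L e := by
  let V := vectorSpan ℝ X
  let v : V := (InnerProductSpace.toDual ℝ V).symm (L.comp V.subtypeL)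
  have hv : ∀ e ∈ V, inner ℝ (v : E) e = L e := fun e he => by
    have : inner ℝ v (⟨e, he⟩ : V) = L e := by simp [v, InnerProductSpace.toDual_symm_apply]
    exact this
  refine ⟨v, ⟨?_, v.2⟩, hv⟩
  rw [hasGradientWithinAt_iff_hasFDerivWithinAt]
  rw [hasFDerivWithinAt_iff_isLittleO] at h ⊢
  refine h.congr' ?_ EventuallyEq.rfl
  filter_upwards [self_mem_nhdsWithin] with x' hx'
  rw [InnerProductSpace.toDual_apply_apply, hv (x' - x) (vsub_mem_vectorSpan ℝ hx' hx)]

/-! ### Embeddings of the factors and partial derivatives. -/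

/-- The embedding `x ↦ (x, 0)`. -/
def inX (m n : ℕ) : Euc m →L[ℝ] EucProd m n :=
  ((WithLp.prodContinuousLinearEquiv 2 ℝ (Euc m) (Euc n)).symm : _ →L[ℝ] _).comp
    (ContinuousLinearMap.inl ℝ (Euc m) (Euc n))

/-- The embedding `y ↦ (0, y)`. -/
def inY (m n : ℕ) : Euc n →L[ℝ] EucProd m n :=
  ((WithLp.prodContinuousLinearEquiv 2 ℝ (Euc m) (Euc n)).symm : _ →L[ℝ] _).comp
    (ContinuousLinearMap.inr ℝ (Euc m) (Euc n))

section Pair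

variable {m n : ℕ}

theorem norm_inX (e : Euc m) : ‖inX m n e‖ = ‖e‖ := WithLp.norm_toLp_fst 2 _ _ e

theorem norm_inY (w : Euc n) : ‖inY m n w‖ = ‖w‖ := WithLp.norm_toLp_snd 2 _ _ w

theorem pairPt_eq (x : Euc m) (y : Euc n) : pairPt x y = inX m n x + inY m n y := by
  have : ((x, y) : Euc m × Euc n) = (x, 0) + (0, y) := by simp
  rw [pairPt, this]; rfl

theorem pairPt_sub (x x' : Euc m) (y y' : Euc n) :
    pairPt x' y' - pairPt x y = inX m n (x' - x) + inY m n (y' - y) := by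
  rw [pairPt_eq, pairPt_eq, map_sub, map_sub]; abel

theorem pairPt_sub_left (x x' : Euc m) (y : Euc n) :
    pairPt x' y - pairPt x y = inX m n (x' - x) := by
  rw [pairPt_sub, sub_self, map_zero, add_zero]

theorem pairPt_sub_right (x : Euc m) (y y' : Euc n) :
    pairPt x y' - pairPt x y = inY m n (y' - y) := by
  rw [pairPt_sub, sub_self, map_zero, zero_add]

theorem jointFun_pairPt (φ : Euc m → Euc n → ℝ) (x : Euc m) (y : Euc n) :
    jointFun φ (pairPt x y) = φ x y := rfl

theorem convex_jointSet {X : Set (Euc m)} {Y : Set (Euc n)} (hX : Convex ℝ X)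
    (hY : Convex ℝ Y) : Convex ℝ (jointSet X Y) :=
  fun _ hz _ hz' _ _ ha hb hab => ⟨hX hz.1 hz'.1 ha hb hab, hY hz.2 hz'.2 ha hb hab⟩

theorem hasFDerivAt_snd_of_jointFun {φ : Euc m → Euc n → ℝ} {x : Euc m} {y : Euc n}
    (h : DifferentiableAt ℝ (jointFun φ) (pairPt x y)) :
    HasFDerivAt (φ x) ((fderiv ℝ (jointFun φ) (pairPt x y)).comp (inY m n)) y := by
  have h1 : HasFDerivAt (fun y : Euc n => pairPt x y) (inY m n) y := by
    simp only [pairPt_eq]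
    exact (inY m n).hasFDerivAt.const_add _
  exact HasFDerivAt.comp y (g := jointFun φ) h.hasFDerivAt h1

theorem inner_gradient_snd {φ : Euc m → Euc n → ℝ} {x : Euc m} {y : Euc n}
    (h : DifferentiableAt ℝ (jointFun φ) (pairPt x y)) (w : Euc n) :
    inner ℝ (gradient (φ x) y) w = fderiv ℝ (jointFun φ) (pairPt x y) (inY m n w) := by
  rw [gradient, InnerProductSpace.toDual_symm_apply, (hasFDerivAt_snd_of_jointFun h).fderiv]
  rfl

end Pair

/-! ### Stability of the lower-level problem and the value estimate (i). -/

namespace Bilevel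

variable {dx dy m₁ m₂ : ℕ} {P : Bilevel dx dy m₁ m₂}

namespace Smooth

variable {lf0 lf1 lg1 Cf : ℝ}

theorem h_contDiff (hP : P.Smooth lf0 lf1 lg1 Cf) (σ : ℝ) : ContDiff ℝ 2 (jointFun (P.h σ)) :=
  (contDiff_const.mul hP.f_contDiff).add hP.g_contDiff

theorem fderiv_h (hP : P.Smooth lf0 lf1 lg1 Cf) (σ : ℝ) (z : EucProd dx dy) :
    fderiv ℝ (jointFun (P.h σ)) z =
      σ • fderiv ℝ (jointFun P.f) z + fderiv ℝ (jointFun P.g) z :=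
  fderiv_const_mul_add hP.f_contDiff hP.g_contDiff σ z

theorem norm_hessForm_h_le (hP : P.Smooth lf0 lf1 lg1 Cf) {σ : ℝ} (hσ : 0 ≤ σ)
    {z : EucProd dx dy} (hz : z ∈ jointSet P.X P.Y) :
    ‖hessForm (jointFun (P.h σ)) z‖ ≤ σ * lf1 + lg1 :=
  norm_hessForm_const_mul_add_le hP.f_contDiff hP.g_contDiff hσ (hP.f_hess _ hz.1 _ hz.2)
    (hP.g_hess _ hz.1 _ hz.2)

theorem convex_Y (hP : P.Smooth lf0 lf1 lg1 Cf) : Convex ℝ P.Y := by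
  intro y hy z hz α β hα hβ hαβ
  refine ⟨fun i => ?_, fun j => ?_⟩
  · have := (hP.c_convex i).2 (mem_univ y) (mem_univ z) hα hβ hαβ
    simp only [smul_eq_mul] at this
    nlinarith [hy.1 i, hz.1 i]
  · rw [inner_add_right, inner_smul_right, inner_smul_right, hy.2 j, hz.2 j, ← add_mul, hαβ,
      one_mul]

theorem isCompact_Y (hP : P.Smooth lf0 lf1 lg1 Cf) : IsCompact P.Y := by
  refine Metric.isCompact_of_isClosed_isBounded ?_ hP.Y_bounded
  have : P.Y = (⋂ i, {y | P.c i y ≤ 0}) ∩ ⋂ j, {y | inner ℝ (P.a j) y = P.b j} := by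
    ext y; simp [Y]
  rw [this]
  refine (isClosed_iInter fun i => ?_).inter (isClosed_iInter fun j => ?_)
  · exact isClosed_le (hP.c_contDiff i).continuous continuous_const
  · exact isClosed_eq (by fun_prop) continuous_const

theorem exists_diam (hP : P.Smooth lf0 lf1 lg1 Cf) :
    ∃ R : ℝ, 0 < R ∧ ∀ a ∈ P.Y, ∀ b ∈ P.Y, ‖a - b‖ ≤ R := by
  obtain ⟨R, hR⟩ := Metric.isBounded_iff.1 hP.Y_bounded
  refine ⟨max R 1, by positivity, fun a ha b hb => ?_⟩
  rw [← dist_eq_norm]; exact (hR ha hb).trans (le_max_left _ _)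

theorem continuous_h (hP : P.Smooth lf0 lf1 lg1 Cf) (σ : ℝ) (x : Euc dx) :
    Continuous (P.h σ x) := by
  have : Continuous fun y : Euc dy => pairPt x y := by simp only [pairPt_eq]; fun_prop
  exact (hP.h_contDiff σ).continuous.comp this

theorem lf0_nonneg (hP : P.Smooth lf0 lf1 lg1 Cf) {x : Euc dx} (hx : x ∈ P.X) : 0 ≤ lf0 := by
  obtain ⟨y, hy⟩ := hP.Y_nonempty
  exact (norm_nonneg _).trans (hP.f_grad x hx y hy)

theorem lf1_nonneg (hP : P.Smooth lf0 lf1 lg1 Cf) {x : Euc dx} (hx : x ∈ P.X) : 0 ≤ lf1 := by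
  obtain ⟨y, hy⟩ := hP.Y_nonempty
  exact (ContinuousLinearMap.opNorm_nonneg _).trans (hP.f_hess x hx y hy)

theorem lg1_nonneg (hP : P.Smooth lf0 lf1 lg1 Cf) {x : Euc dx} (hx : x ∈ P.X) : 0 ≤ lg1 := by
  obtain ⟨y, hy⟩ := hP.Y_nonempty
  exact (ContinuousLinearMap.opNorm_nonneg _).trans (hP.g_hess x hx y hy)

theorem abs_fderiv_f_inY_le (hP : P.Smooth lf0 lf1 lg1 Cf) {x : Euc dx} (hx : x ∈ P.X)
    {y : Euc dy} (hy : y ∈ P.Y) (w : Euc dy) :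
    |fderiv ℝ (jointFun P.f) (pairPt x y) (inY dx dy w)| ≤ lf0 * ‖w‖ := by
  rw [← inner_gradient_snd (hP.f_contDiff.differentiable (by norm_num) _)]
  exact (abs_real_inner_le_norm _ _).trans
    (mul_le_mul_of_nonneg_right (hP.f_grad x hx y hy) (norm_nonneg _))

theorem abs_f_sub_le (hP : P.Smooth lf0 lf1 lg1 Cf) {x : Euc dx} (hx : x ∈ P.X)
    {a b : Euc dy} (ha : a ∈ P.Y) (hb : b ∈ P.Y) : |P.f x a - P.f x b| ≤ lf0 * ‖a - b‖ := by
  refine hP.convex_Y.norm_image_sub_le_of_norm_hasFDerivWithin_le (f := P.f x)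
    (fun y _ => (hasFDerivAt_snd_of_jointFun
      (hP.f_contDiff.differentiable (by norm_num) _)).hasFDerivWithinAt) (fun y hy => ?_) hb ha
  exact ContinuousLinearMap.opNorm_le_bound _ (hP.lf0_nonneg hx)
    fun w => hP.abs_fderiv_f_inY_le hx hy w

/-- The `y`-derivative of `h σ x' - h σ x` is an increment of the joint derivative, hence bounded by
the Hessian bound times `‖x' - x‖`. -/
theorem abs_h_sub_sub_le (hP : P.Smooth lf0 lf1 lg1 Cf) {σ : ℝ} (hσ : 0 ≤ σ) {x x' : Euc dx}
    (hx : x ∈ P.X) (hx' : x' ∈ P.X) {a b : Euc dy} (ha : a ∈ P.Y) (hb : b ∈ P.Y) :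
    |(P.h σ x' a - P.h σ x a) - (P.h σ x' b - P.h σ x b)| ≤
      (σ * lf1 + lg1) * ‖x' - x‖ * ‖a - b‖ := by
  have hd := (hP.h_contDiff σ).differentiable (by norm_num)
  refine hP.convex_Y.norm_image_sub_le_of_norm_hasFDerivWithin_le
    (f := fun y => P.h σ x' y - P.h σ x y)
    (fun y _ => ((hasFDerivAt_snd_of_jointFun (hd _)).sub
      (hasFDerivAt_snd_of_jointFun (hd _))).hasFDerivWithinAt) (fun y hy => ?_) hb ha
  have h1 := norm_fderiv_sub_le_of_hessForm (hP.h_contDiff σ)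
    (convex_jointSet hP.X_convex hP.convex_Y) (fun z hz => hP.norm_hessForm_h_le hσ hz)
    (p := pairPt x y) (q := pairPt x' y) ⟨hx, hy⟩ ⟨hx', hy⟩
  rw [pairPt_sub_left, norm_inX] at h1
  refine ContinuousLinearMap.opNorm_le_bound _ ((norm_nonneg _).trans h1) fun w => ?_
  rw [← ContinuousLinearMap.sub_comp, ContinuousLinearMap.comp_apply]
  refine (ContinuousLinearMap.le_of_opNorm_le _ h1 _).trans ?_
  rw [norm_inY]

end Smooth

theorem T_zero (x : Euc dx) : P.T x 0 = argminSet (P.g x) P.Y := by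
  have : P.h 0 x = P.g x := by ext y; simp [h]
  rw [T, this]

/-- Solutions of the lower-level problem are stable under perturbations of `x` and `σ`. -/
theorem exists_near_mem_T {lf0 lf1 lg1 Cf ρ μ δ σ₀ : ℝ} (hP : P.Smooth lf0 lf1 lg1 Cf)
    (hρ : 0 < ρ) (hμ : 0 < μ) (hδ : 0 < δ) (hEB : P.ProxEB ρ μ δ σ₀) :
    ∃ r : ℝ, 0 < r ∧ ∀ x ∈ P.X, ∀ x' ∈ P.X, ∀ t ∈ Icc 0 σ₀, ∀ t' ∈ Icc 0 σ₀,
      lf0 * |t' - t| + (t * lf1 + lg1) * ‖x' - x‖ < r → ∀ y ∈ P.T x t, ∃ y' ∈ P.T x' t',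
        ‖y - y'‖ ≤ 2 * (lf0 * |t' - t| + (t * lf1 + lg1) * ‖x' - x‖) / μ ∧
        μ / 2 * ‖y - y'‖ ^ 2 ≤ P.h t' x' y - P.h t' x' y' := by
  obtain ⟨R, hR0, hR⟩ := hP.exists_diam
  refine ⟨δ ^ 2 / (2 * μ) / R, by positivity, ?_⟩
  intro x hx x' hx' t ht t' ht' hsmall y hy
  have h0 := hP.lf0_nonneg hx
  have h1 := hP.lf1_nonneg hx
  have h2 := hP.lg1_nonneg hx
  have h3 := ht.1
  refine exists_near_argmin hP.isCompact_Y hP.convex_Y hR (hP.continuous_h t' x').continuousOn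
    hρ hμ hδ (hEB x' hx' t' ht') ?_ (by positivity) ((lt_div_iff₀ hR0).1 hsmall) hy
  intro a ha b hb
  -- Change of `t` at fixed `x'`, then change of `x` at fixed `t`; the two parts have Lipschitz
  -- constants `lf0 * |t' - t|` and `(t * lf1 + lg1) * ‖x' - x‖`.
  have e : (P.h t' x' a - P.h t x a) - (P.h t' x' b - P.h t x b) =
      (t' - t) * (P.f x' a - P.f x' b) +
        ((P.h t x' a - P.h t x a) - (P.h t x' b - P.h t x b)) := by
    simp only [h]; ring
  rw [e]
  refine (abs_add_le _ _).trans ?_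
  rw [abs_mul, add_mul]
  refine add_le_add ?_ (hP.abs_h_sub_sub_le ht.1 hx hx' ha hb)
  calc |t' - t| * |P.f x' a - P.f x' b| ≤ |t' - t| * (lf0 * ‖a - b‖) := by
        gcongr; exact hP.abs_f_sub_le hx' ha hb
    _ = _ := by ring

theorem T_nonempty {lf0 lf1 lg1 Cf : ℝ} (hP : P.Smooth lf0 lf1 lg1 Cf) (x : Euc dx) (σ : ℝ) :
    (P.T x σ).Nonempty :=
  argminSet_nonempty hP.isCompact_Y hP.Y_nonempty (hP.continuous_h σ x).continuousOn

/-- `f` is constant on the solution set. -/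
theorem f_eq_of_mem_T {lf0 lf1 lg1 Cf ρ μ δ σ₀ : ℝ} (hP : P.Smooth lf0 lf1 lg1 Cf)
    (hρ : 0 < ρ) (hμ : 0 < μ) (hδ : 0 < δ) (hEB : P.ProxEB ρ μ δ σ₀) {x : Euc dx}
    (hx : x ∈ P.X) {t : ℝ} (ht : t ∈ Ico 0 σ₀) {y y' : Euc dy} (hy : y ∈ P.T x t)
    (hy' : y' ∈ P.T x t) : P.f x y = P.f x y' := by
  suffices H : ∀ y ∈ P.T x t, ∀ y' ∈ P.T x t, P.f x y ≤ P.f x y' from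
    le_antisymm (H y hy y' hy') (H y' hy' y hy)
  clear hy hy' y y'
  intro y hy y' hy'
  obtain ⟨r, hr, hnear⟩ := exists_near_mem_T hP hρ hμ hδ hEB
  have h0 := hP.lf0_nonneg hx
  have hlim : Tendsto (fun τ : ℝ => P.f x y' + lf0 * (2 * (lf0 * τ) / μ)) (𝓝[>] 0)
      (𝓝 (P.f x y')) := by
    have : Continuous (fun τ : ℝ => P.f x y' + lf0 * (2 * (lf0 * τ) / μ)) := by fun_prop
    simpa using (this.tendsto 0).mono_left nhdsWithin_le_nhds
  have hsm : ∀ᶠ τ in 𝓝[>] (0 : ℝ), lf0 * τ < r := by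
    have : Continuous (fun τ : ℝ => lf0 * τ) := by fun_prop
    exact ((this.tendsto 0).mono_left nhdsWithin_le_nhds).eventually_lt_const (by simpa)
  refine ge_of_tendsto hlim ?_
  filter_upwards [hsm, Ioo_mem_nhdsGT (sub_pos.2 ht.2)] with τ hτ1 hτ
  -- A solution at `t + τ` close to `y`. Adding the optimality inequalities of `y₂` at `t + τ` and
  -- of `y'` at `t` gives `f y₂ ≤ f y'`; then `τ → 0`.
  obtain ⟨y₂, hy₂, hd, -⟩ := hnear x hx x hx t ⟨ht.1, ht.2.le⟩ (t + τ)
    ⟨by linarith [ht.1, hτ.1], by linarith [hτ.2]⟩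
    (by simpa [abs_of_pos hτ.1] using hτ1) y hy
  simp only [add_sub_cancel_left, abs_of_pos hτ.1, sub_self, norm_zero, mul_zero, add_zero] at hd
  have h1 := hy'.2 y₂ hy₂.1
  have h2 := hy₂.2 y' hy'.1
  simp only [h] at h1 h2
  have h3 : P.f x y₂ ≤ P.f x y' := by
    have : τ * P.f x y₂ ≤ τ * P.f x y' := by linarith
    exact le_of_mul_le_mul_left this hτ.1
  have h4 := (abs_le.1 (hP.abs_f_sub_le hx hy.1 hy₂.1)).2
  have h5 := mul_le_mul_of_nonneg_left hd h0
  linarith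

theorem psi_eq {lf0 lf1 lg1 Cf ρ μ δ σ₀ : ℝ} (hP : P.Smooth lf0 lf1 lg1 Cf)
    (hρ : 0 < ρ) (hμ : 0 < μ) (hδ : 0 < δ) (hσ₀ : 0 < σ₀) (hEB : P.ProxEB ρ μ δ σ₀)
    {x : Euc dx} (hx : x ∈ P.X) {y : Euc dy} (hy : y ∈ P.T x 0) : P.psi x = P.f x y := by
  rw [psi, ← T_zero]
  exact minVal_eq_of_mem_argminSet ⟨hy, fun z hz =>
    (f_eq_of_mem_T hP hρ hμ hδ hEB hx ⟨le_rfl, hσ₀⟩ hy hz).le⟩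

theorem continuousOn_minVal {lf0 lf1 lg1 Cf : ℝ} (hP : P.Smooth lf0 lf1 lg1 Cf) (x : Euc dx) :
    Continuous fun t => minVal (P.h t x) P.Y := by
  obtain ⟨C, hC⟩ := hP.isCompact_Y.exists_bound_of_continuousOn (f := P.f x) (by
    have : Continuous fun y : Euc dy => pairPt x y := by simp only [pairPt_eq]; fun_prop
    exact (hP.f_contDiff.continuous.comp this).continuousOn)
  have key : ∀ s t, minVal (P.h t x) P.Y - minVal (P.h s x) P.Y ≤ C * |t - s| := by
    intro s t
    obtain ⟨y, hy⟩ := T_nonempty hP x s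
    obtain ⟨z, hz⟩ := T_nonempty hP x t
    rw [minVal_eq_of_mem_argminSet hy, minVal_eq_of_mem_argminSet hz]
    have h1 := hz.2 y hy.1
    have h2 : (t - s) * P.f x y ≤ |t - s| * C := by
      refine (le_abs_self _).trans ?_
      rw [abs_mul]
      exact mul_le_mul_of_nonneg_left (hC y hy.1) (abs_nonneg _)
    simp only [h] at h1 ⊢
    linarith
  refine (LipschitzWith.of_dist_le' (K := C) fun t s => ?_).continuous
  rw [Real.dist_eq, Real.dist_eq, abs_le]
  have h1 := key s t
  have h2 := key t s
  rw [abs_sub_comm] at h2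
  constructor <;> linarith

/-- The lower bound tests the problem at `σ` with a solution at `0`. The upper bound is the
support-line principle applied to the value function plus `lf0² / (2μ) t²`. -/
theorem psi_sub_psiPen_bounds {lf0 lf1 lg1 Cf ρ μ δ σ₀ : ℝ} (hP : P.Smooth lf0 lf1 lg1 Cf)
    (hρ : 0 < ρ) (hμ : 0 < μ) (hδ : 0 < δ) (hσ₀ : 0 < σ₀) (hEB : P.ProxEB ρ μ δ σ₀)
    {x : Euc dx} (hx : x ∈ P.X) {σ : ℝ} (hσ : 0 < σ) (hσσ : σ ≤ σ₀) :
    0 ≤ P.psi x - P.psiPen σ x ∧ P.psi x - P.psiPen σ x ≤ lf0 ^ 2 / (2 * μ) * σ := by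
  have hl0 : minVal (P.g x) P.Y = minVal (P.h 0 x) P.Y := by
    congr 1; ext y; simp [h]
  have h0 := hP.lf0_nonneg hx
  choose y hy using fun t => T_nonempty hP x t
  rw [psi_eq hP hρ hμ hδ hσ₀ hEB hx (hy 0), psiPen, hl0]
  constructor
  · rw [sub_nonneg, one_div, inv_mul_le_iff₀ hσ, minVal_eq_of_mem_argminSet (hy σ),
      minVal_eq_of_mem_argminSet (hy 0)]
    have := (hy σ).2 _ (hy 0).1
    simp only [h] at this ⊢
    linarith
  · obtain ⟨r, hr, hnear⟩ := exists_near_mem_T hP hρ hμ hδ hEB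
    have hsup := add_mul_le_of_forall_local_support hσ
      (q := fun t => minVal (P.h t x) P.Y + lf0 ^ 2 / (2 * μ) * t ^ 2)
      (a := fun t => P.f x (y t) + lf0 ^ 2 / (2 * μ) * (2 * t))
      ((continuousOn_minVal hP x).add (by fun_prop)).continuousOn ?_
    · rw [sub_le_iff_le_add, one_div, ← sub_le_iff_le_add', le_inv_mul_iff₀ hσ]
      linarith
    intro t ht
    have hsm : ∀ᶠ s in 𝓝[Icc 0 σ] t, lf0 * |t - s| < r := by
      have : Continuous (fun s : ℝ => lf0 * |t - s|) := by fun_prop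
      exact ((this.tendsto t).mono_left nhdsWithin_le_nhds).eventually_lt_const (by simpa)
    filter_upwards [hsm, self_mem_nhdsWithin] with s hs1 hs
    -- The perturbation runs from `s` back to `t`, so that growth of `h t` is evaluated at the
    -- solution `y s`.
    obtain ⟨y', hy', -, hg⟩ := hnear x hx x hx s ⟨hs.1, hs.2.trans hσσ⟩ t
      ⟨ht.1, ht.2.le.trans hσσ⟩ (by simpa using hs1) _ (hy s)
    have hf := f_eq_of_mem_T hP hρ hμ hδ hEB hx ⟨ht.1, ht.2.trans_le hσσ⟩ (hy t) hy'
    rw [minVal_eq_of_mem_argminSet hy', minVal_eq_of_mem_argminSet (hy s), hf]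
    have h1 := hP.abs_f_sub_le hx (hy s).1 hy'.1
    have h2 : -(|s - t| * (lf0 * ‖y s - y'‖)) ≤ (s - t) * (P.f x (y s) - P.f x y') := by
      have := mul_le_mul_of_nonneg_left h1 (abs_nonneg (s - t))
      rw [← abs_mul] at this
      linarith [neg_abs_le ((s - t) * (P.f x (y s) - P.f x y'))]
    -- Young's inequality; completing the square is where `lf0² / (2μ)` comes from.
    have h3 : |s - t| * (lf0 * ‖y s - y'‖) ≤
        μ / 2 * ‖y s - y'‖ ^ 2 + lf0 ^ 2 / (2 * μ) * (s - t) ^ 2 := by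
      have : μ / 2 * ‖y s - y'‖ ^ 2 + lf0 ^ 2 / (2 * μ) * (s - t) ^ 2 -
          |s - t| * (lf0 * ‖y s - y'‖) =
          1 / (2 * μ) * (μ * ‖y s - y'‖ - lf0 * |s - t|) ^ 2 := by
        rw [← sq_abs (s - t)]; field_simp; ring
      have h4 : 0 ≤ 1 / (2 * μ) * (μ * ‖y s - y'‖ - lf0 * |s - t|) ^ 2 := by positivity
      linarith
    simp only [h] at hg ⊢
    linarith

end Bilevel

/-! ### Derivatives in `x` of the value function and of `psiPen`. -/

namespace Bilevel

variable {dx dy m₁ m₂ : ℕ} {P : Bilevel dx dy m₁ m₂}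

theorem exists_lipschitz_near_mem_T {lf0 lf1 lg1 Cf ρ μ δ σ₀ : ℝ} (hP : P.Smooth lf0 lf1 lg1 Cf)
    (hρ : 0 < ρ) (hμ : 0 < μ) (hδ : 0 < δ) (hEB : P.ProxEB ρ μ δ σ₀) {x : Euc dx}
    (hx : x ∈ P.X) {t : ℝ} (ht : t ∈ Icc 0 σ₀) {y : Euc dy} (hy : y ∈ P.T x t) :
    ∃ C : ℝ, 0 ≤ C ∧ ∀ᶠ q : Euc dx × ℝ in 𝓝[P.X ×ˢ Icc 0 σ₀] (x, t), ∃ y' ∈ P.T q.1 q.2,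
      ‖y' - y‖ ≤ C * (‖q.1 - x‖ + |q.2 - t|) := by
  obtain ⟨r, hr, H⟩ := exists_near_mem_T hP hρ hμ hδ hEB
  have h0 := hP.lf0_nonneg hx
  have h1 := hP.lf1_nonneg hx
  have h2 := hP.lg1_nonneg hx
  have h3 := ht.1
  refine ⟨2 * (lf0 + (t * lf1 + lg1)) / μ, by positivity, ?_⟩
  have hcont : Continuous fun q : Euc dx × ℝ =>
      lf0 * |q.2 - t| + (t * lf1 + lg1) * ‖q.1 - x‖ := by fun_prop
  have hsm := ((hcont.tendsto (x, t)).mono_left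
    (nhdsWithin_le_nhds (s := P.X ×ˢ Icc 0 σ₀))).eventually_lt_const (u := r) (by simpa)
  filter_upwards [hsm, self_mem_nhdsWithin] with q hq hq'
  obtain ⟨y', hy', hd, -⟩ := H x hx q.1 hq'.1 t ht q.2 hq'.2 hq y hy
  refine ⟨y', hy', ?_⟩
  rw [norm_sub_rev, div_mul_eq_mul_div]
  refine hd.trans (div_le_div_of_nonneg_right ?_ hμ.le)
  have h4 : 0 ≤ lf0 * ‖q.1 - x‖ := by positivity
  have h5 : 0 ≤ (t * lf1 + lg1) * |q.2 - t| := by positivity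
  linarith

theorem eventually_exists_mem_T {lf0 lf1 lg1 Cf ρ μ δ σ₀ : ℝ} (hP : P.Smooth lf0 lf1 lg1 Cf)
    (hρ : 0 < ρ) (hμ : 0 < μ) (hδ : 0 < δ) (hEB : P.ProxEB ρ μ δ σ₀) {x : Euc dx}
    (hx : x ∈ P.X) {t : ℝ} (ht : t ∈ Icc 0 σ₀) {y : Euc dy} (hy : y ∈ P.T x t) :
    ∃ C : ℝ, 0 ≤ C ∧ ∀ᶠ x' in 𝓝[P.X] x, ∃ y' ∈ P.T x' t, ‖y' - y‖ ≤ C * ‖x' - x‖ := by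
  obtain ⟨C, hC, H⟩ := exists_lipschitz_near_mem_T hP hρ hμ hδ hEB hx ht hy
  refine ⟨C, hC, ?_⟩
  have hlim : Tendsto (fun x' : Euc dx => (x', t)) (𝓝[P.X] x)
      (𝓝[P.X ×ˢ Icc 0 σ₀] (x, t)) := by
    refine tendsto_nhdsWithin_iff.2 ⟨?_, ?_⟩
    · have : Continuous fun x' : Euc dx => (x', t) := by fun_prop
      exact (this.tendsto x).mono_left nhdsWithin_le_nhds
    · filter_upwards [self_mem_nhdsWithin] with x' hx' using ⟨hx', ht⟩
  filter_upwards [hlim.eventually H] with x' hx'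
  simpa using hx'

/-- Danskin's theorem for the value function of the perturbed lower-level problem. -/
theorem hasFDerivWithinAt_minVal {lf0 lf1 lg1 Cf ρ μ δ σ₀ : ℝ} (hP : P.Smooth lf0 lf1 lg1 Cf)
    (hρ : 0 < ρ) (hμ : 0 < μ) (hδ : 0 < δ) (hEB : P.ProxEB ρ μ δ σ₀) {x : Euc dx}
    (hx : x ∈ P.X) {t : ℝ} (ht : t ∈ Icc 0 σ₀) {y : Euc dy} (hy : y ∈ P.T x t) :
    HasFDerivWithinAt (fun x' => minVal (P.h t x') P.Y)
      ((fderiv ℝ (jointFun (P.h t)) (pairPt x y)).comp (inX dx dy)) P.X x := by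
  obtain ⟨C, hC, hnear⟩ := eventually_exists_mem_T hP hρ hμ hδ hEB hx ht hy
  rw [hasFDerivWithinAt_iff_isLittleO, Asymptotics.isLittleO_iff]
  intro c hc
  -- Strict differentiability is needed because the increment in `x` is also taken at the moving
  -- solution `y'`, not only at `y`.
  have hs := ((hP.h_contDiff t).contDiffAt (x := pairPt x y)).hasStrictFDerivAt (by norm_num)
  have hs' := (Asymptotics.isLittleO_iff.1 hs.isLittleO) hc
  rw [Metric.eventually_nhds_iff] at hs'
  obtain ⟨r, hr, hs'⟩ := hs'
  have hcont : Continuous fun x' : Euc dx => (1 + C) * ‖x' - x‖ := by fun_prop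
  have hsm := ((hcont.tendsto x).mono_left (nhdsWithin_le_nhds (s := P.X))).eventually_lt_const
    (u := r) (by simpa)
  have hball : ∀ x' y', ‖x' - x‖ < r - ‖y' - y‖ →
      dist (pairPt x' y') (pairPt x y) < r := by
    intro x' y' h
    rw [dist_eq_norm, pairPt_sub]
    refine (norm_add_le _ _).trans_lt ?_
    rw [norm_inX, norm_inY]; linarith
  filter_upwards [hnear, hsm] with x' ⟨y', hy', hd⟩ hsm
  have hn := norm_nonneg (x' - x)
  have hCn : 0 ≤ C * ‖x' - x‖ := by positivity
  have key : ∀ v, ‖v - y‖ ≤ C * ‖x' - x‖ →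
      |P.h t x' v - P.h t x v -
        fderiv ℝ (jointFun (P.h t)) (pairPt x y) (inX dx dy (x' - x))| ≤ c * ‖x' - x‖ := by
    intro v hv
    have := @hs' (pairPt x' v, pairPt x v) (max_lt (hball _ _ (by linarith))
      (hball _ _ (by rw [sub_self, norm_zero]; linarith)))
    simp only [pairPt_sub_left, norm_inX] at this
    exact this
  have k1 := (abs_le.1 (key y (by simpa using hCn))).2
  have k2 := (abs_le.1 (key y' hd)).1
  rw [minVal_eq_of_mem_argminSet hy, minVal_eq_of_mem_argminSet hy', Real.norm_eq_abs, abs_le,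
    ContinuousLinearMap.comp_apply]
  have h1 := hy.2 y' hy'.1
  have h2 := hy'.2 y hy.1
  constructor <;> linarith

/-- Danskin's formula holds with any solution, and the derivative of the value function is unique
along the span of `X`. Hence solutions can be exchanged freely inside the partial gradient in `x`.
-/
theorem fderiv_inX_eq_of_mem_T {lf0 lf1 lg1 Cf ρ μ δ σ₀ : ℝ} (hP : P.Smooth lf0 lf1 lg1 Cf)
    (hρ : 0 < ρ) (hμ : 0 < μ) (hδ : 0 < δ) (hEB : P.ProxEB ρ μ δ σ₀) {x : Euc dx}
    (hx : x ∈ P.X) {t : ℝ} (ht : t ∈ Icc 0 σ₀) {y y' : Euc dy} (hy : y ∈ P.T x t)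
    (hy' : y' ∈ P.T x t) {e : Euc dx} (he : e ∈ vectorSpan ℝ P.X) :
    fderiv ℝ (jointFun (P.h t)) (pairPt x y) (inX dx dy e) =
      fderiv ℝ (jointFun (P.h t)) (pairPt x y') (inX dx dy e) :=
  HasFDerivWithinAt.eqOn_vectorSpan hP.X_convex hx
    (hasFDerivWithinAt_minVal hP hρ hμ hδ hEB hx ht hy)
    (hasFDerivWithinAt_minVal hP hρ hμ hδ hEB hx ht hy') e he

theorem hasFDerivWithinAt_psiPen {lf0 lf1 lg1 Cf ρ μ δ σ₀ : ℝ} (hP : P.Smooth lf0 lf1 lg1 Cf)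
    (hρ : 0 < ρ) (hμ : 0 < μ) (hδ : 0 < δ) (hEB : P.ProxEB ρ μ δ σ₀) {x : Euc dx}
    (hx : x ∈ P.X) {σ : ℝ} (hσ : 0 ≤ σ) (hσσ : σ ≤ σ₀) {y y₀ : Euc dy} (hy : y ∈ P.T x σ)
    (hy₀ : y₀ ∈ P.T x 0) :
    HasFDerivWithinAt (P.psiPen σ)
      ((1 / σ) • ((fderiv ℝ (jointFun (P.h σ)) (pairPt x y)).comp (inX dx dy) -
        (fderiv ℝ (jointFun (P.h 0)) (pairPt x y₀)).comp (inX dx dy))) P.X x := by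
  have h1 := hasFDerivWithinAt_minVal hP hρ hμ hδ hEB hx ⟨hσ, hσσ⟩ hy
  have h2 := hasFDerivWithinAt_minVal hP hρ hμ hδ hEB hx ⟨le_rfl, hσ.trans hσσ⟩ hy₀
  have h3 : (fun x' => minVal (P.h 0 x') P.Y) = fun x' => minVal (P.g x') P.Y := by
    ext x'; congr 1; ext y; simp [h]
  rw [h3] at h2
  exact (h1.sub h2).const_mul (1 / σ)

end Bilevel

/-! ### Multipliers and stability of the active set. -/

namespace Bilevel

variable {dx dy m₁ m₂ : ℕ} {P : Bilevel dx dy m₁ m₂}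

variable (P) in
/-- The combination `∑ i ∈ I, v i ∇(c i)(y) + ∑ j, w j (a j)` of constraint gradients, as a linear
functional. -/
def conGrad (I : Finset (Fin m₁)) (y : Euc dy) (v : Fin m₁ → ℝ) (w : Fin m₂ → ℝ) :
    Euc dy →L[ℝ] ℝ :=
  (∑ i ∈ I, v i • fderiv ℝ (P.c i) y) + ∑ j, w j • innerSL ℝ (P.a j)

theorem conGrad_apply (I : Finset (Fin m₁)) (y : Euc dy) (v : Fin m₁ → ℝ) (w : Fin m₂ → ℝ)
    (d : Euc dy) : P.conGrad I y v w d =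
      (∑ i ∈ I, v i * fderiv ℝ (P.c i) y d) + ∑ j, w j * inner ℝ (P.a j) d := by
  simp [conGrad]

theorem conGrad_eq_toDual (I : Finset (Fin m₁)) (y : Euc dy) (v : Fin m₁ → ℝ) (w : Fin m₂ → ℝ) :
    P.conGrad I y v w = InnerProductSpace.toDual ℝ (Euc dy)
      ((∑ i ∈ I, v i • gradient (P.c i) y) + ∑ j, w j • P.a j) := by
  rw [map_add, map_sum, map_sum, conGrad]
  congr 1
  · refine Finset.sum_congr rfl fun i _ => ?_
    rw [LinearIsometryEquiv.map_smul, gradient, LinearIsometryEquiv.apply_symm_apply]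
  · refine Finset.sum_congr rfl fun j _ => ?_
    rw [LinearIsometryEquiv.map_smul]; rfl

theorem conGrad_sub (I : Finset (Fin m₁)) (y : Euc dy) (v v' : Fin m₁ → ℝ) (w w' : Fin m₂ → ℝ) :
    P.conGrad I y (v - v') (w - w') = P.conGrad I y v w - P.conGrad I y v' w' := by
  simp only [conGrad, Pi.sub_apply, sub_smul, Finset.sum_sub_distrib]; abel

/-- The Euclidean size of a pair of multiplier vectors. -/
def multSize (I : Finset (Fin m₁)) (v : Fin m₁ → ℝ) (w : Fin m₂ → ℝ) : ℝ :=
  Real.sqrt ((∑ i ∈ I, v i ^ 2) + ∑ j, w j ^ 2)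

theorem multSize_nonneg (I : Finset (Fin m₁)) (v : Fin m₁ → ℝ) (w : Fin m₂ → ℝ) :
    0 ≤ multSize I v w := Real.sqrt_nonneg _

theorem abs_le_multSize {I : Finset (Fin m₁)} (v : Fin m₁ → ℝ) (w : Fin m₂ → ℝ) {i : Fin m₁}
    (hi : i ∈ I) : |v i| ≤ multSize I v w := by
  refine Real.abs_le_sqrt ?_
  have h1 := Finset.single_le_sum (f := fun i => v i ^ 2) (fun i _ => sq_nonneg _) hi
  have h2 : 0 ≤ ∑ j, w j ^ 2 := Finset.sum_nonneg fun j _ => sq_nonneg _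
  linarith

theorem abs_le_multSize_right (I : Finset (Fin m₁)) (v : Fin m₁ → ℝ) (w : Fin m₂ → ℝ)
    (j : Fin m₂) : |w j| ≤ multSize I v w := by
  refine Real.abs_le_sqrt ?_
  have h1 := Finset.single_le_sum (f := fun j => w j ^ 2) (fun i _ => sq_nonneg _)
    (Finset.mem_univ j)
  have h2 : 0 ≤ ∑ i ∈ I, v i ^ 2 := Finset.sum_nonneg fun j _ => sq_nonneg _
  linarith

theorem MinSingGE.le_norm_conGrad {I : Finset (Fin m₁)} {s : ℝ} {y : Euc dy}
    (h : P.MinSingGE I s y) (v : Fin m₁ → ℝ) (w : Fin m₂ → ℝ) :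
    s * multSize I v w ≤ ‖P.conGrad I y v w‖ := by
  rw [conGrad_eq_toDual, LinearIsometryEquiv.norm_map]
  exact h v w

theorem continuous_fderiv_c {lf0 lf1 lg1 Cf : ℝ} (hP : P.Smooth lf0 lf1 lg1 Cf) (i : Fin m₁) :
    Continuous (fderiv ℝ (P.c i)) :=
  (hP.c_contDiff i).continuous_fderiv (by norm_num)

/-- Close to `y` the constraint gradients move by at most `s / 2` in total, which costs half of the
singular value bound. -/
theorem MinSingGE.eventually_le_norm_conGrad {lf0 lf1 lg1 Cf : ℝ}
    (hP : P.Smooth lf0 lf1 lg1 Cf) {I : Finset (Fin m₁)} {s : ℝ} {y : Euc dy}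
    (hs : 0 < s) (h : P.MinSingGE I s y) :
    ∀ᶠ y' in 𝓝 y, ∀ v w, s / 2 * multSize I v w ≤ ‖P.conGrad I y' v w‖ := by
  have hcont : Continuous fun y' => ∑ i ∈ I, ‖fderiv ℝ (P.c i) y' - fderiv ℝ (P.c i) y‖ :=
    continuous_finsetSum _ fun i _ => ((continuous_fderiv_c hP i).sub continuous_const).norm
  have hsm := (hcont.tendsto y).eventually_le_const (u := s / 2) (by simpa)
  filter_upwards [hsm] with y' hy' v w
  have h1 : P.conGrad I y v w = P.conGrad I y' v w -
      ∑ i ∈ I, v i • (fderiv ℝ (P.c i) y' - fderiv ℝ (P.c i) y) := by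
    simp only [conGrad, smul_sub, Finset.sum_sub_distrib]; abel
  have h2 : ‖∑ i ∈ I, v i • (fderiv ℝ (P.c i) y' - fderiv ℝ (P.c i) y)‖ ≤
      multSize I v w * (s / 2) := by
    refine (norm_sum_le _ _).trans ?_
    refine le_trans ?_ (mul_le_mul_of_nonneg_left hy' (multSize_nonneg I v w))
    rw [Finset.mul_sum]
    refine Finset.sum_le_sum fun i hi => ?_
    rw [norm_smul]
    exact mul_le_mul_of_nonneg_right (abs_le_multSize v w hi) (norm_nonneg _)
  have h3 := h.le_norm_conGrad v w
  rw [h1] at h3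
  have h4 := norm_sub_le (P.conGrad I y' v w)
    (∑ i ∈ I, v i • (fderiv ℝ (P.c i) y' - fderiv ℝ (P.c i) y))
  linarith

theorem RegularSol.kkt_fderiv {lf0 lf1 lg1 Cf : ℝ} (hP : P.Smooth lf0 lf1 lg1 Cf) {x : Euc dx}
    {t : ℝ} {I : Finset (Fin m₁)} {y : Euc dy} {lam : Fin m₁ → ℝ} {nu : Fin m₂ → ℝ}
    (h : P.RegularSol x t I y lam nu) :
    (fderiv ℝ (jointFun (P.h t)) (pairPt x y)).comp (inY dx dy) + P.conGrad I y lam nu = 0 := by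
  have h1 : (fderiv ℝ (jointFun (P.h t)) (pairPt x y)).comp (inY dx dy) =
      InnerProductSpace.toDual ℝ (Euc dy) (gradient (P.h t x) y) := by
    rw [gradient, LinearIsometryEquiv.apply_symm_apply]
    exact (hasFDerivAt_snd_of_jointFun
      ((hP.h_contDiff t).differentiable (by norm_num) _)).fderiv.symm
  rw [h1, conGrad_eq_toDual, ← map_add, ← add_assoc, h.kkt, map_zero]

/-- Lagrange multipliers at a solution at which the gradients of the candidate active constraints
are independent. -/
theorem exists_multipliers {lf0 lf1 lg1 Cf : ℝ} (hP : P.Smooth lf0 lf1 lg1 Cf) {x : Euc dx}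
    {t : ℝ} {I : Finset (Fin m₁)} {y : Euc dy} (hy : y ∈ P.T x t) {s : ℝ} (hs : 0 < s)
    (hsing : ∀ v w, s * multSize I v w ≤ ‖P.conGrad I y v w‖)
    (hI : ∀ i, i ∉ I → P.c i y < 0) :
    ∃ lam nu, (∀ i ∈ I, P.c i y ≠ 0 → lam i = 0) ∧
      (fderiv ℝ (jointFun (P.h t)) (pairPt x y)).comp (inY dx dy) + P.conGrad I y lam nu = 0 := by
  classical
  let A : Finset (Fin m₁) := I.filter fun i => P.c i y = 0
  let F : {i // i ∈ A} ⊕ Fin m₂ → Euc dy → ℝ :=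
    Sum.elim (fun i => P.c i.1) fun j u => inner ℝ (P.a j) u
  let F' : {i // i ∈ A} ⊕ Fin m₂ → StrongDual ℝ (Euc dy) :=
    Sum.elim (fun i => fderiv ℝ (P.c i.1) y) fun j => innerSL ℝ (P.a j)
  have hF : ∀ k, HasStrictFDerivAt (F k) (F' k) y := by
    rintro (i | j)
    · exact (hP.c_contDiff i.1).contDiffAt.hasStrictFDerivAt (by norm_num)
    · exact (innerSL ℝ (P.a j)).hasStrictFDerivAt
  let φ' : StrongDual ℝ (Euc dy) :=
    (fderiv ℝ (jointFun (P.h t)) (pairPt x y)).comp (inY dx dy)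
  have hφ : HasStrictFDerivAt (P.h t x) φ' y := by
    have h1 : HasStrictFDerivAt (fun y : Euc dy => pairPt x y) (inY dx dy) y := by
      simp only [pairPt_eq]
      exact (inY dx dy).hasStrictFDerivAt.const_add _
    exact HasStrictFDerivAt.comp y (g := jointFun (P.h t))
      ((hP.h_contDiff t).contDiffAt.hasStrictFDerivAt (by norm_num)) h1
  have hlt : ∀ᶠ u in 𝓝 y, ∀ i, i ∉ A → P.c i u < 0 := by
    rw [Filter.eventually_all]
    intro i
    by_cases hi : i ∈ A
    · exact Eventually.of_forall fun u h => absurd hi h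
    have : P.c i y < 0 := by
      by_cases hiI : i ∈ I
      · refine lt_of_le_of_ne (hy.1.1 i) fun h => hi (Finset.mem_filter.2 ⟨hiI, h⟩)
      · exact hI i hiI
    filter_upwards [(hP.c_contDiff i).continuous.continuousAt.eventually_lt_const this] with u hu _
      using hu
  -- Constraints outside `A` are strictly slack near `y`, so points with the same values of the
  -- functions in `F` are feasible. The equality-constrained multiplier rule then applies; signs of
  -- the multipliers are not needed.
  have hmin : IsLocalExtrOn (P.h t x) {u | ∀ k, F k u = F k y} y := by
    left
    rw [IsMinFilter, eventually_nhdsWithin_iff]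
    filter_upwards [hlt] with u hu huF
    refine hy.2 u ⟨fun i => ?_, fun j => ?_⟩
    · by_cases hi : i ∈ A
      · exact ((huF (Sum.inl ⟨i, hi⟩)).trans (Finset.mem_filter.1 hi).2).le
      · exact (hu i hi).le
    · exact (huF (Sum.inr j)).trans (hy.1.2 j)
  obtain ⟨lm, l0, hne, hsum⟩ := hmin.exists_multipliers_of_hasStrictFDerivAt hF hφ
  let v : Fin m₁ → ℝ := fun i => if hi : i ∈ A then lm (Sum.inl ⟨i, hi⟩) else 0
  let w : Fin m₂ → ℝ := fun j => lm (Sum.inr j)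
  have hvA : ∀ i ∉ A, v i = 0 := fun i hi => by simp [v, hi]
  have hsum' : ∑ k, lm k • F' k = P.conGrad I y v w := by
    rw [Fintype.sum_sum_type, conGrad]
    congr 1
    rw [← Finset.sum_subset (Finset.filter_subset _ _) (s₁ := A)
      (fun i _ hi => by rw [hvA i hi, zero_smul])]
    rw [← Finset.sum_coe_sort A (fun i => v i • fderiv ℝ (P.c i) y)]
    refine Finset.sum_congr rfl fun i _ => ?_
    simp [v, F', i.2]
  rw [hsum'] at hsum
  -- A vanishing objective multiplier would give a nontrivial relation between the constraint
  -- gradients.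
  have hl0 : l0 ≠ 0 := by
    rintro rfl
    rw [zero_smul, add_zero] at hsum
    have h1 := hsing v w
    rw [hsum, norm_zero] at h1
    have h2 : multSize I v w ≤ 0 := by
      by_contra! h2
      nlinarith
    refine hne (Prod.ext (funext fun k => ?_) rfl)
    rcases k with i | j
    · have h3 := (abs_le_multSize v w (Finset.mem_filter.1 i.2).1).trans h2
      have h4 : v i.1 = 0 := abs_nonpos_iff.1 h3
      simpa [v, i.2] using h4
    · exact abs_nonpos_iff.1 ((abs_le_multSize_right I v w j).trans h2)
  refine ⟨fun i => l0⁻¹ * v i, fun j => l0⁻¹ * w j, fun i hi hc => ?_, ?_⟩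
  · have : i ∉ A := fun h => hc (Finset.mem_filter.1 h).2
    simp [hvA i this]
  · have h1 : P.conGrad I y (fun i => l0⁻¹ * v i) (fun j => l0⁻¹ * w j) =
        l0⁻¹ • P.conGrad I y v w := by
      simp only [conGrad, smul_add, Finset.smul_sum, smul_smul]
    have h2 : P.conGrad I y v w = -(l0 • φ') := by
      rw [eq_neg_iff_add_eq_zero]; exact hsum
    rw [h1, h2, smul_neg, smul_smul, inv_mul_cancel₀ hl0, one_smul]
    exact add_neg_cancel φ'

theorem continuous_fderiv_h {lf0 lf1 lg1 Cf : ℝ} (hP : P.Smooth lf0 lf1 lg1 Cf) :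
    Continuous fun q : Euc dx × ℝ × Euc dy =>
      fderiv ℝ (jointFun (P.h q.2.1)) (pairPt q.1 q.2.2) := by
  simp only [hP.fderiv_h]
  have h1 : Continuous fun q : Euc dx × ℝ × Euc dy => pairPt q.1 q.2.2 := by
    simp only [pairPt_eq]; fun_prop
  have hf := (hP.f_contDiff.continuous_fderiv (by norm_num)).comp h1
  have hg := (hP.g_contDiff.continuous_fderiv (by norm_num)).comp h1
  exact ((continuous_fst.comp continuous_snd).smul hf).add hg

/-- Near a regular solution the active set of a solution does not change, and its multipliers
are close. -/
theorem RegularSol.eventually_active_and_multipliers {lf0 lf1 lg1 Cf : ℝ}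
    (hP : P.Smooth lf0 lf1 lg1 Cf) {x : Euc dx} {t : ℝ} {I : Finset (Fin m₁)} {y : Euc dy}
    {lam : Fin m₁ → ℝ} {nu : Fin m₂ → ℝ} (hR : P.RegularSol x t I y lam nu) {s : ℝ} (hs : 0 < s)
    (hsing : P.MinSingGE I s y) :
    ∀ᶠ q : Euc dx × ℝ × Euc dy in 𝓝 (x, t, y), q.2.2 ∈ P.T q.1 q.2.1 →
      (∀ i ∈ I, P.c i q.2.2 = 0) ∧ ∃ v w,
        (fderiv ℝ (jointFun (P.h q.2.1)) (pairPt q.1 q.2.2) -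
            fderiv ℝ (jointFun (P.h t)) (pairPt x y)).comp (inY dx dy) +
          (∑ i ∈ I, lam i • (fderiv ℝ (P.c i) q.2.2 - fderiv ℝ (P.c i) y)) +
          P.conGrad I q.2.2 v w = 0 ∧
        s / 2 * multSize I v w ≤
          ‖(fderiv ℝ (jointFun (P.h q.2.1)) (pairPt q.1 q.2.2) -
            fderiv ℝ (jointFun (P.h t)) (pairPt x y)).comp (inY dx dy)‖ +
          ∑ i ∈ I, lam i * ‖fderiv ℝ (P.c i) q.2.2 - fderiv ℝ (P.c i) y‖ := by
  have hq2 : Tendsto (fun q : Euc dx × ℝ × Euc dy => q.2.2) (𝓝 (x, t, y)) (𝓝 y) :=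
    (continuous_snd.comp continuous_snd).tendsto (x, t, y)
  have hinact : ∀ᶠ y' in 𝓝 y, ∀ i, i ∉ I → P.c i y' < 0 := by
    rw [Filter.eventually_all]
    intro i
    by_cases hi : i ∈ I
    · exact Eventually.of_forall fun u h => absurd hi h
    have : P.c i y < 0 := lt_of_le_of_ne (hR.mem.1.1 i) fun h => hi ((hR.active i).2 h)
    filter_upwards [(hP.c_contDiff i).continuous.continuousAt.eventually_lt_const this] with u hu _
      using hu
  let B : Euc dx × ℝ × Euc dy → ℝ := fun q =>
    ‖(fderiv ℝ (jointFun (P.h q.2.1)) (pairPt q.1 q.2.2) -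
            fderiv ℝ (jointFun (P.h t)) (pairPt x y)).comp (inY dx dy)‖ +
          ∑ i ∈ I, lam i * ‖fderiv ℝ (P.c i) q.2.2 - fderiv ℝ (P.c i) y‖
  have hBc : Continuous B := by
    refine Continuous.add ?_ (continuous_finsetSum _ fun i _ => ?_)
    · exact (((continuous_fderiv_h hP).sub continuous_const).clm_comp continuous_const).norm
    · exact continuous_const.mul ((((continuous_fderiv_c hP i).comp
        (continuous_snd.comp continuous_snd)).sub continuous_const).norm)
  have hB0 : B (x, t, y) = 0 := by simp [B]
  have hBsm : ∀ᶠ q in 𝓝 (x, t, y), ∀ i, i ∈ I → B q < s / 2 * lam i := by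
    rw [Filter.eventually_all]
    intro i
    by_cases hi : i ∈ I
    · have : B (x, t, y) < s / 2 * lam i := by
        rw [hB0]; have := hR.strict i hi; positivity
      filter_upwards [hBc.continuousAt.eventually_lt_const this] with q hq _ using hq
    · exact Eventually.of_forall fun u h => absurd h hi
  filter_upwards [hq2.eventually hinact, hBsm,
    hq2.eventually (hsing.eventually_le_norm_conGrad hP hs)] with q h1 h2 h3 hq
  obtain ⟨lam', nu', hl, hk⟩ := exists_multipliers hP hq (by positivity) h3 h1
  have hk0 := hR.kkt_fderiv hP
  have key : (fderiv ℝ (jointFun (P.h q.2.1)) (pairPt q.1 q.2.2) -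
            fderiv ℝ (jointFun (P.h t)) (pairPt x y)).comp (inY dx dy) +
          (∑ i ∈ I, lam i • (fderiv ℝ (P.c i) q.2.2 - fderiv ℝ (P.c i) y)) +
          P.conGrad I q.2.2 (lam' - lam) (nu' - nu) = 0 := by
    have e : P.conGrad I q.2.2 lam nu - P.conGrad I y lam nu =
        ∑ i ∈ I, lam i • (fderiv ℝ (P.c i) q.2.2 - fderiv ℝ (P.c i) y) := by
      simp only [conGrad, smul_sub, Finset.sum_sub_distrib]; abel
    rw [← e, conGrad_sub, ContinuousLinearMap.sub_comp, ← sub_eq_zero.2 (hk.trans hk0.symm)]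
    abel
  have hsize : s / 2 * multSize I (lam' - lam) (nu' - nu) ≤ B q := by
    refine (h3 _ _).trans ?_
    rw [eq_neg_of_add_eq_zero_right key, norm_neg]
    refine (norm_add_le _ _).trans (add_le_add le_rfl ((norm_sum_le _ _).trans ?_))
    refine Finset.sum_le_sum fun i hi => ?_
    rw [norm_smul, Real.norm_of_nonneg (hR.strict i hi).le]
  refine ⟨fun i hi => ?_, _, _, key, hsize⟩
  -- A constraint that became inactive would have multiplier zero, a jump of size `lam i`; but the
  -- multiplier change is smaller than that by `hBsm`.
  by_contra hc
  have h4 := abs_le_multSize (lam' - lam) (nu' - nu) hi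
  rw [Pi.sub_apply, hl i hi hc, zero_sub, abs_neg, abs_of_pos (hR.strict i hi)] at h4
  have h5 := h2 i hi
  have h6 := mul_le_mul_of_nonneg_left h4 (show 0 ≤ s / 2 by positivity)
  linarith

end Bilevel

/-! ### The critical subspace and the linearized stationarity conditions. -/

namespace Bilevel

variable {dx dy m₁ m₂ : ℕ} {P : Bilevel dx dy m₁ m₂}

variable (P) in
/-- The critical subspace: the directions orthogonal to the active constraint gradients. -/
def critSpace (I : Finset (Fin m₁)) (y : Euc dy) : Submodule ℝ (Euc dy) where
  carrier := {w | (∀ i ∈ I, fderiv ℝ (P.c i) y w = 0) ∧ ∀ j, inner ℝ (P.a j) w = 0}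
  zero_mem' := by simp
  add_mem' := fun {u v} hu hv => ⟨fun i hi => by rw [map_add, hu.1 i hi, hv.1 i hi, add_zero],
    fun j => by rw [inner_add_right, hu.2 j, hv.2 j, add_zero]⟩
  smul_mem' := fun r u hu => ⟨fun i hi => by rw [map_smul, hu.1 i hi, smul_zero],
    fun j => by rw [inner_smul_right, hu.2 j, mul_zero]⟩

variable (P) in
/-- The Hessian in `y` of the Lagrangian of the perturbed lower-level problem. -/
def lagForm (x : Euc dx) (t : ℝ) (I : Finset (Fin m₁)) (y : Euc dy) (lam : Fin m₁ → ℝ) :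
    Euc dy →L[ℝ] Euc dy →L[ℝ] ℝ :=
  (hessForm (jointFun (P.h t)) (pairPt x y)).bilinearComp (inY dx dy) (inY dx dy) +
    ∑ i ∈ I, lam i • hessForm (P.c i) y

theorem lagForm_apply (x : Euc dx) (t : ℝ) (I : Finset (Fin m₁)) (y : Euc dy)
    (lam : Fin m₁ → ℝ) (u w : Euc dy) :
    P.lagForm x t I y lam u w =
      hessForm (jointFun (P.h t)) (pairPt x y) (inY dx dy u) (inY dx dy w) +
        ∑ i ∈ I, lam i * hessForm (P.c i) y u w := by
  simp [lagForm]

theorem lagForm_symm {lf0 lf1 lg1 Cf : ℝ} (hP : P.Smooth lf0 lf1 lg1 Cf) (x : Euc dx) (t : ℝ)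
    (I : Finset (Fin m₁)) (y : Euc dy) (lam : Fin m₁ → ℝ) (u w : Euc dy) :
    P.lagForm x t I y lam u w = P.lagForm x t I y lam w u := by
  rw [lagForm_apply, lagForm_apply, hessForm_symm (hP.h_contDiff t)]
  simp_rw [fun i => hessForm_symm (hP.c_contDiff i) y u w]

theorem conGrad_apply_of_mem_critSpace {I : Finset (Fin m₁)} {y w : Euc dy}
    (hw : w ∈ P.critSpace I y) (v : Fin m₁ → ℝ) (w' : Fin m₂ → ℝ) (y' : Euc dy) :
    P.conGrad I y' v w' w = ∑ i ∈ I, v i * (fderiv ℝ (P.c i) y' - fderiv ℝ (P.c i) y) w := by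
  rw [conGrad_apply]
  have h2 : ∑ j, w' j * inner ℝ (P.a j) w = 0 :=
    Finset.sum_eq_zero fun j _ => by rw [hw.2 j, mul_zero]
  rw [h2, add_zero]
  refine Finset.sum_congr rfl fun i hi => ?_
  rw [_root_.sub_apply, hw.1 i hi, sub_zero]

/-- A functional that vanishes on the critical subspace is a combination of constraint gradients. -/
theorem exists_eq_conGrad {I : Finset (Fin m₁)} {y : Euc dy} (φ : Euc dy →L[ℝ] ℝ)
    (h : ∀ w ∈ P.critSpace I y, φ w = 0) : ∃ v w, φ = P.conGrad I y v w := by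
  classical
  let L : {i // i ∈ I} ⊕ Fin m₂ → Euc dy →ₗ[ℝ] ℝ :=
    Sum.elim (fun i => (fderiv ℝ (P.c i.1) y : Euc dy →ₗ[ℝ] ℝ))
      fun j => (innerSL ℝ (P.a j) : Euc dy →ₗ[ℝ] ℝ)
  have hk : ⨅ k, LinearMap.ker (L k) ≤ LinearMap.ker (φ : Euc dy →ₗ[ℝ] ℝ) := by
    intro w hw
    rw [Submodule.mem_iInf] at hw
    exact h w ⟨fun i hi => hw (Sum.inl ⟨i, hi⟩), fun j => hw (Sum.inr j)⟩
  obtain ⟨c, hc⟩ := (Submodule.mem_span_range_iff_exists_fun ℝ).1 (mem_span_of_iInf_ker_le_ker hk)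
  refine ⟨fun i => if hi : i ∈ I then c (Sum.inl ⟨i, hi⟩) else 0, fun j => c (Sum.inr j), ?_⟩
  ext d
  have := LinearMap.congr_fun hc d
  rw [Fintype.sum_sum_type] at this
  simp only [LinearMap.add_apply, LinearMap.sum_apply, LinearMap.smul_apply, L, Sum.elim_inl,
    Sum.elim_inr, ContinuousLinearMap.coe_coe, smul_eq_mul, innerSL_apply_apply] at this
  rw [← this, conGrad_apply, ← Finset.sum_coe_sort I]
  congr 1
  refine Finset.sum_congr rfl fun i _ => ?_
  simp [i.2]

section Linearization

variable {lf0 lf1 lg1 Cf : ℝ} {x : Euc dx} {t : ℝ} {I : Finset (Fin m₁)} {y : Euc dy}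
  {lam : Fin m₁ → ℝ} {nu : Fin m₂ → ℝ} {α : Type*} {l : Filter α} {x' : α → Euc dx} {t' : α → ℝ}
  {y' : α → Euc dy} {r : α → ℝ}

theorem tendsto_of_isBigO (hr : Tendsto r l (𝓝 0))
    (hx : (fun k => x' k - x) =O[l] r) (ht : (fun k => t' k - t) =O[l] r)
    (hy : (fun k => y' k - y) =O[l] r) :
    Tendsto (fun k => (x' k, t' k, y' k)) l (𝓝 (x, t, y)) :=
  (tendsto_sub_nhds_zero_iff.1 (hx.trans_tendsto hr)).prodMk_nhds
    ((tendsto_sub_nhds_zero_iff.1 (ht.trans_tendsto hr)).prodMk_nhds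
      (tendsto_sub_nhds_zero_iff.1 (hy.trans_tendsto hr)))

theorem pairPt_sub_isBigO (hx : (fun k => x' k - x) =O[l] r) (hy : (fun k => y' k - y) =O[l] r) :
    (fun k => pairPt (x' k) (y' k) - pairPt x y) =O[l] r := by
  simp only [pairPt_sub]
  exact (((inX dx dy).isBigO_comp _ l).trans hx).add (((inY dx dy).isBigO_comp _ l).trans hy)

theorem tendsto_pairPt (hr : Tendsto r l (𝓝 0))
    (hx : (fun k => x' k - x) =O[l] r) (hy : (fun k => y' k - y) =O[l] r) :
    Tendsto (fun k => pairPt (x' k) (y' k)) l (𝓝 (pairPt x y)) :=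
  tendsto_sub_nhds_zero_iff.1 ((pairPt_sub_isBigO hx hy).trans_tendsto hr)

/-- Active constraints vanish at both `y` and `y' k`, so the displacement is tangent to them up to
first order. -/
theorem RegularSol.fderiv_c_isLittleO (hP : P.Smooth lf0 lf1 lg1 Cf)
    (hR : P.RegularSol x t I y lam nu) {s : ℝ} (hs : 0 < s) (hsing : P.MinSingGE I s y)
    (hr : Tendsto r l (𝓝 0)) (hx : (fun k => x' k - x) =O[l] r)
    (ht : (fun k => t' k - t) =O[l] r) (hy : (fun k => y' k - y) =O[l] r)
    (hT : ∀ᶠ k in l, y' k ∈ P.T (x' k) (t' k)) {i : Fin m₁} (hi : i ∈ I) :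
    (fun k => fderiv ℝ (P.c i) y (y' k - y)) =o[l] r := by
  have h1 := (tendsto_of_isBigO hr hx ht hy).eventually
    (hR.eventually_active_and_multipliers hP hs hsing)
  have h2 := ((hP.c_contDiff i).differentiable (by norm_num) y).hasFDerivAt.isLittleO
  have h3 := (h2.comp_tendsto (tendsto_sub_nhds_zero_iff.1 (hy.trans_tendsto hr))).trans_isBigO hy
  refine h3.neg_left.congr' ?_ EventuallyEq.rfl
  filter_upwards [h1, hT] with k hk hTk
  simp only [Function.comp]
  rw [(hk hTk).1 i hi, (hR.active i).1 hi]; ring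

theorem RegularSol.conGrad_isLittleO (hP : P.Smooth lf0 lf1 lg1 Cf)
    (hR : P.RegularSol x t I y lam nu) {s : ℝ} (hs : 0 < s) (hsing : P.MinSingGE I s y)
    (hr : Tendsto r l (𝓝 0)) (hx : (fun k => x' k - x) =O[l] r)
    (ht : (fun k => t' k - t) =O[l] r) (hy : (fun k => y' k - y) =O[l] r)
    (hT : ∀ᶠ k in l, y' k ∈ P.T (x' k) (t' k)) (v : Fin m₁ → ℝ) (w : Fin m₂ → ℝ) :
    (fun k => P.conGrad I y v w (y' k - y)) =o[l] r := by
  have h1 : (fun k => ∑ i ∈ I, v i * fderiv ℝ (P.c i) y (y' k - y)) =o[l] r :=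
    Asymptotics.IsLittleO.fun_sum fun i hi =>
      (hR.fderiv_c_isLittleO hP hs hsing hr hx ht hy hT hi).const_mul_left _
  refine h1.congr' ?_ EventuallyEq.rfl
  filter_upwards [hT] with k hk
  rw [conGrad_apply]
  have : ∑ j, w j * inner ℝ (P.a j) (y' k - y) = 0 := Finset.sum_eq_zero fun j _ => by
    rw [inner_sub_right, hk.1.2 j, hR.mem.1.2 j, sub_self, mul_zero]
  rw [this, add_zero]

/-- Linearization of the stationarity conditions at a regular solution, tested with critical
directions. -/
theorem RegularSol.linearization (hP : P.Smooth lf0 lf1 lg1 Cf)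
    (hR : P.RegularSol x t I y lam nu) {s : ℝ} (hs : 0 < s) (hsing : P.MinSingGE I s y)
    (hr : Tendsto r l (𝓝 0)) (hx : (fun k => x' k - x) =O[l] r)
    (ht : (fun k => t' k - t) =O[l] r) (hy : (fun k => y' k - y) =O[l] r)
    (hT : ∀ᶠ k in l, y' k ∈ P.T (x' k) (t' k)) {w : Euc dy} (hw : w ∈ P.critSpace I y) :
    (fun k => P.lagForm x t I y lam (y' k - y) w +
      hessForm (jointFun (P.h t)) (pairPt x y) (inX dx dy (x' k - x)) (inY dx dy w) +
      (t' k - t) * fderiv ℝ (jointFun P.f) (pairPt x y) (inY dx dy w)) =o[l] r := by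
  have hz := tendsto_pairPt hr hx hy
  have hzO := pairPt_sub_isBigO hx hy
  have hyt : Tendsto y' l (𝓝 y) := tendsto_sub_nhds_zero_iff.1 (hy.trans_tendsto hr)
  have hall := tendsto_of_isBigO hr hx ht hy
  have e1 : (fun k => (fderiv ℝ (jointFun (P.h t)) (pairPt (x' k) (y' k)) -
      fderiv ℝ (jointFun (P.h t)) (pairPt x y) -
      hessForm (jointFun (P.h t)) (pairPt x y) (pairPt (x' k) (y' k) - pairPt x y))
        (inY dx dy w)) =o[l] r := by
    have h1 := ((hP.h_contDiff t).hasFDerivAt_fderiv (pairPt x y)).isLittleO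
    have h2 := (h1.comp_tendsto hz).trans_isBigO hzO
    exact ((ContinuousLinearMap.apply ℝ ℝ (inY dx dy w)).isBigO_comp _ l).trans_isLittleO h2
  have e2 : (fun k => (t' k - t) * (fderiv ℝ (jointFun P.f) (pairPt (x' k) (y' k)) -
      fderiv ℝ (jointFun P.f) (pairPt x y)) (inY dx dy w)) =o[l] r := by
    have h1 : Tendsto (fun k => (fderiv ℝ (jointFun P.f) (pairPt (x' k) (y' k)) -
      fderiv ℝ (jointFun P.f) (pairPt x y)) (inY dx dy w)) l (𝓝 0) := by
      have hc : Continuous fun z => (fderiv ℝ (jointFun P.f) z -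
          fderiv ℝ (jointFun P.f) (pairPt x y)) (inY dx dy w) :=
        ((hP.f_contDiff.continuous_fderiv (by norm_num)).sub continuous_const).clm_apply
          continuous_const
      have := (hc.tendsto (pairPt x y)).comp hz
      rwa [sub_self, _root_.zero_apply] at this
    have := ht.mul_isLittleO ((Asymptotics.isLittleO_one_iff ℝ).2 h1)
    simpa using this
  have e3 : (fun k => ∑ i ∈ I, lam i * (fderiv ℝ (P.c i) (y' k) - fderiv ℝ (P.c i) y -
      hessForm (P.c i) y (y' k - y)) w) =o[l] r := by
    refine Asymptotics.IsLittleO.fun_sum fun i _ => Asymptotics.IsLittleO.const_mul_left ?_ _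
    have h1 := ((hP.c_contDiff i).hasFDerivAt_fderiv y).isLittleO
    have h2 := (h1.comp_tendsto hyt).trans_isBigO hy
    exact ((ContinuousLinearMap.apply ℝ ℝ w).isBigO_comp _ l).trans_isLittleO h2
  -- Testing the difference of the two stationarity conditions with a critical `w` kills the
  -- multiplier changes up to their products with increments of constraint gradients, which are
  -- `o(1) · O(r)`.
  have e4 : (fun k => (fderiv ℝ (jointFun (P.h (t' k))) (pairPt (x' k) (y' k)) -
      fderiv ℝ (jointFun (P.h t)) (pairPt x y)) (inY dx dy w) +
      ∑ i ∈ I, lam i * (fderiv ℝ (P.c i) (y' k) - fderiv ℝ (P.c i) y) w) =o[l] r := by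
    let B : Euc dx × ℝ × Euc dy → ℝ := fun q =>
      ‖(fderiv ℝ (jointFun (P.h q.2.1)) (pairPt q.1 q.2.2) -
            fderiv ℝ (jointFun (P.h t)) (pairPt x y)).comp (inY dx dy)‖ +
          ∑ i ∈ I, lam i * ‖fderiv ℝ (P.c i) q.2.2 - fderiv ℝ (P.c i) y‖
    have hBc : Continuous B := by
      refine Continuous.add ?_ (continuous_finsetSum _ fun i _ => ?_)
      · exact (((continuous_fderiv_h hP).sub continuous_const).clm_comp continuous_const).norm
      · exact continuous_const.mul ((((continuous_fderiv_c hP i).comp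
          (continuous_snd.comp continuous_snd)).sub continuous_const).norm)
    have hB0 : B (x, t, y) = 0 := by simp [B]
    have hBlim : Tendsto (fun k => B (x' k, t' k, y' k)) l (𝓝 0) :=
      hB0 ▸ (hBc.tendsto (x, t, y)).comp hall
    have hD : ∀ i, (fun k => (fderiv ℝ (P.c i) (y' k) - fderiv ℝ (P.c i) y) w) =O[l] r := by
      intro i
      have h1 := ((hP.c_contDiff i).hasFDerivAt_fderiv y).isBigO_sub
      have h2 := (h1.comp_tendsto hyt).trans hy
      exact ((ContinuousLinearMap.apply ℝ ℝ w).isBigO_comp _ l).trans h2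
    have hbound : (fun k => ∑ i ∈ I, (2 / s * B (x' k, t' k, y' k)) *
        |(fderiv ℝ (P.c i) (y' k) - fderiv ℝ (P.c i) y) w|) =o[l] r := by
      refine Asymptotics.IsLittleO.fun_sum fun i _ => ?_
      have h1 : Tendsto (fun k => 2 / s * B (x' k, t' k, y' k)) l (𝓝 0) := by
        simpa using hBlim.const_mul (2 / s)
      have := ((Asymptotics.isLittleO_one_iff ℝ).2 h1).mul_isBigO (hD i).abs_left
      simpa using this
    refine Asymptotics.IsBigO.trans_isLittleO (Asymptotics.IsBigO.of_bound 1 ?_) hbound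
    filter_upwards [hall.eventually (hR.eventually_active_and_multipliers hP hs hsing), hT]
      with k hk hTk
    obtain ⟨-, v, w', hkey, hsize⟩ := hk hTk
    have h1 := congrArg (fun L => L w) hkey
    simp only [_root_.add_apply, ContinuousLinearMap.comp_apply,
      _root_.sum_apply, _root_.smul_apply, smul_eq_mul,
      _root_.zero_apply] at h1
    rw [conGrad_apply_of_mem_critSpace hw] at h1
    rw [eq_neg_of_add_eq_zero_left h1, norm_neg, one_mul]
    refine le_trans ?_ (le_abs_self _)
    refine (norm_sum_le _ _).trans (Finset.sum_le_sum fun i hi => ?_)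
    rw [norm_mul]
    refine mul_le_mul_of_nonneg_right ?_ (norm_nonneg _)
    refine (abs_le_multSize v w' hi).trans ?_
    rw [div_mul_eq_mul_div, le_div_iff₀ hs]
    simp only [B]
    linarith
  refine (((e4.sub e1).sub e2).sub e3).congr_left fun k => ?_
  simp only [hP.fderiv_h, lagForm_apply, pairPt_sub, map_add, _root_.add_apply, _root_.sub_apply,
    _root_.smul_apply, smul_eq_mul, mul_sub, Finset.sum_sub_distrib]
  ring

end Linearization

end Bilevel

/-! ### Kernel of the Lagrangian Hessian and curves in the active manifold. -/

theorem eq_zero_of_mul_const_isLittleO {α : Type*} {l : Filter α} [l.NeBot] {r : α → ℝ} {c : ℝ}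
    (h : (fun k => r k * c) =o[l] r) (hr : ∀ᶠ k in l, r k ≠ 0) : c = 0 := by
  by_contra hc
  have h1 := (Asymptotics.isLittleO_iff.1 h) (show 0 < |c| / 2 by positivity)
  obtain ⟨k, hk, hk0⟩ := (h1.and hr).exists
  rw [norm_mul, mul_comm] at hk
  have h2 : |c| ≤ |c| / 2 := le_of_mul_le_mul_right hk (norm_pos_iff.2 hk0)
  have h3 : 0 < |c| := by positivity
  linarith

theorem isLittleO_second_order_taylor {E : Type*} [NormedAddCommGroup E] [NormedSpace ℝ E]
    {φ : E → ℝ} (hφ : ContDiff ℝ 2 φ) (p : E) :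
    (fun q => φ q - φ p - fderiv ℝ φ p (q - p) - 1 / 2 * hessForm φ p (q - p) (q - p))
      =o[𝓝 p] fun q => ‖q - p‖ ^ 2 := by
  rw [Asymptotics.isLittleO_iff]
  intro c hc
  have h1 := (Asymptotics.isLittleO_iff.1 (hφ.hasFDerivAt_fderiv p).isLittleO) hc
  rw [Metric.eventually_nhds_iff] at h1 ⊢
  obtain ⟨r, hr, h1⟩ := h1
  refine ⟨r, hr, fun q hq => ?_⟩
  have hd : ∀ v, HasFDerivAt
      (fun v => φ v - fderiv ℝ φ p (v - p) - 1 / 2 * hessForm φ p (v - p) (v - p))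
      (fderiv ℝ φ v - fderiv ℝ φ p - hessForm φ p (v - p)) v := by
    intro v
    have a1 := (hφ.differentiable (by norm_num) v).hasFDerivAt
    have a0 : HasFDerivAt (fun v : E => v - p) (ContinuousLinearMap.id ℝ E) v :=
      (hasFDerivAt_id v).sub_const p
    have a2 := (fderiv ℝ φ p).hasFDerivAt.comp v a0
    have a3 := ((hessForm φ p).hasFDerivAt_of_bilinear a0 a0).const_mul (1 / 2)
    convert! (a1.sub a2).sub a3 using 1
    ext w
    simp [hessForm_symm hφ p v w, hessForm_symm hφ p p w]
    ring
  have := (convex_closedBall p ‖q - p‖).norm_image_sub_le_of_norm_hasFDerivWithin_le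
    (fun v _ => (hd v).hasFDerivWithinAt) (C := c * ‖q - p‖) (x := p) (y := q) ?_
    (Metric.mem_closedBall_self (norm_nonneg _)) (by simp [dist_eq_norm])
  · simp only [sub_self, map_zero, sub_zero, mul_zero] at this
    rw [Real.norm_of_nonneg (sq_nonneg ‖q - p‖), sq, ← mul_assoc]
    convert! this using 2
    ring
  · intro v hv
    rw [Metric.mem_closedBall, dist_eq_norm] at hv
    refine (h1 ?_).trans (mul_le_mul_of_nonneg_left hv hc.le)
    rw [dist_eq_norm] at hq ⊢
    exact hv.trans_lt hq

namespace Bilevel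

variable {dx dy m₁ m₂ : ℕ} {P : Bilevel dx dy m₁ m₂}
  {lf0 lf1 lg1 Cf ρ μ δ σ₀ s : ℝ} {x : Euc dx} {t : ℝ} {I : Finset (Fin m₁)} {y : Euc dy}
  {lam : Fin m₁ → ℝ} {nu : Fin m₂ → ℝ}

/-- For `z` in the kernel, `lagForm z` is a combination of constraint gradients, so it is negligible
on the displacement `y' - y`. Only the data perturbation survives in the linearized condition, which
becomes a constraint on the data. -/
theorem RegularSol.kernel_linearization {α : Type*} {l : Filter α} {x' : α → Euc dx} {t' : α → ℝ}
    {y' : α → Euc dy} {r : α → ℝ} (hP : P.Smooth lf0 lf1 lg1 Cf)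
    (hR : P.RegularSol x t I y lam nu) (hs : 0 < s) (hsing : P.MinSingGE I s y)
    (hr : Tendsto r l (𝓝 0)) (hx : (fun k => x' k - x) =O[l] r)
    (ht : (fun k => t' k - t) =O[l] r) (hy : (fun k => y' k - y) =O[l] r)
    (hT : ∀ᶠ k in l, y' k ∈ P.T (x' k) (t' k)) {z : Euc dy} (hz : z ∈ P.critSpace I y)
    (hz0 : ∀ w ∈ P.critSpace I y, P.lagForm x t I y lam z w = 0) :
    (fun k => hessForm (jointFun (P.h t)) (pairPt x y) (inX dx dy (x' k - x)) (inY dx dy z) +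
      (t' k - t) * fderiv ℝ (jointFun P.f) (pairPt x y) (inY dx dy z)) =o[l] r := by
  obtain ⟨v, w, hvw⟩ := exists_eq_conGrad _ hz0
  refine ((hR.linearization hP hs hsing hr hx ht hy hT hz).sub
    (hR.conGrad_isLittleO hP hs hsing hr hx ht hy hT v w)).congr_left fun k => ?_
  rw [← hvw, lagForm_symm hP x t I y lam z]; ring

/-- `∇_y f` vanishes on the kernel of the Hessian of the Lagrangian. -/
theorem RegularSol.fderiv_f_kernel (hP : P.Smooth lf0 lf1 lg1 Cf) (hρ : 0 < ρ) (hμ : 0 < μ)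
    (hδ : 0 < δ) (hσ₀ : 0 < σ₀) (hEB : P.ProxEB ρ μ δ σ₀) (hx : x ∈ P.X) (ht : t ∈ Icc 0 σ₀)
    (hR : P.RegularSol x t I y lam nu) (hs : 0 < s) (hsing : P.MinSingGE I s y)
    {z : Euc dy} (hz : z ∈ P.critSpace I y)
    (hz0 : ∀ w ∈ P.critSpace I y, P.lagForm x t I y lam z w = 0) :
    fderiv ℝ (jointFun P.f) (pairPt x y) (inY dx dy z) = 0 := by
  obtain ⟨C, hC, H⟩ := exists_lipschitz_near_mem_T hP hρ hμ hδ hEB hx ht hR.mem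
  -- Punctured and confined to the parameter interval, so that both end points are covered.
  let l : Filter ℝ := 𝓝[≠] t ⊓ 𝓟 (Icc 0 σ₀)
  have : l.NeBot := (uniqueDiffOn_Icc hσ₀ t ht).accPt
  have hl : l ≤ 𝓝 t := inf_le_left.trans nhdsWithin_le_nhds
  have hlim : Tendsto (fun t' : ℝ => (x, t')) l (𝓝[P.X ×ˢ Icc 0 σ₀] (x, t)) := by
    refine tendsto_nhdsWithin_iff.2 ⟨?_, ?_⟩
    · have : Continuous fun t' : ℝ => (x, t') := by fun_prop
      exact (this.tendsto t).mono_left hl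
    · have : ∀ᶠ t' in l, t' ∈ Icc 0 σ₀ := mem_inf_of_right (mem_principal_self _)
      filter_upwards [this] with t' ht' using ⟨hx, ht'⟩
  obtain ⟨y', hy'⟩ := (hlim.eventually H).choice
  have h0 : Tendsto (fun t' => t' - t) l (𝓝 0) :=
    tendsto_sub_nhds_zero_iff.2 (tendsto_id.mono_left hl)
  have hk := hR.kernel_linearization hP hs hsing (l := l) (x' := fun _ => x) (t' := fun t' => t')
    (y' := y') (r := fun t' => t' - t) h0 (by simpa using Asymptotics.isBigO_zero _ _)
    (Asymptotics.isBigO_refl _ _) (Asymptotics.IsBigO.of_bound C (by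
      filter_upwards [hy'] with k hk
      simpa using hk.2)) (hy'.mono fun k hk => hk.1) hz hz0
  simp only [sub_self, map_zero, _root_.zero_apply, zero_add] at hk
  refine eq_zero_of_mul_const_isLittleO hk ?_
  have : ∀ᶠ t' in l, t' ∈ ({t}ᶜ : Set ℝ) := mem_inf_of_left self_mem_nhdsWithin
  filter_upwards [this] with t' ht' using sub_ne_zero.2 ht'

/-- The mixed derivatives in feasible directions vanish on the kernel of the Hessian of the
Lagrangian. -/
theorem RegularSol.hessForm_mixed_kernel (hP : P.Smooth lf0 lf1 lg1 Cf) (hρ : 0 < ρ) (hμ : 0 < μ)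
    (hδ : 0 < δ) (hEB : P.ProxEB ρ μ δ σ₀) (hx : x ∈ P.X) (ht : t ∈ Icc 0 σ₀)
    (hR : P.RegularSol x t I y lam nu) (hs : 0 < s) (hsing : P.MinSingGE I s y)
    {z : Euc dy} (hz : z ∈ P.critSpace I y)
    (hz0 : ∀ w ∈ P.critSpace I y, P.lagForm x t I y lam z w = 0) {e : Euc dx}
    (he : e ∈ vectorSpan ℝ P.X) :
    hessForm (jointFun (P.h t)) (pairPt x y) (inX dx dy e) (inY dx dy z) = 0 := by
  rw [vectorSpan_eq_span_vsub_set_right ℝ hx] at he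
  induction he using Submodule.span_induction with
  | zero => simp
  | add u v _ _ hu hv => simp [hu, hv]
  | smul c u _ hu => simp [hu]
  | mem e he =>
    obtain ⟨x₂, hx₂, rfl⟩ := he
    simp only [vsub_eq_sub]
    obtain ⟨C, hC, H⟩ := eventually_exists_mem_T hP hρ hμ hδ hEB hx ht hR.mem
    have hid : Tendsto (fun ε : ℝ => ε) (𝓝[>] 0) (𝓝 0) := nhdsWithin_le_nhds
    have hlim : Tendsto (fun ε : ℝ => x + ε • (x₂ - x)) (𝓝[>] 0) (𝓝[P.X] x) := by
      refine tendsto_nhdsWithin_iff.2 ⟨?_, ?_⟩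
      · have : Continuous fun ε : ℝ => x + ε • (x₂ - x) := by fun_prop
        simpa using (this.tendsto 0).mono_left nhdsWithin_le_nhds
      · filter_upwards [Ioo_mem_nhdsGT one_pos] with ε hε
        exact hP.X_convex.add_smul_sub_mem hx hx₂ ⟨hε.1.le, hε.2.le⟩
    obtain ⟨y', hy'⟩ := (hlim.eventually H).choice
    have hxO : (fun ε : ℝ => x + ε • (x₂ - x) - x) =O[𝓝[>] 0] fun ε => ε := by
      refine Asymptotics.IsBigO.of_bound ‖x₂ - x‖ (Eventually.of_forall fun ε => ?_)
      rw [add_sub_cancel_left, norm_smul, mul_comm]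
    have hk := hR.kernel_linearization hP hs hsing (l := 𝓝[>] (0 : ℝ))
      (x' := fun ε => x + ε • (x₂ - x)) (t' := fun _ => t) (y' := y') (r := fun ε => ε) hid hxO
      (by simpa using Asymptotics.isBigO_zero _ _)
      ((Asymptotics.IsBigO.of_bound C (hy'.mono fun k hk => hk.2)).trans hxO)
      (hy'.mono fun k hk => hk.1) hz hz0
    simp only [sub_self, zero_mul, add_zero, add_sub_cancel_left, map_smul,
      _root_.smul_apply, smul_eq_mul] at hk
    refine eq_zero_of_mul_const_isLittleO hk ?_
    filter_upwards [self_mem_nhdsWithin] with ε hε using (mem_Ioi.1 hε).ne'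

/-- A curve in the active constraint manifold with a given critical velocity. -/
theorem RegularSol.exists_curve (hP : P.Smooth lf0 lf1 lg1 Cf)
    (hR : P.RegularSol x t I y lam nu) (hs : 0 < s) (hsing : P.MinSingGE I s y) {u : Euc dy}
    (hu : u ∈ P.critSpace I y) :
    ∃ γ : ℝ → Euc dy, γ 0 = y ∧ HasDerivAt γ u 0 ∧
      ∀ᶠ ε in 𝓝 (0 : ℝ), γ ε ∈ P.Y ∧ ∀ i ∈ I, P.c i (γ ε) = 0 := by
  classical
  let ι := {i // i ∈ I} ⊕ Fin m₂
  let F : Euc dy → ι → ℝ := fun v => Sum.elim (fun i => P.c i.1 v) fun j => inner ℝ (P.a j) v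
  let F' : Euc dy →L[ℝ] ι → ℝ := ContinuousLinearMap.pi
    (Sum.elim (fun i => fderiv ℝ (P.c i.1) y) fun j => innerSL ℝ (P.a j))
  have hF : HasStrictFDerivAt F F' y := by
    refine hasStrictFDerivAt_pi.2 ?_
    rintro (i | j)
    · exact (hP.c_contDiff i.1).contDiffAt.hasStrictFDerivAt (by norm_num)
    · exact (innerSL ℝ (P.a j)).hasStrictFDerivAt
  -- A functional vanishing on the range is a relation between the constraint gradients; the
  -- singular value bound makes it zero.
  have hrange : F'.range = ⊤ := by
    by_contra hne
    obtain ⟨ℓ, hℓ, hle⟩ := Submodule.exists_le_ker_of_lt_top _ (lt_top_iff_ne_top.2 hne)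
    apply hℓ
    let v : Fin m₁ → ℝ := fun i =>
      if hi : i ∈ I then ℓ (fun k => if Sum.inl ⟨i, hi⟩ = k then 1 else 0) else 0
    let w : Fin m₂ → ℝ := fun j => ℓ (fun k => if Sum.inr j = k then 1 else 0)
    have hcon : P.conGrad I y v w = 0 := by
      ext d
      have h1 : ℓ (F' d) = 0 := hle ⟨d, rfl⟩
      rw [LinearMap.pi_apply_eq_sum_univ, Fintype.sum_sum_type] at h1
      rw [conGrad_apply, ← Finset.sum_coe_sort I, _root_.zero_apply, ← h1]
      congr 1
      · refine Finset.sum_congr rfl fun i _ => ?_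
        simp only [v, i.2, dif_pos, F', ContinuousLinearMap.pi_apply, Sum.elim_inl, smul_eq_mul]
        rw [mul_comm]
      · refine Finset.sum_congr rfl fun j _ => ?_
        simp only [w, F', ContinuousLinearMap.pi_apply, Sum.elim_inr, smul_eq_mul,
          innerSL_apply_apply]
        rw [mul_comm]
    have hsz := hsing.le_norm_conGrad v w
    rw [hcon, norm_zero] at hsz
    have hsz' : multSize I v w ≤ 0 := by
      by_contra! h; nlinarith
    refine LinearMap.ext fun q => ?_
    rw [LinearMap.pi_apply_eq_sum_univ, LinearMap.zero_apply]
    refine Finset.sum_eq_zero fun k _ => ?_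
    rcases k with i | j
    · have h3 : v i.1 = 0 := abs_nonpos_iff.1 ((abs_le_multSize v w i.2).trans hsz')
      simp only [v, i.2, dif_pos] at h3
      rw [h3, smul_zero]
    · have h3 : w j = 0 := abs_nonpos_iff.1 ((abs_le_multSize_right I v w j).trans hsz')
      simp only [w] at h3
      rw [h3, smul_zero]
  have hker : u ∈ F'.ker := by
    rw [LinearMap.mem_ker]
    funext k
    rcases k with i | j
    · exact hu.1 i.1 i.2
    · exact hu.2 j
  let γ : ℝ → Euc dy := fun ε => hF.implicitFunction F F' hrange (F y) (ε • ⟨u, hker⟩)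
  have h0 : γ 0 = y := by
    simp only [γ, zero_smul]
    exact hF.implicitFunction_apply_image hrange
  have hd : HasDerivAt γ u 0 := by
    have h1 : HasDerivAt (fun ε : ℝ => ε • (⟨u, hker⟩ : F'.ker)) ⟨u, hker⟩ 0 := by
      simpa using (hasDerivAt_id (0 : ℝ)).smul_const (⟨u, hker⟩ : F'.ker)
    have h2 := (hF.to_implicitFunction hrange).hasFDerivAt
    have h3 : HasFDerivAt (hF.implicitFunction F F' hrange (F y)) F'.ker.subtypeL
        ((fun ε : ℝ => ε • (⟨u, hker⟩ : F'.ker)) 0) := by simpa using h2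
    exact h3.comp_hasDerivAt 0 h1
  refine ⟨γ, h0, hd, ?_⟩
  have hcurve : ∀ᶠ ε in 𝓝 (0 : ℝ), F (γ ε) = F y := by
    have h1 : Tendsto (fun ε : ℝ => (F y, ε • (⟨u, hker⟩ : F'.ker))) (𝓝 0) (𝓝 (F y, 0)) := by
      have : Continuous fun ε : ℝ => (F y, ε • (⟨u, hker⟩ : F'.ker)) := by fun_prop
      simpa using this.tendsto 0
    exact h1.eventually (hF.map_implicitFunction_eq hrange)
  have hinact : ∀ᶠ ε in 𝓝 (0 : ℝ), ∀ i, i ∉ I → P.c i (γ ε) < 0 := by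
    rw [Filter.eventually_all]
    intro i
    by_cases hi : i ∈ I
    · exact Eventually.of_forall fun u h => absurd hi h
    have h1 : P.c i (γ 0) < 0 := by
      rw [h0]; exact lt_of_le_of_ne (hR.mem.1.1 i) fun h => hi ((hR.active i).2 h)
    have h2 : ContinuousAt (fun ε => P.c i (γ ε)) 0 :=
      (hP.c_contDiff i).continuous.continuousAt.comp hd.continuousAt
    filter_upwards [h2.eventually_lt_const h1] with u hu _ using hu
  filter_upwards [hcurve, hinact] with ε h1 h2
  have h3 : ∀ i ∈ I, P.c i (γ ε) = 0 := fun i hi =>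
    (congrFun h1 (Sum.inl ⟨i, hi⟩)).trans ((hR.active i).1 hi)
  refine ⟨⟨fun i => ?_, fun j => (congrFun h1 (Sum.inr j)).trans (hR.mem.1.2 j)⟩, h3⟩
  by_cases hi : i ∈ I
  · exact (h3 i hi).le
  · exact (h2 i hi).le

end Bilevel

/-! ### Coercivity off the kernel, bounded solvability and the derivative of `psi`. -/

namespace Bilevel

variable {dx dy m₁ m₂ : ℕ} {P : Bilevel dx dy m₁ m₂}
  {lf0 lf1 lg1 Cf ρ μ δ σ₀ s : ℝ} {x : Euc dx} {t : ℝ} {I : Finset (Fin m₁)} {y : Euc dy}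
  {lam : Fin m₁ → ℝ} {nu : Fin m₂ → ℝ}

/-- Second-order expansion of the objective along the active constraint manifold. -/
theorem RegularSol.h_isLittleO (hP : P.Smooth lf0 lf1 lg1 Cf)
    (hR : P.RegularSol x t I y lam nu) :
    ∃ R : Euc dy → ℝ, R =o[𝓝 y] (fun v => ‖v - y‖ ^ 2) ∧ ∀ v ∈ P.Y, (∀ i ∈ I, P.c i v = 0) →
      P.h t x v - P.h t x y = 1 / 2 * P.lagForm x t I y lam (v - y) (v - y) + R v := by
  have h1 := isLittleO_second_order_taylor (hP.h_contDiff t) (pairPt x y)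
  have h2 : Tendsto (fun v : Euc dy => pairPt x v) (𝓝 y) (𝓝 (pairPt x y)) := by
    have : Continuous fun v : Euc dy => pairPt x v := by simp only [pairPt_eq]; fun_prop
    exact this.tendsto y
  have h3 := h1.comp_tendsto h2
  have h4 : (fun v => ∑ i ∈ I, lam i * (P.c i v - P.c i y - fderiv ℝ (P.c i) y (v - y) -
      1 / 2 * hessForm (P.c i) y (v - y) (v - y))) =o[𝓝 y] fun v => ‖v - y‖ ^ 2 :=
    Asymptotics.IsLittleO.fun_sum fun i _ =>
      (isLittleO_second_order_taylor (hP.c_contDiff i) y).const_mul_left _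
  simp only [Function.comp_def, pairPt_sub_right, norm_inY, jointFun_pairPt] at h3
  refine ⟨_, h3.add h4, fun v hv hvI => ?_⟩
  have hk := congrArg (fun L => L (v - y)) (hR.kkt_fderiv hP)
  simp only [_root_.add_apply, ContinuousLinearMap.comp_apply, _root_.zero_apply,
    conGrad_apply] at hk
  have h5 : ∑ j, nu j * inner ℝ (P.a j) (v - y) = 0 := Finset.sum_eq_zero fun j _ => by
    rw [inner_sub_right, hv.2 j, hR.mem.1.2 j, sub_self, mul_zero]
  have h6 : ∑ i ∈ I, lam i * (P.c i v - P.c i y - fderiv ℝ (P.c i) y (v - y) -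
      1 / 2 * hessForm (P.c i) y (v - y) (v - y)) =
      -(∑ i ∈ I, lam i * fderiv ℝ (P.c i) y (v - y)) -
        1 / 2 * ∑ i ∈ I, lam i * hessForm (P.c i) y (v - y) (v - y) := by
    rw [Finset.mul_sum, ← Finset.sum_neg_distrib, ← Finset.sum_sub_distrib]
    refine Finset.sum_congr rfl fun i hi => ?_
    rw [hvI i hi, (hR.active i).1 hi]; ring
  rw [h6, lagForm_apply]
  linarith

/-- The Hessian of the Lagrangian is coercive on the critical directions orthogonal to its
kernel. -/
theorem RegularSol.coercive (hP : P.Smooth lf0 lf1 lg1 Cf) (hρ : 0 < ρ) (hμ : 0 < μ)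
    (hδ : 0 < δ) (hEB : P.ProxEB ρ μ δ σ₀) (hx : x ∈ P.X) (ht : t ∈ Icc 0 σ₀)
    (hR : P.RegularSol x t I y lam nu) (hs : 0 < s) (hsing : P.MinSingGE I s y) {u : Euc dy}
    (hu : u ∈ P.critSpace I y)
    (hu0 : ∀ z ∈ P.critSpace I y, (∀ w ∈ P.critSpace I y, P.lagForm x t I y lam z w = 0) →
      inner ℝ u z = 0) :
    μ * ‖u‖ ^ 2 ≤ P.lagForm x t I y lam u u := by
  -- Since `u` is orthogonal to the kernel, `inner u` is represented on the critical subspace by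
  -- `lagForm u₂`. Testing the linearization with `u₂` then shows that solutions do not move in the
  -- direction `u` to first order.
  obtain ⟨u₂, hu₂, hu₂eq, -⟩ := exists_solution_of_symm_form (P.lagForm x t I y lam)
    (lagForm_symm hP x t I y lam) (P.critSpace I y) (-(innerSL ℝ u)) (fun z hz h => by
      simp [hu0 z hz h])
  obtain ⟨v, w, hvw⟩ := exists_eq_conGrad (P := P) (I := I) (y := y)
    (P.lagForm x t I y lam u₂ - innerSL ℝ u) (fun z hz => by
      have := hu₂eq z hz
      simp only [_root_.neg_apply] at this
      simp only [_root_.sub_apply]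
      linarith)
  obtain ⟨γ, hγ0, hγd, hγ⟩ := hR.exists_curve hP hs hsing hu
  obtain ⟨R, hRo, hRe⟩ := hR.h_isLittleO hP
  have hl : (𝓝[>] (0 : ℝ)) ≤ 𝓝 0 := nhdsWithin_le_nhds
  have hγO : (fun ε : ℝ => γ ε - y) =O[𝓝[>] 0] fun ε => ε := by
    have := hγd.hasFDerivAt.isBigO_sub.mono hl
    simpa [hγ0] using this
  have hγo : (fun ε : ℝ => γ ε - y - ε • u) =o[𝓝[>] 0] fun ε => ε := by
    have := (hasDerivAt_iff_isLittleO.1 hγd).mono hl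
    simpa [hγ0] using this
  have hid : Tendsto (fun ε : ℝ => ε) (𝓝[>] 0) (𝓝 0) := hl
  have hγt : Tendsto γ (𝓝[>] 0) (𝓝 y) := tendsto_sub_nhds_zero_iff.1 (hγO.trans_tendsto hid)
  have hnear : ∀ᶠ ε in 𝓝[>] (0 : ℝ), ∃ y' ∈ P.T x t, ‖γ ε - y'‖ ≤ ‖γ ε - y‖ ∧
      μ / 2 * ‖γ ε - y'‖ ^ 2 ≤ P.h t x (γ ε) - P.h t x y := by
    have hsm : ∀ᶠ ε in 𝓝[>] (0 : ℝ), μ * ‖γ ε - y‖ < δ := by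
      have h1 : Tendsto (fun ε => μ * ‖γ ε - y‖) (𝓝[>] 0) (𝓝 0) := by
        simpa using ((hγO.trans_tendsto hid).norm).const_mul μ
      exact h1.eventually_lt_const hδ
    filter_upwards [hsm, hl hγ] with ε h1 h2
    obtain ⟨y', hy', hd⟩ := (argminSet_isCompact hP.isCompact_Y
      (hP.continuous_h t x).continuousOn).exists_infDist_eq_dist ⟨y, hR.mem⟩ (γ ε)
    rw [dist_eq_norm] at hd
    have h3 : ‖γ ε - y'‖ ≤ ‖γ ε - y‖ := by
      rw [← hd, ← dist_eq_norm]; exact Metric.infDist_le_dist_of_mem hR.mem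
    refine ⟨y', hy', h3, ?_⟩
    exact sq_growth_of_prox_error_bound hP.isCompact_Y hP.convex_Y
      (hP.continuous_h t x).continuousOn hρ hμ (hEB x hx t ht) h2.1 hR.mem (norm_nonneg _) hd.ge
      ((mul_le_mul_of_nonneg_left h3 hμ.le).trans h1.le)
  obtain ⟨y', hy'⟩ := hnear.choice
  have hyO : (fun ε => y' ε - y) =O[𝓝[>] 0] fun ε : ℝ => ε := by
    have h1 : (fun ε => γ ε - y' ε) =O[𝓝[>] 0] fun ε : ℝ => ε :=
      (Asymptotics.IsBigO.of_bound 1 (hy'.mono fun ε h => by simpa using h.2.1)).trans hγO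
    exact (hγO.sub h1).congr_left fun ε => by abel
  have hT := hy'.mono fun ε h => h.1
  have hx0 : (fun _ : ℝ => x - x) =O[𝓝[>] 0] fun ε : ℝ => ε := by
    simpa using Asymptotics.isBigO_zero _ _
  have ht0 : (fun _ : ℝ => t - t) =O[𝓝[>] 0] fun ε : ℝ => ε := by
    simpa using Asymptotics.isBigO_zero _ _
  have h1 : (fun ε => inner ℝ u (y' ε - y)) =o[𝓝[>] 0] fun ε : ℝ => ε := by
    refine ((hR.linearization hP hs hsing (x' := fun _ => x) (t' := fun _ => t) hid hx0 ht0 hyO hT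
      hu₂).sub (hR.conGrad_isLittleO hP hs hsing (x' := fun _ => x) (t' := fun _ => t) hid hx0 ht0
      hyO hT v w)).congr_left fun ε => ?_
    rw [← hvw, lagForm_symm hP x t I y lam (y' ε - y)]
    simp
  -- The curve moves by `ε u` while its nearest solution `y' ε` moves only by `o(ε)` along `u`, so
  -- the distance to the solution set is at least `ε ‖u‖ - o(ε)`.
  have h2 : Tendsto (fun ε : ℝ => inner ℝ u (γ ε - y' ε) / ε) (𝓝[>] 0) (𝓝 (‖u‖ ^ 2)) := by
    have h3 : (fun ε => inner ℝ u (γ ε - y - ε • u)) =o[𝓝[>] 0] fun ε : ℝ => ε :=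
      ((innerSL ℝ u).isBigO_comp _ _).trans_isLittleO hγo
    have h4 := ((h3.sub h1).tendsto_div_nhds_zero).const_add (‖u‖ ^ 2)
    rw [add_zero] at h4
    refine h4.congr' ?_
    filter_upwards [self_mem_nhdsWithin] with ε hε
    have hε' : ε ≠ 0 := (mem_Ioi.1 hε).ne'
    rw [eq_div_iff hε', add_mul, div_mul_cancel₀ _ hε']
    simp only [inner_sub_right, inner_smul_right, real_inner_self_eq_norm_sq]
    ring
  have h5 : Tendsto (fun ε : ℝ => ‖u‖ ^ 2 * ((P.h t x (γ ε) - P.h t x y) / ε ^ 2)) (𝓝[>] 0)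
      (𝓝 (‖u‖ ^ 2 * (1 / 2 * P.lagForm x t I y lam u u))) := by
    refine Tendsto.const_mul _ ?_
    have h6 : Tendsto (fun ε : ℝ => (1 / ε) • (γ ε - y)) (𝓝[>] 0) (𝓝 u) := by
      have := (hasDerivAt_iff_tendsto_slope.1 hγd).mono_left
        (nhdsWithin_mono 0 fun ε (hε : ε ∈ Ioi (0 : ℝ)) => (mem_Ioi.1 hε).ne')
      refine this.congr fun ε => ?_
      simp [slope, hγ0]
    have h7 : Tendsto (fun ε : ℝ => 1 / 2 * P.lagForm x t I y lam ((1 / ε) • (γ ε - y))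
        ((1 / ε) • (γ ε - y))) (𝓝[>] 0) (𝓝 (1 / 2 * P.lagForm x t I y lam u u)) := by
      have hc : Continuous fun v : Euc dy => 1 / 2 * P.lagForm x t I y lam v v := by fun_prop
      exact (hc.tendsto u).comp h6
    have h8 : (fun ε => R (γ ε)) =o[𝓝[>] 0] fun ε : ℝ => ε ^ 2 :=
      (hRo.comp_tendsto hγt).trans_isBigO (hγO.norm_left.pow 2)
    have h9 := h7.add h8.tendsto_div_nhds_zero
    rw [add_zero] at h9
    refine h9.congr' ?_
    filter_upwards [self_mem_nhdsWithin, hl hγ] with ε hε hγε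
    have hε' : ε ≠ 0 := (mem_Ioi.1 hε).ne'
    rw [hRe _ hγε.1 hγε.2]
    simp only [map_smul, _root_.smul_apply, smul_eq_mul]
    field_simp
  -- Quadratic growth along the curve, multiplied by `‖u‖²` and divided by `ε²`, with Cauchy–Schwarz
  -- for the distance.
  have h10 := le_of_tendsto_of_tendsto ((h2.pow 2).const_mul (μ / 2)) h5 (by
    filter_upwards [self_mem_nhdsWithin, hy'] with ε hε hyε
    have hε' : 0 < ε := hε
    rw [div_pow, mul_div_assoc', mul_div_assoc']
    refine div_le_div_of_nonneg_right ?_ (sq_nonneg ε)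
    have h11 : inner ℝ u (γ ε - y' ε) ^ 2 ≤ (‖u‖ * ‖γ ε - y' ε‖) ^ 2 := by
      rw [← sq_abs]
      exact pow_le_pow_left₀ (abs_nonneg _) (abs_real_inner_le_norm _ _) 2
    calc μ / 2 * inner ℝ u (γ ε - y' ε) ^ 2 ≤ μ / 2 * (‖u‖ * ‖γ ε - y' ε‖) ^ 2 := by gcongr
      _ = ‖u‖ ^ 2 * (μ / 2 * ‖γ ε - y' ε‖ ^ 2) := by ring
      _ ≤ _ := mul_le_mul_of_nonneg_left hyε.2.2 (sq_nonneg _))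
  rcases eq_or_ne u 0 with rfl | hne
  · simp
  · have hpos : 0 < ‖u‖ ^ 2 := by positivity
    have : ‖u‖ ^ 2 * (μ * ‖u‖ ^ 2) ≤ ‖u‖ ^ 2 * P.lagForm x t I y lam u u := by linarith
    exact le_of_mul_le_mul_left this hpos

/-- Solvability, with bounds, of the linearized stationarity system. -/
theorem RegularSol.exists_bounded_solution (hP : P.Smooth lf0 lf1 lg1 Cf) (hρ : 0 < ρ)
    (hμ : 0 < μ) (hδ : 0 < δ) (hEB : P.ProxEB ρ μ δ σ₀) (hx : x ∈ P.X) (ht : t ∈ Icc 0 σ₀)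
    (hR : P.RegularSol x t I y lam nu) (hs : 0 < s) (hsing : P.MinSingGE I s y)
    (b : Euc dy →L[ℝ] ℝ)
    (hb : ∀ z ∈ P.critSpace I y, (∀ w ∈ P.critSpace I y, P.lagForm x t I y lam z w = 0) →
      b z = 0) :
    ∃ u ∈ P.critSpace I y, ∃ v w, P.lagForm x t I y lam u + b = P.conGrad I y v w ∧
      μ * ‖u‖ ≤ ‖b‖ ∧ s * multSize I v w ≤ ‖P.lagForm x t I y lam u + b‖ := by
  obtain ⟨u, hu, hub, hu0⟩ := exists_solution_of_symm_form (P.lagForm x t I y lam)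
    (lagForm_symm hP x t I y lam) (P.critSpace I y) b hb
  obtain ⟨v, w, hvw⟩ := exists_eq_conGrad (P := P) (I := I) (y := y)
    (P.lagForm x t I y lam u + b) (fun z hz => hub z hz)
  refine ⟨u, hu, v, w, hvw, ?_, hvw ▸ hsing.le_norm_conGrad v w⟩
  have h1 := hR.coercive hP hρ hμ hδ hEB hx ht hs hsing hu hu0
  have h2 := hub u hu
  have h3 := (abs_le.1 (b.le_opNorm u)).1
  rcases (norm_nonneg u).eq_or_lt with h | h
  · rw [← h, mul_zero]; exact norm_nonneg _
  · have : ‖u‖ * (μ * ‖u‖) ≤ ‖u‖ * ‖b‖ := by nlinarith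
    exact le_of_mul_le_mul_left this h

/-- The derivative of the hyper-objective at a regular solution. -/
theorem hasFDerivWithinAt_psi (hP : P.Smooth lf0 lf1 lg1 Cf) (hρ : 0 < ρ)
    (hμ : 0 < μ) (hδ : 0 < δ) (hσ₀ : 0 < σ₀) (hEB : P.ProxEB ρ μ δ σ₀) (hx : x ∈ P.X)
    (hR : P.RegularSol x 0 I y lam nu) (hs : 0 < s) (hsing : P.MinSingGE I s y)
    {u : Euc dy} (hu : u ∈ P.critSpace I y) {v : Fin m₁ → ℝ} {w : Fin m₂ → ℝ}
    (huv : P.lagForm x 0 I y lam u +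
      (fderiv ℝ (jointFun P.f) (pairPt x y)).comp (inY dx dy) = P.conGrad I y v w) :
    HasFDerivWithinAt P.psi ((fderiv ℝ (jointFun P.f) (pairPt x y)).comp (inX dx dy) +
      (hessForm (jointFun (P.h 0)) (pairPt x y) (inY dx dy u)).comp (inX dx dy)) P.X x := by
  have ht : (0 : ℝ) ∈ Icc 0 σ₀ := ⟨le_rfl, hσ₀.le⟩
  obtain ⟨C, hC, H⟩ := eventually_exists_mem_T hP hρ hμ hδ hEB hx ht hR.mem
  have : (𝓝[P.X] x).NeBot := mem_closure_iff_nhdsWithin_neBot.1 (subset_closure hx)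
  obtain ⟨y', hy'⟩ := H.choice
  have hr : Tendsto (fun x' => ‖x' - x‖) (𝓝[P.X] x) (𝓝 0) := by
    have : Continuous fun x' : Euc dx => ‖x' - x‖ := by fun_prop
    simpa using (this.tendsto x).mono_left nhdsWithin_le_nhds
  have hxO : (fun x' : Euc dx => x' - x) =O[𝓝[P.X] x] fun x' => ‖x' - x‖ :=
    (Asymptotics.isBigO_refl _ _).norm_right
  have hyO : (fun x' => y' x' - y) =O[𝓝[P.X] x] fun x' => ‖x' - x‖ :=
    Asymptotics.IsBigO.of_bound C (hy'.mono fun k hk => by simpa using hk.2)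
  have ht0 : (fun _ : Euc dx => (0 : ℝ) - 0) =O[𝓝[P.X] x] fun x' => ‖x' - x‖ := by
    simpa using Asymptotics.isBigO_zero _ _
  have hT := hy'.mono fun k hk => hk.1
  have h1 := hR.linearization hP hs hsing (t' := fun _ => 0) hr hxO ht0 hyO hT hu
  have h2 := hR.conGrad_isLittleO hP hs hsing (t' := fun _ => 0) hr hxO ht0 hyO hT v w
  have h3 := ((hP.f_contDiff.differentiable (by norm_num) (pairPt x y)).hasFDerivAt.isLittleO
    |>.comp_tendsto (tendsto_pairPt hr hxO hyO)).trans_isBigO (pairPt_sub_isBigO hxO hyO)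
  rw [hasFDerivWithinAt_iff_isLittleO]
  -- The unknown displacement enters through `∇_y f`, which by `huv` is a constraint combination
  -- minus `lagForm u`. The former is negligible on it, and the linearization tested with `u`
  -- converts the latter into a mixed derivative in `x' - x`.
  refine (((h3.add h2).sub h1).congr' ?_ EventuallyEq.rfl).of_norm_right
  filter_upwards [hT, self_mem_nhdsWithin] with x' hx' hxX
  rw [psi_eq hP hρ hμ hδ hσ₀ hEB hx hR.mem, psi_eq hP hρ hμ hδ hσ₀ hEB hxX hx', ← huv]
  simp only [Function.comp, jointFun_pairPt, pairPt_sub, map_add, _root_.add_apply,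
    ContinuousLinearMap.comp_apply, sub_self, zero_mul, add_zero]
  rw [lagForm_symm hP x 0 I y lam u, hessForm_symm (hP.h_contDiff 0) _ (inY dx dy u)]
  ring

end Bilevel

/-! ### Quantitative expansion of the partial gradient in `x`. -/

/-- Both `p + B t²` and `-p + B t²` have local affine supports, so the support-line principle
applies to each. The neighbourhoods may shrink with `t` and `D` need not be continuous. -/
theorem abs_sub_sub_le_of_local_expansion {p D : ℝ → ℝ} {B σ : ℝ} (hσ : 0 < σ)
    (h : ∀ t ∈ Icc 0 σ, ∀ᶠ s in 𝓝[Icc 0 σ] t, |p s - p t - (s - t) * D t| ≤ B * (s - t) ^ 2) :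
    |p σ - p 0 - σ * D 0| ≤ B * σ ^ 2 := by
  have hp : ContinuousOn p (Icc 0 σ) := by
    intro t ht
    have h1 : Tendsto (fun s => (s - t) * D t) (𝓝[Icc 0 σ] t) (𝓝 0) := by
      have : Continuous fun s : ℝ => (s - t) * D t := by fun_prop
      simpa using (this.tendsto t).mono_left nhdsWithin_le_nhds
    have h2 : Tendsto (fun s => B * (s - t) ^ 2) (𝓝[Icc 0 σ] t) (𝓝 0) := by
      have : Continuous fun s : ℝ => B * (s - t) ^ 2 := by fun_prop
      simpa using (this.tendsto t).mono_left nhdsWithin_le_nhds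
    have h3 := squeeze_zero_norm' (f := fun s => p s - p t - (s - t) * D t) (h t ht) h2
    have h4 := (h3.add h1).add_const (p t)
    simp only [sub_add_cancel, add_zero, zero_add] at h4
    exact h4
  have hq : Continuous fun t : ℝ => B * t ^ 2 := by fun_prop
  have k1 := add_mul_le_of_forall_local_support (q := fun t => p t + B * t ^ 2)
    (a := fun t => D t + 2 * B * t) hσ (hp.add hq.continuousOn) (fun t ht => by
      filter_upwards [h t ⟨ht.1, ht.2.le⟩] with s hs
      have := (abs_le.1 hs).1
      linarith)
  have k2 := add_mul_le_of_forall_local_support (q := fun t => -p t + B * t ^ 2)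
    (a := fun t => -D t + 2 * B * t) hσ (hp.neg.add hq.continuousOn) (fun t ht => by
      filter_upwards [h t ⟨ht.1, ht.2.le⟩] with s hs
      have := (abs_le.1 hs).2
      linarith)
  rw [abs_le]
  constructor <;> linarith

theorem le_mul_of_eq_mul_of_one_le {a b c : ℝ} (ha : 0 ≤ a) (hc : 1 ≤ c) (hb : b = a * c) :
    a ≤ b := hb ▸ le_mul_of_one_le_right ha hc

/-- The constant in the Lipschitz estimate of the gradients. -/
theorem gradient_error_bound {k m N l S M A lh f τ e d ue ve Δ : ℝ} (hk : 1 ≤ k) (hm : 1 ≤ m)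
    (hN : 1 ≤ N) (hl : 1 ≤ l) (hS : 1 ≤ S) (hM : 1 ≤ M) (hf : 1 ≤ f) (hlh : 0 ≤ lh)
    (hA : A = f * M) (hτ : 0 ≤ τ) (he : 0 ≤ e) (hd0 : 0 ≤ d) (hd : d ≤ 2 * A * τ)
    (hue : ue ≤ k * l * M * e) (hve : ve ≤ S * (k * m * N * l * ue + k * l * e))
    (hΔ0 : 0 ≤ Δ) (hΔ : Δ ≤ 2 * S * (k * m * N * l * d + f * τ)) :
    2 * lh * d ^ 2 * e + τ * (k * l) * d * e + m * (ve * (k * l * d ^ 2)) +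
      ue * (2 * lh * d ^ 2 + m * N * (lh * d ^ 2) + m * (Δ * (k * l * d)) + τ * (k * l) * d) ≤
      24 * k ^ 3 * m ^ 2 * N *
        (l ^ 4 * f ^ 3 * (M ^ 3 * S ^ 3) + lh * l ^ 2 * f ^ 3 * (M ^ 3 * S ^ 2)) * e * τ ^ 2 := by
  have hA1 : 1 ≤ A := by rw [hA]; exact one_le_mul_of_one_le_of_one_le hf hM
  have hfA : f ≤ A := by rw [hA]; exact le_mul_of_one_le_right (by linarith) hM
  have hk0 : 0 ≤ k := by linarith
  have hm0 : 0 ≤ m := by linarith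
  have hN0 : 0 ≤ N := by linarith
  have hl0 : 0 ≤ l := by linarith
  have hS0 : 0 ≤ S := by linarith
  have hM0 : 0 ≤ M := by linarith
  have hA0 : 0 ≤ A := by linarith
  have hf0 : 0 ≤ f := by linarith
  have one : ∀ {a b : ℝ}, 1 ≤ a → 1 ≤ b → 1 ≤ a * b := fun ha hb =>
    one_le_mul_of_one_le_of_one_le ha hb
  have hve' : ve ≤ 2 * (S * k ^ 2 * m * N * l ^ 2 * M * e) := by
    have h1 : k * m * N * l * ue ≤ k * m * N * l * (k * l * M * e) := by gcongr
    have h2 : k * l * e ≤ k * m * N * l * (k * l * M * e) :=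
      le_mul_of_eq_mul_of_one_le (by positivity) (c := m * N * k * l * M)
        (one (one (one (one hm hN) hk) hl) hM) (by ring)
    calc ve ≤ S * (k * m * N * l * ue + k * l * e) := hve
      _ ≤ S * (k * m * N * l * (k * l * M * e) + k * m * N * l * (k * l * M * e)) := by gcongr
      _ = _ := by ring
  have hΔ' : Δ ≤ 6 * (S * k * m * N * l * A * τ) := by
    have h2 : f * τ ≤ k * m * N * l * (A * τ) := by
      calc f * τ ≤ A * τ := by gcongr
        _ ≤ _ := le_mul_of_eq_mul_of_one_le (by positivity) (c := k * m * N * l)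
          (one (one (one hk hm) hN) hl) (by ring)
    calc Δ ≤ 2 * S * (k * m * N * l * d + f * τ) := hΔ
      _ ≤ 2 * S * (k * m * N * l * (2 * A * τ) + k * m * N * l * (A * τ)) := by gcongr
      _ = _ := by ring
  have hd2 : d ^ 2 ≤ 4 * (A ^ 2 * τ ^ 2) := by
    calc d ^ 2 ≤ (2 * A * τ) ^ 2 := by gcongr
      _ = _ := by ring
  -- `G * U` and `G * V` are the dominating monomials without and with `lh`. All parameters other
  -- than `lh` in them are at least `1`, so each smaller monomial is padded up to one of them.
  set G := k ^ 3 * m ^ 2 * N with hG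
  set U := S * l ^ 3 * M * A ^ 2 with hU
  set V := lh * l * M * A ^ 2 with hV
  have t1 : 2 * lh * d ^ 2 * e ≤ 8 * (G * V * e * τ ^ 2) := by
    calc 2 * lh * d ^ 2 * e ≤ 2 * lh * (4 * (A ^ 2 * τ ^ 2)) * e := by gcongr
      _ = 8 * (lh * A ^ 2 * τ ^ 2 * e) := by ring
      _ ≤ _ := by
        refine mul_le_mul_of_nonneg_left ?_ (by norm_num)
        exact le_mul_of_eq_mul_of_one_le (by positivity) (c := G * (l * M))
          (one (one (one (one_le_pow₀ hk) (one_le_pow₀ hm)) hN) (one hl hM))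
          (by simp only [hG, hV]; ring)
  have t2 : τ * (k * l) * d * e ≤ 2 * (G * U * e * τ ^ 2) := by
    calc τ * (k * l) * d * e ≤ τ * (k * l) * (2 * A * τ) * e := by gcongr
      _ = 2 * (k * l * A * τ ^ 2 * e) := by ring
      _ ≤ _ := by
        refine mul_le_mul_of_nonneg_left ?_ (by norm_num)
        exact le_mul_of_eq_mul_of_one_le (by positivity)
          (c := k ^ 2 * m ^ 2 * N * (S * l ^ 2 * M * A))
          (one (one (one (one_le_pow₀ hk) (one_le_pow₀ hm)) hN)
            (one (one (one hS (one_le_pow₀ hl)) hM) hA1)) (by simp only [hG, hU]; ring)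
  have t3 : m * (ve * (k * l * d ^ 2)) ≤ 8 * (G * U * e * τ ^ 2) := by
    calc m * (ve * (k * l * d ^ 2)) ≤
        m * (2 * (S * k ^ 2 * m * N * l ^ 2 * M * e) * (k * l * (4 * (A ^ 2 * τ ^ 2)))) := by
          gcongr
      _ = _ := by rw [hG, hU]; ring
  have t4 : ue * (2 * lh * d ^ 2) ≤ 8 * (G * V * e * τ ^ 2) := by
    calc ue * (2 * lh * d ^ 2) ≤ k * l * M * e * (2 * lh * (4 * (A ^ 2 * τ ^ 2))) := by gcongr
      _ = 8 * (k * l * M * e * lh * A ^ 2 * τ ^ 2) := by ring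
      _ ≤ _ := by
        refine mul_le_mul_of_nonneg_left ?_ (by norm_num)
        exact le_mul_of_eq_mul_of_one_le (by positivity) (c := k ^ 2 * m ^ 2 * N)
          (one (one (one_le_pow₀ hk) (one_le_pow₀ hm)) hN) (by simp only [hG, hV]; ring)
  have t5 : ue * (m * N * (lh * d ^ 2)) ≤ 4 * (G * V * e * τ ^ 2) := by
    calc ue * (m * N * (lh * d ^ 2)) ≤
        k * l * M * e * (m * N * (lh * (4 * (A ^ 2 * τ ^ 2)))) := by gcongr
      _ = 4 * (k * l * M * e * m * N * lh * A ^ 2 * τ ^ 2) := by ring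
      _ ≤ _ := by
        refine mul_le_mul_of_nonneg_left ?_ (by norm_num)
        exact le_mul_of_eq_mul_of_one_le (by positivity) (c := k ^ 2 * m)
          (one (one_le_pow₀ hk) hm) (by simp only [hG, hV]; ring)
  have t6 : ue * (m * (Δ * (k * l * d))) ≤ 12 * (G * U * e * τ ^ 2) := by
    calc ue * (m * (Δ * (k * l * d))) ≤
        k * l * M * e * (m * (6 * (S * k * m * N * l * A * τ) * (k * l * (2 * A * τ)))) := by
          gcongr
      _ = _ := by rw [hG, hU]; ring
  have t7 : ue * (τ * (k * l) * d) ≤ 2 * (G * U * e * τ ^ 2) := by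
    calc ue * (τ * (k * l) * d) ≤ k * l * M * e * (τ * (k * l) * (2 * A * τ)) := by gcongr
      _ = 2 * (k ^ 2 * l ^ 2 * M * A * e * τ ^ 2) := by ring
      _ ≤ _ := by
        refine mul_le_mul_of_nonneg_left ?_ (by norm_num)
        exact le_mul_of_eq_mul_of_one_le (by positivity) (c := k * m ^ 2 * N * (S * l * A))
          (one (one (one hk (one_le_pow₀ hm)) hN) (one (one hS hl) hA1))
          (by simp only [hG, hU]; ring)
  have hUQ : U ≤ l ^ 4 * f ^ 3 * (M ^ 3 * S ^ 3) :=
    le_mul_of_eq_mul_of_one_le (by positivity) (c := l * f * S ^ 2)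
      (one (one hl hf) (one_le_pow₀ hS)) (by rw [hU, hA]; ring)
  have hVQ : V ≤ lh * l ^ 2 * f ^ 3 * (M ^ 3 * S ^ 2) :=
    le_mul_of_eq_mul_of_one_le (by positivity) (c := l * f * S ^ 2)
      (one (one hl hf) (one_le_pow₀ hS)) (by rw [hV, hA]; ring)
  have hV0 : 0 ≤ V := by positivity
  have hG0 : 0 ≤ G := by positivity
  have hGV : 0 ≤ G * V * e * τ ^ 2 := by positivity
  -- The `U`-terms add up to `2 + 8 + 12 + 2 = 24` and the `V`-terms to `8 + 8 + 4 = 20`.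
  calc _ ≤ 24 * (G * U * e * τ ^ 2) + 24 * (G * V * e * τ ^ 2) := by linarith
    _ = 24 * G * (U + V) * e * τ ^ 2 := by ring
    _ ≤ 24 * G * (l ^ 4 * f ^ 3 * (M ^ 3 * S ^ 3) + lh * l ^ 2 * f ^ 3 * (M ^ 3 * S ^ 2)) * e *
        τ ^ 2 := by gcongr
    _ = _ := by rw [hG]; ring

theorem abs_sum_le_mul_of_forall {m : ℕ} (I : Finset (Fin m)) (φ : Fin m → ℝ) {B : ℝ} (hB : 0 ≤ B)
    (h : ∀ i ∈ I, |φ i| ≤ B) : |∑ i ∈ I, φ i| ≤ m * B := by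
  refine (Finset.abs_sum_le_sum_abs _ _).trans ((Finset.sum_le_card_nsmul _ _ _ h).trans ?_)
  rw [nsmul_eq_mul]
  refine mul_le_mul_of_nonneg_right ?_ hB
  exact_mod_cast (Finset.card_le_univ I).trans_eq (Fintype.card_fin m)

namespace Bilevel

variable {dx dy m₁ m₂ : ℕ} {P : Bilevel dx dy m₁ m₂}
  {lf0 lf1 lg1 Cf ρ μ δ σ₀ s : ℝ} {x : Euc dx} {t : ℝ} {I : Finset (Fin m₁)} {y : Euc dy}
  {lam : Fin m₁ → ℝ} {nu : Fin m₂ → ℝ}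

/-- Remainder formula for the partial gradient in `x` along perturbed solutions: the change of
the solution is eliminated with the dual solution `ue`. -/
theorem fderiv_inX_expansion (hP : P.Smooth lf0 lf1 lg1 Cf) {t' : ℝ} {y' u ue : Euc dy}
    {e : Euc dx} {v ve D : Fin m₁ → ℝ} {w we D' : Fin m₂ → ℝ} (hy : y ∈ P.Y) (hy' : y' ∈ P.Y)
    (hu : u ∈ P.critSpace I y) (hue : ue ∈ P.critSpace I y)
    (huv : P.lagForm x t I y lam u +
      (fderiv ℝ (jointFun P.f) (pairPt x y)).comp (inY dx dy) = P.conGrad I y v w)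
    (huve : P.lagForm x t I y lam ue + (hessForm (jointFun (P.h t)) (pairPt x y)
      (inX dx dy e)).comp (inY dx dy) = P.conGrad I y ve we)
    (hstar : (fderiv ℝ (jointFun (P.h t')) (pairPt x y') -
            fderiv ℝ (jointFun (P.h t)) (pairPt x y)).comp (inY dx dy) +
          (∑ i ∈ I, lam i • (fderiv ℝ (P.c i) y' - fderiv ℝ (P.c i) y)) +
          P.conGrad I y' D D' = 0) :
    fderiv ℝ (jointFun (P.h t')) (pairPt x y') (inX dx dy e) -
      fderiv ℝ (jointFun (P.h t)) (pairPt x y) (inX dx dy e) -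
      (t' - t) * (fderiv ℝ (jointFun P.f) (pairPt x y) (inX dx dy e) +
        hessForm (jointFun (P.h t)) (pairPt x y) (inY dx dy u) (inX dx dy e)) =
    (fderiv ℝ (jointFun (P.h t)) (pairPt x y') - fderiv ℝ (jointFun (P.h t)) (pairPt x y) -
      hessForm (jointFun (P.h t)) (pairPt x y) (inY dx dy (y' - y)))
        (inX dx dy e + inY dx dy ue) +
    (t' - t) * (fderiv ℝ (jointFun P.f) (pairPt x y') - fderiv ℝ (jointFun P.f) (pairPt x y))
      (inX dx dy e + inY dx dy ue) +
    (∑ i ∈ I, ve i * fderiv ℝ (P.c i) y (y' - y)) +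
    (∑ i ∈ I, lam i * (fderiv ℝ (P.c i) y' - fderiv ℝ (P.c i) y -
      hessForm (P.c i) y (y' - y)) ue) +
    ∑ i ∈ I, D i * (fderiv ℝ (P.c i) y' - fderiv ℝ (P.c i) y) ue := by
  have e1 := congrArg (fun L => L ue) hstar
  have e2 := lagForm_apply (P := P) x t I y lam (y' - y) ue
  have e3 := congrArg (fun L => L (y' - y)) huve
  have e4 := congrArg (fun L => L ue) huv
  have e5 := congrArg (fun L => L u) huve
  have c1 : P.conGrad I y ve we (y' - y) = ∑ i ∈ I, ve i * fderiv ℝ (P.c i) y (y' - y) := by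
    rw [conGrad_apply]
    have : ∑ j, we j * inner ℝ (P.a j) (y' - y) = 0 := Finset.sum_eq_zero fun j _ => by
      rw [inner_sub_right, hy'.2 j, hy.2 j, sub_self, mul_zero]
    rw [this, add_zero]
  have c2 : ∀ z ∈ P.critSpace I y, ∀ v w, P.conGrad I y v w z = 0 := fun z hz v w => by
    rw [conGrad_apply_of_mem_critSpace hz]; simp
  have s1 : ∑ i ∈ I, lam i * (fderiv ℝ (P.c i) y' - fderiv ℝ (P.c i) y -
      hessForm (P.c i) y (y' - y)) ue =
      ∑ i ∈ I, lam i * (fderiv ℝ (P.c i) y' - fderiv ℝ (P.c i) y) ue -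
        ∑ i ∈ I, lam i * hessForm (P.c i) y (y' - y) ue := by
    rw [← Finset.sum_sub_distrib]
    refine Finset.sum_congr rfl fun i _ => ?_
    rw [_root_.sub_apply _ (hessForm (P.c i) y (y' - y)), mul_sub]
  have hst := hessForm_symm (hP.h_contDiff t) (pairPt x y)
  -- Adjoint identity: test the equation of `u` with `ue` and that of `ue` with `u`, and use
  -- symmetry of `lagForm`.
  have s2 : fderiv ℝ (jointFun P.f) (pairPt x y) (inY dx dy ue) =
      hessForm (jointFun (P.h t)) (pairPt x y) (inY dx dy u) (inX dx dy e) := by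
    simp only [_root_.add_apply, ContinuousLinearMap.comp_apply, c2 _ hue, c2 _ hu] at e4 e5
    rw [lagForm_symm hP x t I y lam ue u] at e5
    rw [hst (inY dx dy u)]
    linarith
  rw [s1]
  simp only [_root_.add_apply, ContinuousLinearMap.comp_apply, _root_.sum_apply,
    _root_.smul_apply, smul_eq_mul, _root_.zero_apply, conGrad_apply_of_mem_critSpace hue] at e1
  simp only [_root_.add_apply, ContinuousLinearMap.comp_apply, c1] at e3
  rw [lagForm_symm hP x t I y lam ue, e2, hst (inX dx dy e)] at e3
  simp only [hP.fderiv_h, _root_.add_apply, _root_.sub_apply, _root_.smul_apply, smul_eq_mul,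
    map_add] at e1 e3 ⊢
  rw [← s2]
  linarith

/-- Quantitative first-order expansion of the partial gradient in `x` along solutions. -/
theorem RegularSol.local_expansion {κ Λ lh2 : ℝ} (hP : P.Smooth lf0 lf1 lg1 Cf) (hρ : 0 < ρ)
    (hμ : 0 < μ) (hδ : 0 < δ) (hEB : P.ProxEB ρ μ δ σ₀) (hx : x ∈ P.X) (ht : t ∈ Icc 0 σ₀)
    (hR : P.RegularSol x t I y lam nu) (hs : 0 < s) (hsing : P.MinSingGE I s y)
    (hlf0 : 1 ≤ lf0) (hlg1 : 1 ≤ lg1) (hlh2 : 0 ≤ lh2) (hμ1 : μ ≤ 1) (hs1 : s ≤ 1) (ht1 : t ≤ 1)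
    (hκ : lf1 ≤ κ * lg1) (hc : ∀ i, ∀ y ∈ P.Y, ‖hessForm (P.c i) y‖ ≤ κ * lg1)
    (hlam : ∀ i ∈ I, lam i ≤ Λ)
    (hfl : LipAtPoint (hessForm (jointFun P.f)) (jointSet P.X P.Y) lh2 (pairPt x y))
    (hgl : LipAtPoint (hessForm (jointFun P.g)) (jointSet P.X P.Y) lh2 (pairPt x y))
    (hcl : ∀ i, LipAtPoint (hessForm (P.c i)) P.Y lh2 y)
    {u : Euc dy} (hu : u ∈ P.critSpace I y) {v : Fin m₁ → ℝ} {w : Fin m₂ → ℝ}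
    (huv : P.lagForm x t I y lam u +
      (fderiv ℝ (jointFun P.f) (pairPt x y)).comp (inY dx dy) = P.conGrad I y v w)
    {e : Euc dx} (he : e ∈ vectorSpan ℝ P.X) :
    ∀ᶠ t' in 𝓝[Icc 0 σ₀] t, ∀ y₁ ∈ P.T x t',
      |fderiv ℝ (jointFun (P.h t')) (pairPt x y₁) (inX dx dy e) -
        fderiv ℝ (jointFun (P.h t)) (pairPt x y) (inX dx dy e) -
        (t' - t) * (fderiv ℝ (jointFun P.f) (pairPt x y) (inX dx dy e) +
          hessForm (jointFun (P.h t)) (pairPt x y) (inY dx dy u) (inX dx dy e))| ≤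
      24 * (1 + κ) ^ 3 * (1 + m₁) ^ 2 * (1 + |Λ|) *
        (lg1 ^ 4 * lf0 ^ 3 * (μ⁻¹ ^ 3 * s⁻¹ ^ 3) + lh2 * lg1 ^ 2 * lf0 ^ 3 * (μ⁻¹ ^ 3 * s⁻¹ ^ 2)) *
          ‖e‖ * |t' - t| ^ 2 := by
  have hlf1 := hP.lf1_nonneg hx
  have hκ0 : 0 ≤ κ := by
    by_contra! h; nlinarith
  have hl0 : 0 ≤ lg1 := by linarith
  have hy := hR.mem.1
  have hJ := convex_jointSet hP.X_convex hP.convex_Y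
  have hzJ : pairPt x y ∈ jointSet P.X P.Y := ⟨hx, hy⟩
  have hL : t * lf1 + lg1 ≤ (1 + κ) * lg1 := by
    have : t * lf1 ≤ 1 * lf1 := mul_le_mul_of_nonneg_right ht1 hlf1
    linarith
  have hHn : ‖hessForm (jointFun (P.h t)) (pairPt x y)‖ ≤ (1 + κ) * lg1 :=
    (hP.norm_hessForm_h_le ht.1 hzJ).trans hL
  have hkl : κ * lg1 ≤ (1 + κ) * lg1 := by linarith
  have hm0 : (0 : ℝ) ≤ m₁ := Nat.cast_nonneg _
  have hlamN : ∀ i ∈ I, |lam i| ≤ 1 + |Λ| := fun i hi => by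
    rw [abs_of_pos (hR.strict i hi)]
    linarith [hlam i hi, le_abs_self Λ]
  have hN1 : 1 ≤ 1 + |Λ| := by linarith [abs_nonneg Λ]
  -- The dual solution for the direction `e`, used to eliminate the displacement of the lower-level
  -- solution.
  obtain ⟨ue, hue, ve, we, huve, huen, hven⟩ := hR.exists_bounded_solution hP hρ hμ hδ hEB hx ht hs
    hsing ((hessForm (jointFun (P.h t)) (pairPt x y) (inX dx dy e)).comp (inY dx dy))
    (fun z hz hz0 => hR.hessForm_mixed_kernel hP hρ hμ hδ hEB hx ht hs hsing hz hz0 he)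
  have hbe : ∀ q, |hessForm (jointFun (P.h t)) (pairPt x y) (inX dx dy e) (inY dx dy q)| ≤
      (1 + κ) * lg1 * ‖e‖ * ‖q‖ := fun q => by
    have := (hessForm (jointFun (P.h t)) (pairPt x y)).le_opNorm₂ (inX dx dy e) (inY dx dy q)
    rw [norm_inX, norm_inY] at this
    exact this.trans (by gcongr)
  have hsum : (1 + κ) * lg1 + m₁ * ((1 + |Λ|) * (κ * lg1)) ≤
      (1 + κ) * (1 + m₁) * (1 + |Λ|) * lg1 := by
    have h1 : (1 + κ) * lg1 ≤ (1 + κ) * lg1 * (1 + |Λ|) :=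
      le_mul_of_one_le_right (by positivity) hN1
    have h2 : m₁ * ((1 + |Λ|) * (κ * lg1)) ≤ m₁ * ((1 + |Λ|) * ((1 + κ) * lg1)) := by gcongr
    linarith
  have hue' : ‖ue‖ ≤ (1 + κ) * lg1 * μ⁻¹ * ‖e‖ := by
    have h1 : μ * ‖ue‖ ≤ (1 + κ) * lg1 * ‖e‖ := huen.trans
      (ContinuousLinearMap.opNorm_le_bound _ (by positivity) hbe)
    have h2 := mul_le_mul_of_nonneg_left h1 (inv_nonneg.2 hμ.le)
    rw [inv_mul_cancel_left₀ hμ.ne'] at h2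
    linarith
  have hve' : multSize I ve we ≤ s⁻¹ * ((1 + κ) * (1 + m₁) * (1 + |Λ|) * lg1 * ‖ue‖ +
      (1 + κ) * lg1 * ‖e‖) := by
    rw [← div_eq_inv_mul, le_div_iff₀ hs, mul_comm]
    refine hven.trans (ContinuousLinearMap.opNorm_le_bound _ (by positivity) fun q => ?_)
    rw [_root_.add_apply, lagForm_apply, add_mul]
    refine (norm_add_le _ _).trans (add_le_add ?_ (hbe q))
    refine (norm_add_le _ _).trans ?_
    have h1 : ‖hessForm (jointFun (P.h t)) (pairPt x y) (inY dx dy ue) (inY dx dy q)‖ ≤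
        (1 + κ) * lg1 * ‖ue‖ * ‖q‖ := by
      have := (hessForm (jointFun (P.h t)) (pairPt x y)).le_opNorm₂ (inY dx dy ue) (inY dx dy q)
      rw [norm_inY, norm_inY] at this
      exact this.trans (by gcongr)
    have h2 : ‖∑ i ∈ I, lam i * hessForm (P.c i) y ue q‖ ≤
        m₁ * ((1 + |Λ|) * (κ * lg1 * ‖ue‖ * ‖q‖)) := by
      refine abs_sum_le_mul_of_forall I _ (by positivity) fun i hi => ?_
      rw [abs_mul]
      exact mul_le_mul (hlamN i hi) (((hessForm (P.c i) y).le_opNorm₂ ue q).trans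
        (by have := hc i y hy; gcongr)) (abs_nonneg _) (by positivity)
    have h3 := mul_le_mul_of_nonneg_right hsum (show 0 ≤ ‖ue‖ * ‖q‖ by positivity)
    linarith
  -- a nearby selection of solutions
  obtain ⟨r, hr, hnear⟩ := exists_near_mem_T hP hρ hμ hδ hEB
  have : (𝓝[Icc 0 σ₀] t).NeBot := mem_closure_iff_nhdsWithin_neBot.1 (subset_closure ht)
  have hex : ∀ᶠ t' in 𝓝[Icc 0 σ₀] t, ∃ y' ∈ P.T x t', ‖y' - y‖ ≤ 2 * (lf0 * μ⁻¹) * |t' - t| := by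
    have hsm : ∀ᶠ t' in 𝓝[Icc 0 σ₀] t, lf0 * |t' - t| < r := by
      have : Continuous (fun t' : ℝ => lf0 * |t' - t|) := by fun_prop
      exact ((this.tendsto t).mono_left nhdsWithin_le_nhds).eventually_lt_const (by simpa)
    filter_upwards [hsm, self_mem_nhdsWithin] with t' h1 h2
    obtain ⟨y', hy', hd, -⟩ := hnear x hx x hx t ht t' h2 (by simpa using h1) y hR.mem
    refine ⟨y', hy', ?_⟩
    rw [norm_sub_rev]
    simp only [sub_self, norm_zero, mul_zero, add_zero, div_eq_mul_inv] at hd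
    linarith
  obtain ⟨y', hy'⟩ := hex.choice
  have h0 : Tendsto (fun t' => t' - t) (𝓝[Icc 0 σ₀] t) (𝓝 0) :=
    tendsto_sub_nhds_zero_iff.2 (tendsto_id.mono_left nhdsWithin_le_nhds)
  have hx0 : (fun _ : ℝ => x - x) =O[𝓝[Icc 0 σ₀] t] fun t' => t' - t := by
    simpa using Asymptotics.isBigO_zero _ _
  have hyO : (fun t' => y' t' - y) =O[𝓝[Icc 0 σ₀] t] fun t' => t' - t :=
    Asymptotics.IsBigO.of_bound _ (hy'.mono fun t' h => h.2)
  have hall := tendsto_of_isBigO (x' := fun _ => x) (t' := fun t' => t') h0 hx0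
    (Asymptotics.isBigO_refl _ _) hyO
  have hzt : Tendsto (fun t' => pairPt x (y' t')) (𝓝[Icc 0 σ₀] t)
      (𝓝[jointSet P.X P.Y] (pairPt x y)) :=
    tendsto_nhdsWithin_iff.2 ⟨tendsto_pairPt (x' := fun _ => x) h0 hx0 hyO,
      hy'.mono fun t' h => ⟨hx, h.1.1⟩⟩
  have hyt : Tendsto y' (𝓝[Icc 0 σ₀] t) (𝓝[P.Y] y) :=
    tendsto_nhdsWithin_iff.2 ⟨tendsto_sub_nhds_zero_iff.1 (hyO.trans_tendsto h0),
      hy'.mono fun t' h => h.1.1⟩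
  have hT1 := hzt.eventually (LipAtPoint.norm_fderiv_sub_sub_le (hP.h_contDiff t) hJ
    (by have := ht.1; positivity) hzJ
    (LipAtPoint.hessForm_const_mul_add hP.f_contDiff hP.g_contDiff ht.1 hfl hgl))
  have hT2 : ∀ᶠ t' in 𝓝[Icc 0 σ₀] t, ∀ i, ‖fderiv ℝ (P.c i) (y' t') - fderiv ℝ (P.c i) y -
      hessForm (P.c i) y (y' t' - y)‖ ≤ lh2 * ‖y' t' - y‖ ^ 2 :=
    Filter.eventually_all.2 fun i => hyt.eventually
      (LipAtPoint.norm_fderiv_sub_sub_le (hP.c_contDiff i) hP.convex_Y hlh2 hy (hcl i))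
  filter_upwards [hy', hT1, hT2, hall.eventually
    (hR.eventually_active_and_multipliers hP hs hsing), self_mem_nhdsWithin]
    with t' hyt' hR1 hRc hmult htI y₁ hy₁
  obtain ⟨hact, D, D', hstar, hsize⟩ := hmult hyt'.1
  -- The arbitrary solution `y₁` is exchanged for the nearby `y' t'`, for which the Lipschitz bound
  -- holds.
  rw [fderiv_inX_eq_of_mem_T hP hρ hμ hδ hEB hx htI hy₁ hyt'.1 he,
    fderiv_inX_expansion hP hy hyt'.1.1 hu hue huv huve hstar]
  rw [pairPt_sub_right, norm_inY] at hR1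
  set d := y' t' - y with hd
  have hyY := hyt'.1.1
  have hK : (t * lh2 + lh2) * ‖d‖ ^ 2 ≤ 2 * lh2 * ‖d‖ ^ 2 := by
    have : t * lh2 ≤ 1 * lh2 := mul_le_mul_of_nonneg_right ht1 hlh2
    gcongr; linarith
  have hDF : ‖fderiv ℝ (jointFun P.f) (pairPt x (y' t')) -
      fderiv ℝ (jointFun P.f) (pairPt x y)‖ ≤ (1 + κ) * lg1 * ‖d‖ := by
    have := norm_fderiv_sub_le_of_hessForm hP.f_contDiff hJ
      (fun z hz => hP.f_hess _ hz.1 _ hz.2) hzJ (q := pairPt x (y' t')) ⟨hx, hyY⟩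
    rw [pairPt_sub_right, norm_inY] at this
    exact this.trans (mul_le_mul_of_nonneg_right (hκ.trans hkl) (norm_nonneg _))
  have hDH : ‖fderiv ℝ (jointFun (P.h t)) (pairPt x (y' t')) -
      fderiv ℝ (jointFun (P.h t)) (pairPt x y)‖ ≤ (1 + κ) * lg1 * ‖d‖ := by
    have := norm_fderiv_sub_le_of_hessForm (hP.h_contDiff t) hJ
      (fun z hz => hP.norm_hessForm_h_le ht.1 hz) hzJ (q := pairPt x (y' t')) ⟨hx, hyY⟩
    rw [pairPt_sub_right, norm_inY] at this
    exact this.trans (mul_le_mul_of_nonneg_right hL (norm_nonneg _))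
  have hDc : ∀ i, ‖fderiv ℝ (P.c i) (y' t') - fderiv ℝ (P.c i) y‖ ≤ κ * lg1 * ‖d‖ := fun i =>
    norm_fderiv_sub_le_of_hessForm (hP.c_contDiff i) hP.convex_Y (hc i) hy hyY
  -- Quadratic in `d`, because the active constraints vanish at both points.
  have hDcd : ∀ i ∈ I, |fderiv ℝ (P.c i) y d| ≤ (1 + κ) * lg1 * ‖d‖ ^ 2 := by
    intro i hi
    have := (hP.convex_Y.inter (convex_closedBall y ‖d‖)).norm_image_sub_le_of_norm_hasFDerivWithin_le'
      (f := P.c i) (f' := fun z => fderiv ℝ (P.c i) z) (φ := fderiv ℝ (P.c i) y)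
      (C := κ * lg1 * ‖d‖) (x := y) (y := y' t')
      (fun z _ => ((hP.c_contDiff i).differentiable (by norm_num) z).hasFDerivAt.hasFDerivWithinAt)
      (fun z hz => by
        have hzb := hz.2
        rw [Metric.mem_closedBall, dist_eq_norm] at hzb
        refine (norm_fderiv_sub_le_of_hessForm (hP.c_contDiff i) hP.convex_Y (hc i) hy hz.1).trans
          ?_
        gcongr)
      ⟨hy, Metric.mem_closedBall_self (norm_nonneg _)⟩ ⟨hyY, by simp [dist_eq_norm, hd]⟩
    rw [hact i hi, (hR.active i).1 hi, sub_self, zero_sub, norm_neg, ← hd, mul_assoc, ← sq] at this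
    exact this.trans (mul_le_mul_of_nonneg_right hkl (sq_nonneg _))
  have hΔ : multSize I D D' ≤ 2 * s⁻¹ * ((1 + κ) * (1 + m₁) * (1 + |Λ|) * lg1 * ‖d‖ +
      lf0 * |t' - t|) := by
    have h1 : ‖(fderiv ℝ (jointFun (P.h t')) (pairPt x (y' t')) -
        fderiv ℝ (jointFun (P.h t)) (pairPt x y)).comp (inY dx dy)‖ ≤
        (1 + κ) * lg1 * ‖d‖ + lf0 * |t' - t| := by
      refine ContinuousLinearMap.opNorm_le_bound _ (by positivity) fun q => ?_
      have h2 : (fderiv ℝ (jointFun (P.h t')) (pairPt x (y' t')) -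
        fderiv ℝ (jointFun (P.h t)) (pairPt x y)).comp (inY dx dy) q =
        (fderiv ℝ (jointFun (P.h t)) (pairPt x (y' t')) -
        fderiv ℝ (jointFun (P.h t)) (pairPt x y)) (inY dx dy q) +
        (t' - t) * fderiv ℝ (jointFun P.f) (pairPt x (y' t')) (inY dx dy q) := by
        simp only [hP.fderiv_h, ContinuousLinearMap.comp_apply, _root_.add_apply,
          _root_.sub_apply, _root_.smul_apply, smul_eq_mul]
        ring
      rw [h2, add_mul]
      refine (norm_add_le _ _).trans (add_le_add ?_ ?_)
      · refine (ContinuousLinearMap.le_of_opNorm_le _ hDH _).trans ?_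
        rw [norm_inY]
      · rw [norm_mul, Real.norm_eq_abs, Real.norm_eq_abs, mul_comm lf0, mul_assoc]
        exact mul_le_mul_of_nonneg_left (hP.abs_fderiv_f_inY_le hx hyY q) (abs_nonneg _)
    have h3 : ∑ i ∈ I, lam i * ‖fderiv ℝ (P.c i) (y' t') - fderiv ℝ (P.c i) y‖ ≤
        m₁ * ((1 + |Λ|) * (κ * lg1 * ‖d‖)) := by
      refine (le_abs_self _).trans (abs_sum_le_mul_of_forall I _ (by positivity) fun i hi => ?_)
      rw [abs_mul, abs_norm]
      exact mul_le_mul (hlamN i hi) (hDc i) (norm_nonneg _) (by positivity)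
    have h4 := mul_le_mul_of_nonneg_right hsum (norm_nonneg d)
    have h5 : s / 2 * multSize I D D' ≤ (1 + κ) * (1 + m₁) * (1 + |Λ|) * lg1 * ‖d‖ +
      lf0 * |t' - t| := by linarith
    have h6 := mul_le_mul_of_nonneg_left h5 (show 0 ≤ 2 * s⁻¹ by positivity)
    have h7 : 2 * s⁻¹ * (s / 2 * multSize I D D') = multSize I D D' := by field_simp
    linarith
  have heu : ‖inX dx dy e + inY dx dy ue‖ ≤ ‖e‖ + ‖ue‖ := by
    refine (norm_add_le _ _).trans ?_
    rw [norm_inX, norm_inY]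
  have b1 := (ContinuousLinearMap.le_of_opNorm_le_of_le _ (hR1.trans hK) heu)
  have b2 := mul_le_mul_of_nonneg_left (ContinuousLinearMap.le_of_opNorm_le_of_le _ hDF heu)
    (abs_nonneg (t' - t))
  rw [Real.norm_eq_abs, ← abs_mul] at b2
  have b3 : |∑ i ∈ I, ve i * fderiv ℝ (P.c i) y d| ≤
      m₁ * (multSize I ve we * ((1 + κ) * lg1 * ‖d‖ ^ 2)) := by
    refine abs_sum_le_mul_of_forall I _ (by have := multSize_nonneg I ve we; positivity)
      fun i hi => ?_
    rw [abs_mul]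
    exact mul_le_mul (abs_le_multSize ve we hi) (hDcd i hi) (abs_nonneg _) (multSize_nonneg _ _ _)
  have b4 : |∑ i ∈ I, lam i * (fderiv ℝ (P.c i) (y' t') - fderiv ℝ (P.c i) y -
      hessForm (P.c i) y d) ue| ≤ m₁ * ((1 + |Λ|) * (lh2 * ‖d‖ ^ 2 * ‖ue‖)) := by
    refine abs_sum_le_mul_of_forall I _ (by positivity) fun i hi => ?_
    rw [abs_mul]
    exact mul_le_mul (hlamN i hi) (ContinuousLinearMap.le_of_opNorm_le _ (hRc i) ue)
      (abs_nonneg _) (by positivity)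
  have b5 : |∑ i ∈ I, D i * (fderiv ℝ (P.c i) (y' t') - fderiv ℝ (P.c i) y) ue| ≤
      m₁ * (multSize I D D' * ((1 + κ) * lg1 * ‖d‖ * ‖ue‖)) := by
    refine abs_sum_le_mul_of_forall I _ (by have := multSize_nonneg I D D'; positivity)
      fun i hi => ?_
    rw [abs_mul]
    have hb : ‖fderiv ℝ (P.c i) (y' t') - fderiv ℝ (P.c i) y‖ ≤ (1 + κ) * lg1 * ‖d‖ :=
      (hDc i).trans (mul_le_mul_of_nonneg_right hkl (norm_nonneg _))
    exact mul_le_mul (abs_le_multSize D D' hi) (ContinuousLinearMap.le_of_opNorm_le _ hb ue)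
      (abs_nonneg _) (multSize_nonneg _ _ _)
  have hfinal := gradient_error_bound (k := 1 + κ) (m := 1 + m₁) (N := 1 + |Λ|) (l := lg1)
    (S := s⁻¹) (M := μ⁻¹) (A := lf0 * μ⁻¹) (lh := lh2) (f := lf0) (τ := |t' - t|) (e := ‖e‖)
    (d := ‖d‖) (ue := ‖ue‖) (ve := multSize I ve we) (Δ := multSize I D D') (by linarith)
    (by linarith) hN1 hlg1 ((one_le_inv₀ hs).2 hs1) ((one_le_inv₀ hμ).2 hμ1) hlf0 hlh2 rfl
    (abs_nonneg _) (norm_nonneg _) (norm_nonneg _) hyt'.2 hue'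
    hve' (multSize_nonneg _ _ _) hΔ
  refine le_trans ?_ hfinal
  have z1 : 0 ≤ multSize I ve we * ((1 + κ) * lg1 * ‖d‖ ^ 2) := by
    have := multSize_nonneg I ve we; positivity
  have z2 : 0 ≤ (1 + |Λ|) * (lh2 * ‖d‖ ^ 2 * ‖ue‖) := by positivity
  have z3 : 0 ≤ multSize I D D' * ((1 + κ) * lg1 * ‖d‖ * ‖ue‖) := by
    have := multSize_nonneg I D D'; positivity
  rw [Real.norm_eq_abs] at b1
  refine (abs_add_le _ _).trans ?_
  refine (add_le_add (abs_add_le _ _) le_rfl).trans ?_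
  refine (add_le_add (add_le_add (abs_add_le _ _) le_rfl) le_rfl).trans ?_
  refine (add_le_add (add_le_add (add_le_add (abs_add_le _ _) le_rfl) le_rfl) le_rfl).trans ?_
  linarith

end Bilevel

end

/-! ### Assembly of the two estimates. -/

theorem mainTheorem1 :
    ∃ C : ℕ → ℝ → ℝ → ℝ,
      ∀ (dx dy m₁ m₂ : ℕ) (P : Bilevel dx dy m₁ m₂) (ρ μ δ σ₀ lf0 lf1 lg1 Cf : ℝ),
        0 < ρ → 0 < μ → 0 < δ → 0 < σ₀ →
        P.Smooth lf0 lf1 lg1 Cf →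
        ρ * (lg1 + σ₀ * lf1) < 1 →
        P.ProxEB ρ μ δ σ₀ →
        (∀ x ∈ P.X, ∀ σ : ℝ, 0 < σ → σ ≤ σ₀ → 2 * Cf * σ ≤ δ →
          0 ≤ P.psi x - P.psiPen σ x ∧
            P.psi x - P.psiPen σ x ≤ lf0 ^ 2 / (2 * μ) * σ) ∧
        (∀ (κ Λ s lh2 : ℝ),
          1 ≤ lf0 → 1 ≤ lg1 → 0 ≤ lh2 → μ ≤ 1 → 0 < s → s ≤ 1 →
          lf1 ≤ κ * lg1 → (∀ i, ∀ y ∈ P.Y, ‖hessForm (P.c i) y‖ ≤ κ * lg1) →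
          ∀ x ∈ P.X, ∀ (I : Finset (Fin m₁)) (y : ℝ → Euc dy) (lam : ℝ → Fin m₁ → ℝ)
            (nu : ℝ → Fin m₂ → ℝ), P.RegularPath x σ₀ s lh2 Λ I y lam nu →
          ∃ v : Euc dx, HasRelGradient P.psi v P.X x ∧
            ∀ σ : ℝ, 0 < σ → σ ≤ σ₀ → σ ≤ 1 → 2 * Cf * σ ≤ δ →
              ∃ w : Euc dx, HasRelGradient (P.psiPen σ) w P.X x ∧
                ‖w - v‖ ≤ C m₁ κ Λ *
                  (lg1 ^ 4 * lf0 ^ 3 / (μ ^ 3 * s ^ 3) +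
                    lh2 * lg1 ^ 2 * lf0 ^ 3 / (μ ^ 3 * s ^ 2)) * σ) := by
  refine ⟨fun m κ Λ => 24 * (1 + κ) ^ 3 * (1 + m) ^ 2 * (1 + |Λ|), ?_⟩
  intro dx dy m₁ m₂ P ρ μ δ σ₀ lf0 lf1 lg1 Cf hρ hμ hδ hσ₀ hP _ hEB
  refine ⟨fun x hx σ hσ hσσ _ =>
    Bilevel.psi_sub_psiPen_bounds hP hρ hμ hδ hσ₀ hEB hx hσ hσσ, ?_⟩
  intro κ Λ s lh2 hlf0 hlg1 hlh2 hμ1 hs hs1 hκ hc x hx I y lam nu hpath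
  have hsol : ∀ t ∈ Icc 0 σ₀, ∃ u ∈ P.critSpace I (y t), ∃ v w,
      P.lagForm x t I (y t) (lam t) u +
        (fderiv ℝ (jointFun P.f) (pairPt x (y t))).comp (inY dx dy) =
          P.conGrad I (y t) v w := fun t ht => by
    obtain ⟨u, hu, v, w, huv, -, -⟩ := (hpath.regular t ht).exists_bounded_solution hP hρ hμ hδ hEB
      hx ht hs (hpath.sing t ht) ((fderiv ℝ (jointFun P.f) (pairPt x (y t))).comp (inY dx dy))
      (fun z hz hz0 => (hpath.regular t ht).fderiv_f_kernel hP hρ hμ hδ hσ₀ hEB hx ht hs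
        (hpath.sing t ht) hz hz0)
    exact ⟨u, hu, v, w, huv⟩
  choose! u hu v' w' huv using hsol
  have h0 : (0 : ℝ) ∈ Icc 0 σ₀ := ⟨le_rfl, hσ₀.le⟩
  obtain ⟨v, hv, hve⟩ := exists_hasRelGradient_of_hasFDerivWithinAt hx
    (Bilevel.hasFDerivWithinAt_psi hP hρ hμ hδ hσ₀ hEB hx (hpath.regular 0 h0) hs
      (hpath.sing 0 h0) (hu 0 h0) (huv 0 h0))
  refine ⟨v, hv, fun σ hσ hσσ hσ1 _ => ?_⟩
  have hσI : σ ∈ Icc 0 σ₀ := ⟨hσ.le, hσσ⟩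
  obtain ⟨w, hw, hwe⟩ := exists_hasRelGradient_of_hasFDerivWithinAt hx
    (Bilevel.hasFDerivWithinAt_psiPen hP hρ hμ hδ hEB hx hσ.le hσσ (hpath.regular σ hσI).mem
      (hpath.regular 0 h0).mem)
  refine ⟨w, hw, ?_⟩
  -- The expansion is tested in the direction `w - v` itself, so one factor `‖w - v‖` cancels at the
  -- end.
  have he : w - v ∈ vectorSpan ℝ P.X := Submodule.sub_mem _ hw.2 hv.2
  have hexp := abs_sub_sub_le_of_local_expansion hσ
    (p := fun t => fderiv ℝ (jointFun (P.h t)) (pairPt x (y t)) (inX dx dy (w - v)))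
    (D := fun t => fderiv ℝ (jointFun P.f) (pairPt x (y t)) (inX dx dy (w - v)) +
      hessForm (jointFun (P.h t)) (pairPt x (y t)) (inY dx dy (u t)) (inX dx dy (w - v)))
    (B := 24 * (1 + κ) ^ 3 * (1 + m₁) ^ 2 * (1 + |Λ|) *
        (lg1 ^ 4 * lf0 ^ 3 * (μ⁻¹ ^ 3 * s⁻¹ ^ 3) + lh2 * lg1 ^ 2 * lf0 ^ 3 * (μ⁻¹ ^ 3 * s⁻¹ ^ 2)) *
          ‖w - v‖) (fun t ht => by
      have htI : t ∈ Icc 0 σ₀ := ⟨ht.1, ht.2.trans hσσ⟩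
      have h1 := (hpath.regular t htI).local_expansion hP hρ hμ hδ hEB hx htI hs
        (hpath.sing t htI) hlf0 hlg1 hlh2 hμ1 hs1 (ht.2.trans hσ1) hκ hc (hpath.lam_le t htI)
        (hpath.f_lip t htI) (hpath.g_lip t htI) (hpath.c_lip t htI) (hu t htI) (huv t htI) he
      filter_upwards [nhdsWithin_mono t (Icc_subset_Icc_right hσσ) h1, self_mem_nhdsWithin]
        with t' ht' ht'I
      have := ht' _ (hpath.regular t' ⟨ht'I.1, ht'I.2.trans hσσ⟩).mem
      rwa [sq_abs] at this)
  have e1 := hwe _ he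
  have e2 := hve _ he
  simp only [smul_apply, sub_apply, add_apply, ContinuousLinearMap.comp_apply, smul_eq_mul]
    at e1 e2
  have e3 : ‖w - v‖ * ‖w - v‖ * σ =
      fderiv ℝ (jointFun (P.h σ)) (pairPt x (y σ)) (inX dx dy (w - v)) -
      fderiv ℝ (jointFun (P.h 0)) (pairPt x (y 0)) (inX dx dy (w - v)) -
      σ * (fderiv ℝ (jointFun P.f) (pairPt x (y 0)) (inX dx dy (w - v)) +
      hessForm (jointFun (P.h 0)) (pairPt x (y 0)) (inY dx dy (u 0)) (inX dx dy (w - v))) := by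
    rw [← real_inner_self_eq_norm_mul_norm, inner_sub_left, e1, e2]
    field_simp
  have e4 := (le_abs_self _).trans hexp
  rw [← e3] at e4
  rcases (norm_nonneg (w - v)).eq_or_lt with h | h
  · have hκ0 : 0 ≤ κ := by
      have := hP.lf1_nonneg hx
      by_contra! h; nlinarith
    rw [← h]; positivity
  · rw [div_eq_mul_inv, div_eq_mul_inv, mul_inv, mul_inv, ← inv_pow, ← inv_pow, ← inv_pow]
    have e5 : (‖w - v‖ * σ) * ‖w - v‖ ≤ (‖w - v‖ * σ) *
        (24 * (1 + κ) ^ 3 * (1 + m₁) ^ 2 * (1 + |Λ|) *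
        (lg1 ^ 4 * lf0 ^ 3 * (μ⁻¹ ^ 3 * s⁻¹ ^ 3) +
          lh2 * lg1 ^ 2 * lf0 ^ 3 * (μ⁻¹ ^ 3 * s⁻¹ ^ 2)) * σ) := by linarith
    exact le_of_mul_le_mul_left e5 (by positivity)
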